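/- **Conventions.** $[X]$ is the closed linear span of $X$; for sets of operators, $XY=\{xy\}$. A *$C^*$-base* $\mathfrak b=(\mathfrak K,\mathfrak B,\mathfrak B^\dagger)$ consists of a Hilbert space $\mathfrak K$ and two commuting nondegenerate $C^*$-algebras $\mathfrak B,\mathfrak B^\dagger\subseteq\mathcal L(\mathfrak K)$; put $\mathfrak b^\dagger=(\mathfrak K,\mathfrak B^\dagger,\mathfrak B)$. A *$C^*$-$\mathfrak b$-module* is a Hilbert space $H$ with a closed subspace $\alpha\subseteq\mathcal L(\mathfrak K,H)$ such that $[\alpha\mathfrak K]=H$, $[\alpha\mathfrak B]=\alpha$, $[\alpha^*\alpha]=\mathfrak B$. For $c\in\mathfrak B^\dagger$ let $\rho_\alpha(c)\in\mathcal L(H)$, $\rho_\alpha(c)\xi\zeta=\xi c\zeta$ ($\xi\in\alpha$, $\zeta\in\mathfrak K$), and let $M(\alpha)=\{T\in\mathcal L(\mathfrak K,H): T\mathfrak B\subseteq\alpha,\ T^*\alpha\subseteq\mathfrak B\}$; for $C^*$-$\mathfrak b^\dagger$-modules exchange $\mathfrak B$ and $\mathfrak B^\dagger$. A Hilbert space with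 several module structures $\alpha_i$ over $\mathfrak b_i\in\{\mathfrak b,\mathfrak b^\dagger\}$ is a *$C^*$-$(\mathfrak b_1,\dots,\mathfrak b_n)$-module* if $[\rho_{\alpha_i}(\mathfrak C_i)\alpha_j]=\alpha_j$ for $i\ne j$, $\mathfrak C_i$ being the second algebra of $\mathfrak b_i$. For a $C^*$-$\mathfrak b$-module $(H,\beta)$ and a $C^*$-$\mathfrak b^\dagger$-module $(K,\gamma)$, $H\,{}_\beta\!\otimes_\gamma K$ is the Hilbert space generated by vectors $\xi\otimes\zeta\otimes\eta$ ($\xi\in\beta$, $\zeta\in\mathfrak K$, $\eta\in\gamma$) with $\langle\xi\otimes\zeta\otimes\eta,\xi'\otimes\zeta'\otimes\eta'\rangle=\langle\zeta,\xi^*\xi'\eta^*\eta'\zeta'\rangle$. Define $|\xi\rangle_1:K\to H\,{}_\beta\!\otimes_\gamma K$, $\eta\zeta\mapsto\xi\otimes\zeta\otimes\eta$, and $|\eta\rangle_2:H\to H\,{}_\beta\!\otimes_\gamma K$, $\xi\zeta\mapsto\xi\otimes\zeta\otimes\eta$; the adjoints are $\langle\xi|_1,\langle\eta|_2$, and these operators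 are defined likewise for $\xi\in M(\beta)$, $\eta\in M(\gamma)$ (through $\langle\xi|_1(\xi'\otimes\zeta\otimes\eta)=\eta\xi^*\xi'\zeta$ and $\langle\eta|_2(\xi\otimes\zeta\otimes\eta')=\xi\eta^*\eta'\zeta$). Put $\alpha\triangleleft\gamma=[|\gamma\rangle_2\alpha]$ and $\beta\triangleright\delta=[|\beta\rangle_1\delta]$ for further module structures $\alpha$ on $H$, $\delta$ on $K$. **Pseudo-multiplicative unitaries.** A *$C^*$-pseudo-multiplicative unitary* is a $C^*$-$(\mathfrak b^\dagger,\mathfrak b,\mathfrak b^\dagger)$-module $(H,\widehat\beta,\alpha,\beta)$ with a unitary $V:H\,{}_{\widehat\beta}\!\otimes_\alpha H\to H\,{}_\alpha\!\otimes_\beta H$ such that $$V(\alpha\triangleleft\alpha)=\alpha\triangleright\alpha,\quad V(\widehat\beta\triangleright\beta)=\widehat\beta\triangleleft\beta,\quad V(\widehat\beta\triangleright\widehat\beta)=\alpha\triangleright\widehat\beta,\quad V(\beta\triangleleft\alpha)=\beta\triangleleft\beta,$$ and such that the pentagon equation $V_{12}V_{13}V_{23}=V_{23}V_{12}$ holds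 on the threefold relative tensor product. Put $$\widehat A_V=[\langle\beta|_2V|\alpha\rangle_2]\subseteq\mathcal L(H),\qquad \widehat\Delta_V(\hat a)=V^*(\mathrm{id}\otimes\hat a)V .$$ $V$ is *regular* if $[\langle\alpha|_1V|\alpha\rangle_2]=[\alpha\alpha^*]$. A *cofixed element* for $V$ is $\xi\in M(\alpha)\cap M(\beta)$ with $V|\xi\rangle_2=|\xi\rangle_2$. $V$ is *proper* if $\xi_0^*\xi_0=\mathrm{id}_{\mathfrak K}$ for some cofixed $\xi_0$. **Hopf $C^*$-bimodules.** Let $\mathfrak c=(\mathfrak K,\mathfrak C,\mathfrak C^\dagger)$ be a $C^*$-base. A *Hopf $C^*$-bimodule* over $\mathfrak c$ is a $C^*$-$(\mathfrak c^\dagger,\mathfrak c)$-module $(H,\sigma,\tau)$ with a $C^*$-algebra $A\subseteq\mathcal L(H)$ such that $\rho_\sigma(\mathfrak C)A\subseteq A$, $\rho_\tau(\mathfrak C^\dagger)A\subseteq A$, and a $*$-homomorphism $\Delta:A\to\mathcal L(H\,{}_\tau\!\otimes_\sigma H)$ such that * $\Delta(A)\subseteq A\,{}_\tau\!*_\sigma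 A:=\{x: x|\tau\rangle_1,\,x^*|\tau\rangle_1\subseteq[|\tau\rangle_1A],\ x|\sigma\rangle_2,\,x^*|\sigma\rangle_2\subseteq[|\sigma\rangle_2A]\}$; * (joint semi-normality) if $\mathcal S$ is the set of all $S\in\mathcal L(H,H\,{}_\tau\!\otimes_\sigma H)$ with $Sa=\Delta(a)S$ for $a\in A$, $S\sigma\subseteq\sigma\triangleleft\sigma$ and $S\tau\subseteq\tau\triangleright\tau$, then $[\mathcal S\sigma]=\sigma\triangleleft\sigma$ and $[\mathcal S\tau]=\tau\triangleright\tau$; * (coassociativity) $(\Delta*\mathrm{id})\Delta=(\mathrm{id}*\Delta)\Delta$ on $H\,{}_\tau\!\otimes_\sigma H\,{}_\tau\!\otimes_\sigma H$, where $(\Delta*\mathrm{id})(x)(S\otimes\mathrm{id})=(S\otimes\mathrm{id})x$ for all operators $S$ with $Sa=\Delta(a)S$ ($a\in A$) and $S\tau\subseteq\tau\triangleright\tau$, and similarly for $\mathrm{id}*\Delta$ (with $S\sigma\subseteq\sigma\triangleleft\sigma$). A *bounded left Haar weight* for it is a completely positive contraction $\phi:A\to\mathfrak C$ with $a\rho_\sigma(b)\in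 A$, $\langle\xi|_1\Delta(a)|\xi'\rangle_1\in A$ and $$\phi(a\rho_\sigma(b))=\phi(a)b,\qquad \phi(\langle\xi|_1\Delta(a)|\xi'\rangle_1)=\xi^*\rho_\sigma(\phi(a))\xi'\qquad(a\in A,\ b\in\mathfrak C,\ \xi,\xi'\in\tau).$$ It is *normal* if $\phi(a)=\sum_k\eta_k^*a\eta_k'$ (in norm, for all $a\in A$) for sequences $(\eta_k),(\eta'_k)$ in $M(\sigma)$ for which $\sum_k\eta_k^*\eta_k$ and $\sum_k\eta_k'^*\eta'_k$ converge in norm. **Theorem.** Let $V$ be a proper regular $C^*$-pseudo-multiplicative unitary as above. Then $(\widehat A_V,\widehat\Delta_V)$, with $(H,\alpha,\widehat\beta)$ (that is, $\sigma=\alpha$, $\tau=\widehat\beta$), is a Hopf $C^*$-bimodule over $\mathfrak b^\dagger$, and there exists a normal bounded left Haar weight $\widehat A_V\to\mathfrak B^\dagger$ for it. More precisely, for every cofixed element $\xi_0$ for $V$ with $\xi_0^*\xi_0=\mathrm{id}_{\mathfrak K}$ (at least one exists, as $V$ is proper), the map $\phi(\hat a)=\xi_0^*\hat a\,\xi_0$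 is a normal bounded left Haar weight for $(\widehat A_V,\widehat\Delta_V)$. -/

import Mathlib

open ContinuousLinearMap
open scoped InnerProductSpace ComplexOrder

noncomputable section

namespace CPMU

/-- The closed linear span `[s]`. -/
def cspan {E : Type*} [NormedAddCommGroup E] [NormedSpace ℂ E] (s : Set E) : Submodule ℂ E :=
  (Submodule.span ℂ s).topologicalClosure

section Extension

/-- The bounded operator `T` with `T (f i) = g i` for all `i`. It is used for families `f` with
dense linear span, for which there is at most one such `T` (and it is `0` if there is none). -/
def extendOp {ι E F : Type*} [NormedAddCommGroup E] [NormedSpace ℂ E] [NormedAddCommGroup F]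
    [NormedSpace ℂ F] (f : ι → E) (g : ι → F) : E →L[ℂ] F :=
  open Classical in
  if h : ∃ T : E →L[ℂ] F, ∀ i, T (f i) = g i then h.choose else 0

variable {ι E F : Type*} [NormedAddCommGroup E] [NormedSpace ℂ E] [NormedAddCommGroup F]
    [NormedSpace ℂ F] {f : ι → E} {g : ι → F}

theorem extendOp_apply (h : ∃ T : E →L[ℂ] F, ∀ i, T (f i) = g i) (i : ι) :
    extendOp f g (f i) = g i := by
  unfold extendOp
  rw [dif_pos h]
  exact h.choose_spec i

theorem ext_of_total (hf : cspan (Set.range f) = ⊤) {S T : E →L[ℂ] F}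
    (h : ∀ i, S (f i) = T (f i)) : S = T := by
  refine ContinuousLinearMap.ext_on (s := Set.range f) ?_ ?_
  · rw [dense_iff_closure_eq, ← Submodule.topologicalClosure_coe]
    change ((cspan (Set.range f) : Submodule ℂ E) : Set E) = _
    rw [hf]; rfl
  · rintro _ ⟨i, rfl⟩; exact h i

theorem extendOp_eq (hf : cspan (Set.range f) = ⊤) {T : E →L[ℂ] F} (h : ∀ i, T (f i) = g i) :
    extendOp f g = T :=
  ext_of_total hf fun i => by rw [extendOp_apply ⟨T, h⟩, h]

theorem exists_extension [CompleteSpace F] (hf : cspan (Set.range f) = ⊤) (C : ℝ)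
    (hC : ∀ (s : Finset ι) (a : ι → ℂ), ‖∑ i ∈ s, a i • g i‖ ≤ C * ‖∑ i ∈ s, a i • f i‖) :
    ∃ T : E →L[ℂ] F, ∀ i, T (f i) = g i := by
  classical
  let e := Finsupp.linearCombination ℂ f
  let k := Finsupp.linearCombination ℂ g
  have hd : DenseRange e := by
    rw [DenseRange, dense_iff_closure_eq, ← LinearMap.coe_range,
      Finsupp.range_linearCombination, ← Submodule.topologicalClosure_coe]
    change ((cspan (Set.range f) : Submodule ℂ E) : Set E) = _
    rw [hf]; rfl
  have hb : ∀ x, ‖k x‖ ≤ C * ‖e x‖ := fun x => by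
    simpa [e, k, Finsupp.linearCombination_apply, Finsupp.sum] using hC x.support x
  refine ⟨k.extendOfNorm e, fun i => ?_⟩
  have := LinearMap.extendOfNorm_eq (f := k) hd ⟨C, hb⟩ (Finsupp.single i 1)
  simpa [e, k] using this

end Extension

section Root

variable {𝔎 H : Type*} [NormedAddCommGroup 𝔎] [InnerProductSpace ℂ 𝔎] [CompleteSpace 𝔎]
  [NormedAddCommGroup H] [InnerProductSpace ℂ H] [CompleteSpace H]

/-- The entries of the square root of the positive operator matrix with entries `ξ i† ξ j`. -/
theorem exists_root {ι : Type*} [Fintype ι] (ξ : ι → 𝔎 →L[ℂ] H) :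
    ∃ c : ι → ι → 𝔎 →L[ℂ] 𝔎,
      (∀ i j x y, ⟪ξ i x, ξ j y⟫_ℂ = ∑ k, ⟪c k i x, c k j y⟫_ℂ) ∧
      ∀ d : 𝔎 →L[ℂ] 𝔎, (∀ i j, Commute d (adjoint (ξ i) ∘L ξ j)) → ∀ k j x, d (c k j x) = c k j (d x) := by
  classical
  let E := PiLp 2 (fun _ : ι => 𝔎)
  let pr : ι → E →L[ℂ] 𝔎 := fun k => PiLp.proj 2 (fun _ : ι => 𝔎) k
  let sg : ι → 𝔎 →L[ℂ] E := fun k => adjoint (pr k)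
  have hsg : ∀ k x j, pr j (sg k x) = if j = k then x else 0 := by
    intro k x j
    have : sg k x = WithLp.toLp 2 (Pi.single k x) := by
      refine ext_inner_right ℂ fun v => ?_
      rw [adjoint_inner_left, PiLp.inner_apply, Finset.sum_eq_single k]
      · simp [pr]; rfl
      · intro b _ hb; simp [hb]
      · simp
    rw [this]
    change (Pi.single k x : ι → 𝔎) j = _
    rw [Pi.single_apply]
  have hsum : ∀ v : E, ∑ k, sg k (pr k v) = v := by
    intro v
    ext j
    have : ∀ w : E, w j = pr j w := fun w => rfl
    rw [this, map_sum]
    simp [hsg]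
    rfl
  let X : E →L[ℂ] H := ∑ i, ξ i ∘L pr i
  have hX : ∀ i x, X (sg i x) = ξ i x := by
    intro i x
    simp only [X, sum_apply, comp_apply, hsg]
    rw [Finset.sum_eq_single i] <;> simp +contextual
  let T : E →L[ℂ] E := adjoint X ∘L X
  have hT : 0 ≤ T := by
    rw [nonneg_iff_isPositive]
    exact isPositive_adjoint_comp_self X
  let R : E →L[ℂ] E := CFC.sqrt T
  have hR0 : 0 ≤ R := CFC.sqrt_nonneg T
  have hRsa : adjoint R = R := (IsSelfAdjoint.of_nonneg hR0)
  have hRR : R * R = T := CFC.sqrt_mul_sqrt_self T hT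
  refine ⟨fun k j => pr k ∘L R ∘L sg j, ?_, ?_⟩
  · intro i j x y
    have h1 : ∑ k, ⟪(pr k ∘L R ∘L sg i) x, (pr k ∘L R ∘L sg j) y⟫_ℂ = ⟪R (sg i x), R (sg j y)⟫_ℂ := by
      rw [PiLp.inner_apply]; rfl
    rw [h1, ← adjoint_inner_right R, hRsa]
    have h2 : R (R (sg j y)) = T (sg j y) := by rw [← hRR]; rfl
    rw [h2]
    simp only [T, comp_apply, adjoint_inner_right, hX]
  · intro d hd k j x
    let D : E →L[ℂ] E := ∑ i, sg i ∘L d ∘L pr i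
    have hDs : ∀ i x, D (sg i x) = sg i (d x) := by
      intro i x
      simp only [D, sum_apply, comp_apply, hsg]
      rw [Finset.sum_eq_single i] <;> simp +contextual
    have hpD : ∀ i v, pr i (D v) = d (pr i v) := by
      intro i v
      simp only [D, sum_apply, comp_apply, map_sum, hsg]
      simp
    have hTs : ∀ i v, pr i (T v) = ∑ l, adjoint (ξ i) (ξ l (pr l v)) := by
      intro i v
      refine ext_inner_left ℂ fun u => ?_
      rw [← adjoint_inner_left]
      simp only [T, comp_apply]
      rw [adjoint_inner_right]
      change ⟪X (sg i u), _⟫_ℂ = _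
      rw [hX]
      simp [X, inner_sum, adjoint_inner_right]
    have hDT : Commute D T := by
      refine ContinuousLinearMap.ext fun v => ?_
      ext i
      change pr i (D (T v)) = pr i (T (D v))
      rw [hpD, hTs, hTs, map_sum]
      refine Finset.sum_congr rfl fun l _ => ?_
      rw [hpD]
      exact congrArg (fun f : 𝔎 →L[ℂ] 𝔎 => f (pr l v)) (hd i l)
    have hDR : Commute R D := by
      have := Commute.cfcₙ_nnreal hDT.symm NNReal.sqrt
      exact this
    have h3 := congrArg (fun f : E →L[ℂ] E => pr k (f (sg j x))) hDR
    change pr k (R (D (sg j x))) = pr k (D (R (sg j x))) at h3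
    rw [hDs, hpD] at h3
    exact h3.symm

set_option linter.unusedSectionVars false in
theorem norm_sq_root {ι : Type*} [Fintype ι] {ξ : ι → 𝔎 →L[ℂ] H} {c : ι → ι → 𝔎 →L[ℂ] 𝔎}
    (hc : ∀ i j x y, ⟪ξ i x, ξ j y⟫_ℂ = ∑ k, ⟪c k i x, c k j y⟫_ℂ) (z : ι → 𝔎) :
    ‖∑ i, ξ i (z i)‖ ^ 2 = ∑ k, ‖∑ i, c k i (z i)‖ ^ 2 := by
  have h : ((‖∑ i, ξ i (z i)‖ : ℂ)) ^ 2 = ∑ k, (‖∑ i, c k i (z i)‖ : ℂ) ^ 2 := by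
    have e1 : ∀ v : H, (‖v‖ : ℂ) ^ 2 = ⟪v, v⟫_ℂ := fun v => (inner_self_eq_norm_sq_to_K v).symm
    have e2 : ∀ v : 𝔎, (‖v‖ : ℂ) ^ 2 = ⟪v, v⟫_ℂ := fun v => (inner_self_eq_norm_sq_to_K v).symm
    simp only [e1, e2, sum_inner, inner_sum, hc]
    refine (Finset.sum_congr rfl fun i _ => Finset.sum_comm).trans ?_
    exact Finset.sum_comm
  exact_mod_cast h

end Root

/-- A `C*`-base: two commuting nondegenerate `C*`-algebras on a Hilbert space. -/
structure CStarBase (𝔎 : Type*) [NormedAddCommGroup 𝔎] [InnerProductSpace ℂ 𝔎]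
    [CompleteSpace 𝔎] where
  B : NonUnitalStarSubalgebra ℂ (𝔎 →L[ℂ] 𝔎)
  Bd : NonUnitalStarSubalgebra ℂ (𝔎 →L[ℂ] 𝔎)
  isClosed_B : IsClosed (B : Set (𝔎 →L[ℂ] 𝔎))
  isClosed_Bd : IsClosed (Bd : Set (𝔎 →L[ℂ] 𝔎))
  commute : ∀ b ∈ B, ∀ c ∈ Bd, Commute b c
  nondegenerate_B : cspan {v : 𝔎 | ∃ b ∈ B, ∃ ζ : 𝔎, b ζ = v} = ⊤
  nondegenerate_Bd : cspan {v : 𝔎 | ∃ c ∈ Bd, ∃ ζ : 𝔎, c ζ = v} = ⊤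

/-- The base `𝔟† = (𝔎, 𝔅†, 𝔅)`. -/
def CStarBase.dagger {𝔎 : Type*} [NormedAddCommGroup 𝔎] [InnerProductSpace ℂ 𝔎]
    [CompleteSpace 𝔎] (𝔟 : CStarBase 𝔎) : CStarBase 𝔎 where
  B := 𝔟.Bd
  Bd := 𝔟.B
  isClosed_B := 𝔟.isClosed_Bd
  isClosed_Bd := 𝔟.isClosed_B
  commute := fun b hb c hc => (𝔟.commute c hc b hb).symm
  nondegenerate_B := 𝔟.nondegenerate_Bd
  nondegenerate_Bd := 𝔟.nondegenerate_B

section Modules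

variable {𝔎 H : Type*} [NormedAddCommGroup 𝔎] [InnerProductSpace ℂ 𝔎] [CompleteSpace 𝔎]
  [NormedAddCommGroup H] [InnerProductSpace ℂ H] [CompleteSpace H]

/-- `(H, α)` is a `C*`-`𝔟`-module. -/
structure IsCStarModule (𝔟 : CStarBase 𝔎) (α : Submodule ℂ (𝔎 →L[ℂ] H)) : Prop where
  isClosed : IsClosed (α : Set (𝔎 →L[ℂ] H))
  total : cspan {v : H | ∃ ξ ∈ α, ∃ ζ : 𝔎, ξ ζ = v} = ⊤
  mul_eq : cspan {T : 𝔎 →L[ℂ] H | ∃ ξ ∈ α, ∃ b ∈ 𝔟.B, ξ ∘L b = T} = α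
  inner_eq : (cspan {T : 𝔎 →L[ℂ] 𝔎 | ∃ ξ ∈ α, ∃ ξ' ∈ α, adjoint ξ ∘L ξ' = T} :
    Set (𝔎 →L[ℂ] 𝔎)) = 𝔟.B

/-- The operator `ρ_α(c)` on `H`, determined by `ρ_α(c) ξζ = ξcζ` for `ξ ∈ α`, `ζ ∈ 𝔎`. -/
def rho (α : Submodule ℂ (𝔎 →L[ℂ] H)) (c : 𝔎 →L[ℂ] 𝔎) : H →L[ℂ] H :=
  extendOp (fun p : α × 𝔎 => (p.1 : 𝔎 →L[ℂ] H) p.2) (fun p => (p.1 : 𝔎 →L[ℂ] H) (c p.2))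

/-- `[ρ_α(𝔅†) γ] = γ`, where `(H, α)` is a module over a base whose second algebra is `C`. -/
def Compatible (C : NonUnitalStarSubalgebra ℂ (𝔎 →L[ℂ] 𝔎)) (α γ : Submodule ℂ (𝔎 →L[ℂ] H)) :
    Prop :=
  cspan {T : 𝔎 →L[ℂ] H | ∃ c ∈ C, ∃ ξ ∈ γ, rho α c ∘L ξ = T} = γ

/-- `M(γ) = {T | T B ⊆ γ, T† γ ⊆ B}`, where `(H, γ)` is a module over a base with first
algebra `B`. -/
def multiplierSpace (B : NonUnitalStarSubalgebra ℂ (𝔎 →L[ℂ] 𝔎))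
    (γ : Submodule ℂ (𝔎 →L[ℂ] H)) : Set (𝔎 →L[ℂ] H) :=
  {T | (∀ b ∈ B, T ∘L b ∈ γ) ∧ ∀ ξ ∈ γ, adjoint T ∘L ξ ∈ B}

theorem IsCStarModule.inner_mem {𝔟 : CStarBase 𝔎} {α : Submodule ℂ (𝔎 →L[ℂ] H)}
    (h : IsCStarModule 𝔟 α) {ξ ξ' : 𝔎 →L[ℂ] H} (hξ : ξ ∈ α) (hξ' : ξ' ∈ α) :
    adjoint ξ ∘L ξ' ∈ 𝔟.B := by
  have : adjoint ξ ∘L ξ' ∈ (𝔟.B : Set (𝔎 →L[ℂ] 𝔎)) := by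
    rw [← h.inner_eq]
    exact Submodule.le_topologicalClosure _ (Submodule.subset_span ⟨ξ, hξ, ξ', hξ', rfl⟩)
  exact this

theorem IsCStarModule.total' {𝔟 : CStarBase 𝔎} {α : Submodule ℂ (𝔎 →L[ℂ] H)}
    (h : IsCStarModule 𝔟 α) :
    cspan (Set.range fun p : α × 𝔎 => (p.1 : 𝔎 →L[ℂ] H) p.2) = ⊤ := by
  rw [← h.total]
  congr 1
  ext v
  simp

theorem rho_apply {𝔟 : CStarBase 𝔎} {α : Submodule ℂ (𝔎 →L[ℂ] H)} (h : IsCStarModule 𝔟 α)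
    {c : 𝔎 →L[ℂ] 𝔎} (hc : c ∈ 𝔟.Bd) {ξ : 𝔎 →L[ℂ] H} (hξ : ξ ∈ α) (ζ : 𝔎) :
    rho α c (ξ ζ) = ξ (c ζ) := by
  classical
  refine extendOp_apply (f := fun p : α × 𝔎 => (p.1 : 𝔎 →L[ℂ] H) p.2) ?_ (⟨ξ, hξ⟩, ζ)
  refine exists_extension h.total' ‖c‖ fun s a => ?_
  let x : s → 𝔎 →L[ℂ] H := fun i => ((i : α × 𝔎).1 : 𝔎 →L[ℂ] H)
  obtain ⟨r, hr, hrc⟩ := exists_root x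
  have hcom : ∀ k j v, c (r k j v) = r k j (c v) := hrc c fun i j =>
    (𝔟.commute _ (h.inner_mem (i : α × 𝔎).1.2 (j : α × 𝔎).1.2) c hc).symm
  have e1 : ∑ i ∈ s, a i • (i.1 : 𝔎 →L[ℂ] H) (c i.2)
      = ∑ i : s, x i (c (a i • (i : α × 𝔎).2)) := by
    rw [← Finset.sum_coe_sort]; simp [x]
  have e2 : ∑ i ∈ s, a i • (i.1 : 𝔎 →L[ℂ] H) i.2 = ∑ i : s, x i (a i • (i : α × 𝔎).2) := by
    rw [← Finset.sum_coe_sort]; simp [x]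
  rw [e1, e2]
  refine (sq_le_sq₀ (norm_nonneg _) (by positivity)).mp ?_
  rw [mul_pow, norm_sq_root hr, norm_sq_root hr, Finset.mul_sum]
  refine Finset.sum_le_sum fun k _ => ?_
  simp_rw [← hcom]
  rw [← map_sum, ← mul_pow]
  gcongr
  exact c.le_opNorm _

end Modules

section RelativeTensorProduct

variable {𝔎 H K : Type*} [NormedAddCommGroup 𝔎] [InnerProductSpace ℂ 𝔎] [CompleteSpace 𝔎]
  [NormedAddCommGroup H] [InnerProductSpace ℂ H] [CompleteSpace H]
  [NormedAddCommGroup K] [InnerProductSpace ℂ K] [CompleteSpace K]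

/-- The operator-valued kernel `((ξ, η), (ξ', η')) ↦ ξ†ξ'η†η'` on `β × γ`. -/
def relKernel (β : Submodule ℂ (𝔎 →L[ℂ] H)) (γ : Submodule ℂ (𝔎 →L[ℂ] K)) :
    Matrix (β × γ) (β × γ) (𝔎 →L[ℂ] 𝔎) :=
  Matrix.of fun x y => (adjoint (x.1 : 𝔎 →L[ℂ] H) ∘L y.1) ∘L (adjoint (x.2 : 𝔎 →L[ℂ] K) ∘L y.2)

/-- `relKernel` made total: it is the kernel itself if that is positive semidefinite, which is so
for every `C*`-`𝔟`-module `β` and every `C*`-`𝔟†`-module `γ`, see `relKernel_posSemidef`. -/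
def relKernel' (β : Submodule ℂ (𝔎 →L[ℂ] H)) (γ : Submodule ℂ (𝔎 →L[ℂ] K)) :
    Matrix (β × γ) (β × γ) (𝔎 →L[ℂ] 𝔎) :=
  open Classical in if (relKernel β γ).PosSemidef then relKernel β γ else 0

instance (β : Submodule ℂ (𝔎 →L[ℂ] H)) (γ : Submodule ℂ (𝔎 →L[ℂ] K)) :
    Fact (relKernel' β γ).PosSemidef :=
  ⟨by
    unfold relKernel'
    split_ifs with h
    · exact h
    · exact Matrix.PosSemidef.zero⟩

/-- The relative tensor product `H β⊗γ K`: the Hilbert space generated by vectors `ξ ⊗ ζ ⊗ η`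
(`ξ ∈ β`, `ζ ∈ 𝔎`, `η ∈ γ`) with `⟪ξ ⊗ ζ ⊗ η, ξ' ⊗ ζ' ⊗ η'⟫ = ⟪ζ, ξ†ξ'η†η'ζ'⟫`. -/
def RTP (β : Submodule ℂ (𝔎 →L[ℂ] H)) (γ : Submodule ℂ (𝔎 →L[ℂ] K)) : Type _ :=
  RKHS.OfKernel (relKernel' β γ)

instance (β : Submodule ℂ (𝔎 →L[ℂ] H)) (γ : Submodule ℂ (𝔎 →L[ℂ] K)) :
    NormedAddCommGroup (RTP β γ) :=
  inferInstanceAs (NormedAddCommGroup (RKHS.OfKernel (relKernel' β γ)))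

instance (β : Submodule ℂ (𝔎 →L[ℂ] H)) (γ : Submodule ℂ (𝔎 →L[ℂ] K)) :
    InnerProductSpace ℂ (RTP β γ) :=
  inferInstanceAs (InnerProductSpace ℂ (RKHS.OfKernel (relKernel' β γ)))

instance (β : Submodule ℂ (𝔎 →L[ℂ] H)) (γ : Submodule ℂ (𝔎 →L[ℂ] K)) :
    CompleteSpace (RTP β γ) :=
  inferInstanceAs (CompleteSpace (RKHS.OfKernel (relKernel' β γ)))

variable {β : Submodule ℂ (𝔎 →L[ℂ] H)} {γ : Submodule ℂ (𝔎 →L[ℂ] K)}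

/-- The vector `ξ ⊗ ζ ⊗ η`. -/
def tmul (ξ : β) (ζ : 𝔎) (η : γ) : RTP β γ :=
  (RKHS.kerFun (RKHS.OfKernel (relKernel' β γ)) (ξ, η) ζ : RKHS.OfKernel (relKernel' β γ))

variable (β γ) in
/-- The family of all vectors `ξ ⊗ ζ ⊗ η`. -/
def tmulFamily (p : β × 𝔎 × γ) : RTP β γ := tmul p.1 p.2.1 p.2.2

theorem tmul_total : cspan (Set.range (tmulFamily β γ)) = ⊤ := by
  have h := RKHS.kerFun_dense (RKHS.OfKernel (relKernel' β γ))
  have e : Set.range (tmulFamily β γ) =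
      {v : RTP β γ | ∃ x v', RKHS.kerFun (RKHS.OfKernel (relKernel' β γ)) x v' = v} := by
    ext v
    constructor
    · rintro ⟨p, rfl⟩; exact ⟨_, _, rfl⟩
    · rintro ⟨x, v', rfl⟩; exact ⟨(x.1, v', x.2), rfl⟩
  rw [e]
  exact h

theorem IsCStarModule.commute {𝔟 : CStarBase 𝔎} (hβ : IsCStarModule 𝔟 β)
    (hγ : IsCStarModule 𝔟.dagger γ) {ξ ξ' : 𝔎 →L[ℂ] H} (hξ : ξ ∈ β) (hξ' : ξ' ∈ β)
    {η η' : 𝔎 →L[ℂ] K} (hη : η ∈ γ) (hη' : η' ∈ γ) :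
    Commute (adjoint ξ ∘L ξ') (adjoint η ∘L η') := by
  have h1 := hβ.inner_mem hξ hξ'
  have h2 : adjoint η ∘L η' ∈ 𝔟.Bd := hγ.inner_mem hη hη'
  exact 𝔟.commute _ h1 _ h2

theorem relKernel_posSemidef {𝔟 : CStarBase 𝔎} (hβ : IsCStarModule 𝔟 β)
    (hγ : IsCStarModule 𝔟.dagger γ) : (relKernel β γ).PosSemidef := by
  have hcomm : ∀ (ξ ξ' : β) (η η' : γ),
      Commute (adjoint (ξ : 𝔎 →L[ℂ] H) ∘L (ξ' : 𝔎 →L[ℂ] H))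
        (adjoint (η : 𝔎 →L[ℂ] K) ∘L (η' : 𝔎 →L[ℂ] K)) :=
    fun ξ ξ' η η' => hβ.commute hγ ξ.2 ξ'.2 η.2 η'.2
  have tf := (RKHS.posSemidef_tfae (K := relKernel β γ)).out 0 2
  refine tf.mpr ⟨?_, fun v => ?_⟩
  · ext x y : 2
    simp only [Matrix.conjTranspose_apply, relKernel, Matrix.of_apply, star_eq_adjoint,
      adjoint_comp, adjoint_adjoint]
    exact congrArg (fun f : 𝔎 →L[ℂ] 𝔎 => f _) (hcomm x.1 y.1 x.2 y.2).symm.eq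
  · obtain ⟨r, hr, hrc⟩ := exists_root (fun i : v.support => ((i : β × γ).1 : 𝔎 →L[ℂ] H))
    have hcom : ∀ (a b : v.support) k j z,
        adjoint ((a : β × γ).2 : 𝔎 →L[ℂ] K) (((b : β × γ).2 : 𝔎 →L[ℂ] K) (r k j z))
          = r k j (adjoint ((a : β × γ).2 : 𝔎 →L[ℂ] K) (((b : β × γ).2 : 𝔎 →L[ℂ] K) z)) :=
      fun a b => hrc (adjoint ((a : β × γ).2 : 𝔎 →L[ℂ] K) ∘L ((b : β × γ).2 : 𝔎 →L[ℂ] K))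
        fun i j => (hcomm _ _ _ _).symm
    have key : (v.sum fun x w => v.sum fun x' w' => ⟪relKernel β γ x' x w, w'⟫_ℂ)
        = ∑ k, ⟪∑ i : v.support, ((i : β × γ).2 : 𝔎 →L[ℂ] K) (r k i (v i)),
            ∑ i : v.support, ((i : β × γ).2 : 𝔎 →L[ℂ] K) (r k i (v i))⟫_ℂ := by
      have hs : ∀ x x' : v.support, ⟪relKernel β γ x' x (v x), v x'⟫_ℂ
          = ∑ k, ⟪((x : β × γ).2 : 𝔎 →L[ℂ] K) (r k x (v x)),
              ((x' : β × γ).2 : 𝔎 →L[ℂ] K) (r k x' (v x'))⟫_ℂ := fun x x' => by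
        simp only [relKernel, Matrix.of_apply, comp_apply]
        rw [adjoint_inner_left, hr]
        refine Finset.sum_congr rfl fun k _ => ?_
        rw [← hcom, adjoint_inner_left]
      simp only [Finsupp.sum]
      rw [← Finset.sum_coe_sort]
      simp_rw [← Finset.sum_coe_sort v.support, hs, sum_inner, inner_sum]
      rw [Finset.sum_comm' (t' := Finset.univ) (s' := fun _ => Finset.univ) (by simp)]
      refine (Finset.sum_congr rfl fun i _ => Finset.sum_comm).trans ?_
      rw [Finset.sum_comm]
      refine Finset.sum_congr rfl fun k _ => ?_
      rw [Finset.sum_comm]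
    rw [key, map_sum]
    exact Finset.sum_nonneg fun k _ => inner_self_nonneg

theorem inner_tmul {𝔟 : CStarBase 𝔎} (hβ : IsCStarModule 𝔟 β) (hγ : IsCStarModule 𝔟.dagger γ)
    (ξ ξ' : β) (ζ ζ' : 𝔎) (η η' : γ) :
    ⟪tmul ξ ζ η, tmul ξ' ζ' η'⟫_ℂ =
      ⟪ζ, adjoint (ξ : 𝔎 →L[ℂ] H) ((ξ' : 𝔎 →L[ℂ] H)
        (adjoint (η : 𝔎 →L[ℂ] K) ((η' : 𝔎 →L[ℂ] K) ζ')))⟫_ℂ := by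
  have h := RKHS.kernel_inner (RKHS.OfKernel (relKernel' β γ)) (ξ', η') (ξ, η) ζ ζ'
  have e : relKernel' β γ = relKernel β γ := by
    unfold relKernel'; rw [if_pos (relKernel_posSemidef hβ hγ)]
  rw [RKHS.OfKernel.kernel_ofKernel] at h
  change _ = ⟪tmul ξ ζ η, tmul ξ' ζ' η'⟫_ℂ at h
  rw [← h, e]
  have hc := congrArg (fun f : 𝔎 →L[ℂ] 𝔎 => f ζ') (hβ.commute hγ ξ.2 ξ'.2 η.2 η'.2).eq
  change adjoint (ξ : 𝔎 →L[ℂ] H) ((ξ' : 𝔎 →L[ℂ] H)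
        (adjoint (η : 𝔎 →L[ℂ] K) ((η' : 𝔎 →L[ℂ] K) ζ'))) =
    adjoint (η : 𝔎 →L[ℂ] K) ((η' : 𝔎 →L[ℂ] K)
        (adjoint (ξ : 𝔎 →L[ℂ] H) ((ξ' : 𝔎 →L[ℂ] H) ζ'))) at hc
  rw [hc, adjoint_inner_right, ← adjoint_inner_left, adjoint_inner_right, ← adjoint_inner_left]
  rfl

theorem norm_sq_sum_tmul_left {ι : Type*} [Fintype ι] {𝔟 : CStarBase 𝔎}
    (hβ : IsCStarModule 𝔟 β) (hγ : IsCStarModule 𝔟.dagger γ) (ξ : ι → β) (η : ι → γ) :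
    ∃ r : ι → ι → 𝔎 →L[ℂ] 𝔎, (∀ z : ι → 𝔎,
      ‖∑ i, (ξ i : 𝔎 →L[ℂ] H) (z i)‖ ^ 2 = ∑ k, ‖∑ i, r k i (z i)‖ ^ 2) ∧
      (∀ d ∈ 𝔟.Bd, ∀ k j x, d (r k j x) = r k j (d x)) ∧
      ∀ z : ι → 𝔎, ‖∑ i, tmul (ξ i) (z i) (η i)‖ ^ 2
        = ∑ k, ‖∑ i, (η i : 𝔎 →L[ℂ] K) (r k i (z i))‖ ^ 2 := by
  obtain ⟨r, hr, hrc⟩ := exists_root (fun i : ι => (ξ i : 𝔎 →L[ℂ] H))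
  have hcom : ∀ d ∈ 𝔟.Bd, ∀ k j x, d (r k j x) = r k j (d x) := fun d hd => hrc d fun i j =>
    (𝔟.commute _ (hβ.inner_mem (ξ i).2 (ξ j).2) d hd).symm
  refine ⟨r, norm_sq_root hr, hcom, fun z => ?_⟩
  have h : ((‖∑ i, tmul (ξ i) (z i) (η i)‖ : ℂ)) ^ 2
      = ∑ k, (‖∑ i, (η i : 𝔎 →L[ℂ] K) (r k i (z i))‖ : ℂ) ^ 2 := by
    have e1 : ∀ v : RTP β γ, (‖v‖ : ℂ) ^ 2 = ⟪v, v⟫_ℂ :=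
      fun v => (inner_self_eq_norm_sq_to_K v).symm
    have e2 : ∀ v : K, (‖v‖ : ℂ) ^ 2 = ⟪v, v⟫_ℂ := fun v => (inner_self_eq_norm_sq_to_K v).symm
    have e3 : ∀ i j, ⟪tmul (ξ i) (z i) (η i), tmul (ξ j) (z j) (η j)⟫_ℂ =
        ∑ k, ⟪(η i : 𝔎 →L[ℂ] K) (r k i (z i)), (η j : 𝔎 →L[ℂ] K) (r k j (z j))⟫_ℂ := fun i j => by
      rw [inner_tmul hβ hγ, adjoint_inner_right, hr]
      refine Finset.sum_congr rfl fun k _ => ?_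
      have hd : adjoint (η i : 𝔎 →L[ℂ] K) ∘L (η j : 𝔎 →L[ℂ] K) ∈ 𝔟.Bd :=
        hγ.inner_mem (η i).2 (η j).2
      rw [← adjoint_inner_right (η i : 𝔎 →L[ℂ] K)]
      exact congrArg (fun v => ⟪r k i (z i), v⟫_ℂ) (hcom _ hd k j (z j)).symm
    simp only [e1, e2, sum_inner, inner_sum, e3]
    refine (Finset.sum_congr rfl fun i _ => Finset.sum_comm).trans ?_
    exact Finset.sum_comm
  exact_mod_cast h

theorem norm_sq_sum_tmul_right {ι : Type*} [Fintype ι] {𝔟 : CStarBase 𝔎}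
    (hβ : IsCStarModule 𝔟 β) (hγ : IsCStarModule 𝔟.dagger γ) (ξ : ι → β) (η : ι → γ) :
    ∃ r : ι → ι → 𝔎 →L[ℂ] 𝔎, (∀ z : ι → 𝔎,
      ‖∑ i, (η i : 𝔎 →L[ℂ] K) (z i)‖ ^ 2 = ∑ k, ‖∑ i, r k i (z i)‖ ^ 2) ∧
      (∀ d ∈ 𝔟.B, ∀ k j x, d (r k j x) = r k j (d x)) ∧
      ∀ z : ι → 𝔎, ‖∑ i, tmul (ξ i) (z i) (η i)‖ ^ 2
        = ∑ k, ‖∑ i, (ξ i : 𝔎 →L[ℂ] H) (r k i (z i))‖ ^ 2 := by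
  have hflip : ∀ z : ι → 𝔎, ‖∑ i, tmul (ξ i) (z i) (η i)‖ ^ 2
      = ‖∑ i, tmul (η i) (z i) (ξ i)‖ ^ 2 := fun z => by
    have h : ((‖∑ i, tmul (ξ i) (z i) (η i)‖ : ℂ)) ^ 2
        = (‖∑ i, tmul (η i) (z i) (ξ i)‖ : ℂ) ^ 2 := by
      have e1 : ∀ v : RTP β γ, (‖v‖ : ℂ) ^ 2 = ⟪v, v⟫_ℂ :=
        fun v => (inner_self_eq_norm_sq_to_K v).symm
      have e2 : ∀ v : RTP γ β, (‖v‖ : ℂ) ^ 2 = ⟪v, v⟫_ℂ :=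
        fun v => (inner_self_eq_norm_sq_to_K v).symm
      simp only [e1, e2, sum_inner, inner_sum]
      refine Finset.sum_congr rfl fun i _ => Finset.sum_congr rfl fun j _ => ?_
      rw [inner_tmul hβ hγ, inner_tmul (𝔟 := 𝔟.dagger) hγ hβ]
      exact congrArg (fun f : 𝔎 →L[ℂ] 𝔎 => ⟪z j, f (z i)⟫_ℂ)
        (hβ.commute hγ (ξ j).2 (ξ i).2 (η j).2 (η i).2).eq
    exact_mod_cast h
  obtain ⟨r, h1, h2, h3⟩ := norm_sq_sum_tmul_left (𝔟 := 𝔟.dagger) hγ hβ η ξ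
  exact ⟨r, h1, h2, fun z => (hflip z).trans (h3 z)⟩

theorem sum_smul_tmul (s : Finset (β × 𝔎 × γ)) (a : β × 𝔎 × γ → ℂ) :
    ∑ p ∈ s, a p • tmulFamily β γ p =
      ∑ p : s, tmul (p : β × 𝔎 × γ).1 (a p • (p : β × 𝔎 × γ).2.1) (p : β × 𝔎 × γ).2.2 := by
  rw [← Finset.sum_coe_sort]
  refine Finset.sum_congr rfl fun p _ => ?_
  simp only [tmulFamily, tmul]
  exact (map_smul _ _ _).symm

variable (β γ)

/-- `⟨ξ|₁ : ξ' ⊗ ζ ⊗ η ↦ η (ξ†ξ') ζ`. -/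
def bra1 (ξ : 𝔎 →L[ℂ] H) : RTP β γ →L[ℂ] K :=
  extendOp (tmulFamily β γ) fun p => (p.2.2 : 𝔎 →L[ℂ] K) (adjoint ξ ((p.1 : 𝔎 →L[ℂ] H) p.2.1))

/-- `⟨η|₂ : ξ ⊗ ζ ⊗ η' ↦ ξ (η†η') ζ`. -/
def bra2 (η : 𝔎 →L[ℂ] K) : RTP β γ →L[ℂ] H :=
  extendOp (tmulFamily β γ) fun p => (p.1 : 𝔎 →L[ℂ] H) (adjoint η ((p.2.2 : 𝔎 →L[ℂ] K) p.2.1))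

/-- `|ξ⟩₁ : ηζ ↦ ξ ⊗ ζ ⊗ η`, as the adjoint of `⟨ξ|₁`; for `ξ` in `β` or `M(β)`. -/
def ket1 (ξ : 𝔎 →L[ℂ] H) : K →L[ℂ] RTP β γ := adjoint (bra1 β γ ξ)

/-- `|η⟩₂ : ξζ ↦ ξ ⊗ ζ ⊗ η`, as the adjoint of `⟨η|₂`; for `η` in `γ` or `M(γ)`. -/
def ket2 (η : 𝔎 →L[ℂ] K) : H →L[ℂ] RTP β γ := adjoint (bra2 β γ η)

variable {β γ}

theorem bra2_tmul {𝔟 : CStarBase 𝔎} (hβ : IsCStarModule 𝔟 β) (hγ : IsCStarModule 𝔟.dagger γ)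
    {η : 𝔎 →L[ℂ] K} (hη : ∀ η' ∈ γ, adjoint η ∘L η' ∈ 𝔟.Bd) (ξ : β) (ζ : 𝔎) (η' : γ) :
    bra2 β γ η (tmul ξ ζ η') = (ξ : 𝔎 →L[ℂ] H) (adjoint η ((η' : 𝔎 →L[ℂ] K) ζ)) := by
  classical
  refine extendOp_apply (f := tmulFamily β γ) (g := fun p => (p.1 : 𝔎 →L[ℂ] H)
    (adjoint η ((p.2.2 : 𝔎 →L[ℂ] K) p.2.1))) ?_ (ξ, ζ, η')
  refine exists_extension tmul_total ‖η‖ fun s a => ?_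
  obtain ⟨r, h1, h2, h3⟩ := norm_sq_sum_tmul_left hβ hγ (fun p : s => (p : β × 𝔎 × γ).1)
    (fun p : s => (p : β × 𝔎 × γ).2.2)
  rw [sum_smul_tmul]
  have e : ∑ p ∈ s, a p • (p.1 : 𝔎 →L[ℂ] H) (adjoint η ((p.2.2 : 𝔎 →L[ℂ] K) p.2.1)) =
      ∑ p : s, ((p : β × 𝔎 × γ).1 : 𝔎 →L[ℂ] H)
        (adjoint η (((p : β × 𝔎 × γ).2.2 : 𝔎 →L[ℂ] K) (a p • (p : β × 𝔎 × γ).2.1))) := by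
    rw [← Finset.sum_coe_sort]; simp
  rw [e]
  refine (sq_le_sq₀ (norm_nonneg _) (by positivity)).mp ?_
  rw [mul_pow, h1, h3 fun p : s => a p • (p : β × 𝔎 × γ).2.1, Finset.mul_sum]
  refine Finset.sum_le_sum fun k _ => ?_
  have e' : ∀ p : s, r k p (adjoint η (((p : β × 𝔎 × γ).2.2 : 𝔎 →L[ℂ] K)
        (a p • (p : β × 𝔎 × γ).2.1))) =
      adjoint η (((p : β × 𝔎 × γ).2.2 : 𝔎 →L[ℂ] K) (r k p (a p • (p : β × 𝔎 × γ).2.1))) :=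
    fun p => (h2 _ (hη _ (p : β × 𝔎 × γ).2.2.2) k p _).symm
  simp_rw [e']
  rw [← map_sum, ← mul_pow]
  gcongr
  refine ((adjoint η).le_opNorm _).trans_eq ?_
  rw [LinearIsometryEquiv.norm_map]

theorem bra1_tmul {𝔟 : CStarBase 𝔎} (hβ : IsCStarModule 𝔟 β) (hγ : IsCStarModule 𝔟.dagger γ)
    {ξ : 𝔎 →L[ℂ] H} (hξ : ∀ ξ' ∈ β, adjoint ξ ∘L ξ' ∈ 𝔟.B) (ξ' : β) (ζ : 𝔎) (η : γ) :
    bra1 β γ ξ (tmul ξ' ζ η) = (η : 𝔎 →L[ℂ] K) (adjoint ξ ((ξ' : 𝔎 →L[ℂ] H) ζ)) := by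
  classical
  refine extendOp_apply (f := tmulFamily β γ) (g := fun p => (p.2.2 : 𝔎 →L[ℂ] K)
    (adjoint ξ ((p.1 : 𝔎 →L[ℂ] H) p.2.1))) ?_ (ξ', ζ, η)
  refine exists_extension tmul_total ‖ξ‖ fun s a => ?_
  obtain ⟨r, h1, h2, h3⟩ := norm_sq_sum_tmul_right hβ hγ (fun p : s => (p : β × 𝔎 × γ).1)
    (fun p : s => (p : β × 𝔎 × γ).2.2)
  rw [sum_smul_tmul]
  have e : ∑ p ∈ s, a p • (p.2.2 : 𝔎 →L[ℂ] K) (adjoint ξ ((p.1 : 𝔎 →L[ℂ] H) p.2.1)) =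
      ∑ p : s, ((p : β × 𝔎 × γ).2.2 : 𝔎 →L[ℂ] K)
        (adjoint ξ (((p : β × 𝔎 × γ).1 : 𝔎 →L[ℂ] H) (a p • (p : β × 𝔎 × γ).2.1))) := by
    rw [← Finset.sum_coe_sort]; simp
  rw [e]
  refine (sq_le_sq₀ (norm_nonneg _) (by positivity)).mp ?_
  rw [mul_pow, h1, h3 fun p : s => a p • (p : β × 𝔎 × γ).2.1, Finset.mul_sum]
  refine Finset.sum_le_sum fun k _ => ?_
  have e' : ∀ p : s, r k p (adjoint ξ (((p : β × 𝔎 × γ).1 : 𝔎 →L[ℂ] H)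
        (a p • (p : β × 𝔎 × γ).2.1))) =
      adjoint ξ (((p : β × 𝔎 × γ).1 : 𝔎 →L[ℂ] H) (r k p (a p • (p : β × 𝔎 × γ).2.1))) :=
    fun p => (h2 _ (hξ _ (p : β × 𝔎 × γ).1.2) k p _).symm
  simp_rw [e']
  rw [← map_sum, ← mul_pow]
  gcongr
  refine ((adjoint ξ).le_opNorm _).trans_eq ?_
  rw [LinearIsometryEquiv.norm_map]

theorem ext_inner_tmul {v w : RTP β γ}
    (h : ∀ (ξ : β) (ζ : 𝔎) (η : γ), ⟪tmul ξ ζ η, v⟫_ℂ = ⟪tmul ξ ζ η, w⟫_ℂ) : v = w := by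
  have hT : innerSL ℂ v = innerSL ℂ w := ext_of_total tmul_total fun p => by
    simp only [innerSL_apply_apply]
    rw [← inner_conj_symm v, ← inner_conj_symm w]
    exact congrArg _ (h p.1 p.2.1 p.2.2)
  refine ext_inner_right ℂ fun u => ?_
  exact congrArg (fun f : RTP β γ →L[ℂ] ℂ => f u) hT

theorem ket2_apply {𝔟 : CStarBase 𝔎} (hβ : IsCStarModule 𝔟 β) (hγ : IsCStarModule 𝔟.dagger γ)
    (ξ : β) (ζ : 𝔎) (η : γ) : ket2 β γ η ((ξ : 𝔎 →L[ℂ] H) ζ) = tmul ξ ζ η := by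
  refine ext_inner_tmul fun ξ' ζ' η' => ?_
  rw [ket2, adjoint_inner_right,
    bra2_tmul hβ hγ (fun η' h => (hγ.inner_mem η.2 h : _ ∈ 𝔟.dagger.B)), inner_tmul hβ hγ,
    ← adjoint_inner_right, ← adjoint_inner_right, adjoint_adjoint, ← adjoint_inner_right]
  exact congrArg (fun f : 𝔎 →L[ℂ] 𝔎 => ⟪ζ', f ζ⟫_ℂ)
    (hβ.commute hγ ξ'.2 ξ.2 η'.2 η.2).symm.eq

theorem ket1_apply {𝔟 : CStarBase 𝔎} (hβ : IsCStarModule 𝔟 β) (hγ : IsCStarModule 𝔟.dagger γ)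
    (ξ : β) (ζ : 𝔎) (η : γ) : ket1 β γ ξ ((η : 𝔎 →L[ℂ] K) ζ) = tmul ξ ζ η := by
  refine ext_inner_tmul fun ξ' ζ' η' => ?_
  rw [ket1, adjoint_inner_right, bra1_tmul hβ hγ (fun ξ' h => hβ.inner_mem ξ.2 h),
    inner_tmul hβ hγ, ← adjoint_inner_right, ← adjoint_inner_right, adjoint_adjoint,
    ← adjoint_inner_right]

end RelativeTensorProduct

section Operators

variable {𝔎 H K H' K' : Type*} [NormedAddCommGroup 𝔎] [InnerProductSpace ℂ 𝔎] [CompleteSpace 𝔎]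
  [NormedAddCommGroup H] [InnerProductSpace ℂ H] [CompleteSpace H]
  [NormedAddCommGroup K] [InnerProductSpace ℂ K] [CompleteSpace K]
  [NormedAddCommGroup H'] [InnerProductSpace ℂ H'] [CompleteSpace H']
  [NormedAddCommGroup K'] [InnerProductSpace ℂ K'] [CompleteSpace K']

/-- `α ◁ γ = [|γ⟩₂ α]`, a space of operators `𝔎 → H β⊗γ K`. -/
def ltri (β : Submodule ℂ (𝔎 →L[ℂ] H)) (γ : Submodule ℂ (𝔎 →L[ℂ] K))
    (α : Submodule ℂ (𝔎 →L[ℂ] H)) : Submodule ℂ (𝔎 →L[ℂ] RTP β γ) :=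
  cspan {T | ∃ η ∈ γ, ∃ ξ ∈ α, ket2 β γ η ∘L ξ = T}

/-- `β ▷ δ = [|β⟩₁ δ]`, a space of operators `𝔎 → H β⊗γ K`. -/
def rtri (β : Submodule ℂ (𝔎 →L[ℂ] H)) (γ : Submodule ℂ (𝔎 →L[ℂ] K))
    (δ : Submodule ℂ (𝔎 →L[ℂ] K)) : Submodule ℂ (𝔎 →L[ℂ] RTP β γ) :=
  cspan {T | ∃ ξ ∈ β, ∃ η ∈ δ, ket1 β γ ξ ∘L η = T}

/-- `S ⊗ id : H β⊗γ K → H' β'⊗γ K`, `|ξ⟩₁ ω ↦ |Sξ⟩₁ ω`, for a semi-morphism `S` (`Sβ ⊆ β'`). -/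
def tensorId (β : Submodule ℂ (𝔎 →L[ℂ] H)) (γ : Submodule ℂ (𝔎 →L[ℂ] K))
    (β' : Submodule ℂ (𝔎 →L[ℂ] H')) (S : H →L[ℂ] H') : RTP β γ →L[ℂ] RTP β' γ :=
  extendOp (fun p : β × K => ket1 β γ p.1 p.2) (fun p => ket1 β' γ (S ∘L p.1) p.2)

/-- `id ⊗ T : H β⊗γ K → H β⊗γ' K'`, `|η⟩₂ ω ↦ |Tη⟩₂ ω`, for a semi-morphism `T` (`Tγ ⊆ γ'`). -/
def idTensor (β : Submodule ℂ (𝔎 →L[ℂ] H)) (γ : Submodule ℂ (𝔎 →L[ℂ] K))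
    (γ' : Submodule ℂ (𝔎 →L[ℂ] K')) (T : K →L[ℂ] K') : RTP β γ →L[ℂ] RTP β γ' :=
  extendOp (fun p : γ × H => ket2 β γ p.1 p.2) (fun p => ket2 β γ' (T ∘L p.1) p.2)

/-- `id ⊗ y : H β⊗γ K → H β⊗γ K`, `|ξ⟩₁ ω ↦ |ξ⟩₁ yω`, for `y` in the commutant `ρ_γ(𝔅)'`. -/
def idTensorComm (β : Submodule ℂ (𝔎 →L[ℂ] H)) (γ : Submodule ℂ (𝔎 →L[ℂ] K)) (y : K →L[ℂ] K) :
    RTP β γ →L[ℂ] RTP β γ :=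
  extendOp (fun p : β × K => ket1 β γ p.1 p.2) (fun p => ket1 β γ p.1 (y p.2))

/-- The flip `Σ : ξ ⊗ ζ ⊗ η ↦ η ⊗ ζ ⊗ ξ`. -/
def flip (β : Submodule ℂ (𝔎 →L[ℂ] H)) (γ : Submodule ℂ (𝔎 →L[ℂ] K)) :
    RTP β γ →L[ℂ] RTP γ β :=
  extendOp (tmulFamily β γ) (fun p => tmul p.2.2 p.2.1 p.1)

section Associativity

variable {L : Type*} [NormedAddCommGroup L] [InnerProductSpace ℂ L] [CompleteSpace L]
  (β : Submodule ℂ (𝔎 →L[ℂ] H)) (γ ε : Submodule ℂ (𝔎 →L[ℂ] K)) (φ : Submodule ℂ (𝔎 →L[ℂ] L))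

/-- The canonical isomorphism `(H β⊗γ K) ⊗ L → H ⊗ (K ε⊗φ L)`, where the outer tensor products
are taken with respect to `β ▷ ε`, `φ` and `β`, `γ ◁ φ`, respectively. -/
def assoc : RTP (rtri β γ ε) φ →L[ℂ] RTP β (ltri ε φ γ) :=
  extendOp (fun p : β × K × φ => ket2 (rtri β γ ε) φ p.2.2 (ket1 β γ p.1 p.2.1))
    (fun p => ket1 β (ltri ε φ γ) p.1 (ket2 ε φ p.2.2 p.2.1))

/-- The inverse of `assoc`. -/
def assocInv : RTP β (ltri ε φ γ) →L[ℂ] RTP (rtri β γ ε) φ :=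
  extendOp (fun p : β × K × φ => ket1 β (ltri ε φ γ) p.1 (ket2 ε φ p.2.2 p.2.1))
    (fun p => ket2 (rtri β γ ε) φ p.2.2 (ket1 β γ p.1 p.2.1))

/-- The isomorphism `Σ₂₃ : (K p⊗x H) ⊗ L → (K q⊗y L) ⊗ H` exchanging the last two legs, where
the outer tensor products are taken with respect to `q ◁ x`, `y` and `p ◁ y`, `x`. -/
def swap23 (p : Submodule ℂ (𝔎 →L[ℂ] K)) (x : Submodule ℂ (𝔎 →L[ℂ] H))
    (q : Submodule ℂ (𝔎 →L[ℂ] K)) (y : Submodule ℂ (𝔎 →L[ℂ] L)) :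
    RTP (ltri p x q) y →L[ℂ] RTP (ltri q y p) x :=
  extendOp (fun t : x × y × K => ket2 (ltri p x q) y t.2.1 (ket2 p x t.1 t.2.2))
    (fun t => ket2 (ltri q y p) x t.1 (ket2 q y t.2.1 t.2.2))

end Associativity

end Operators

section HopfBimodules

variable {𝔎 H K L : Type*} [NormedAddCommGroup 𝔎] [InnerProductSpace ℂ 𝔎] [CompleteSpace 𝔎]
  [NormedAddCommGroup H] [InnerProductSpace ℂ H] [CompleteSpace H]
  [NormedAddCommGroup K] [InnerProductSpace ℂ K] [CompleteSpace K]
  [NormedAddCommGroup L] [InnerProductSpace ℂ L] [CompleteSpace L]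

/-- The fiber product `A β∗γ C` of `A ⊆ ℒ(H)` and `C ⊆ ℒ(K)`. -/
def fiberProduct (β : Submodule ℂ (𝔎 →L[ℂ] H)) (γ : Submodule ℂ (𝔎 →L[ℂ] K))
    (A : Submodule ℂ (H →L[ℂ] H)) (C : Submodule ℂ (K →L[ℂ] K)) :
    Set (RTP β γ →L[ℂ] RTP β γ) :=
  {x | (∀ ξ ∈ β,
      x ∘L ket1 β γ ξ ∈ cspan {T | ∃ ξ' ∈ β, ∃ c ∈ C, ket1 β γ ξ' ∘L c = T} ∧
      adjoint x ∘L ket1 β γ ξ ∈ cspan {T | ∃ ξ' ∈ β, ∃ c ∈ C, ket1 β γ ξ' ∘L c = T}) ∧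
    ∀ η ∈ γ,
      x ∘L ket2 β γ η ∈ cspan {T | ∃ η' ∈ γ, ∃ a ∈ A, ket2 β γ η' ∘L a = T} ∧
      adjoint x ∘L ket2 β γ η ∈ cspan {T | ∃ η' ∈ γ, ∃ a ∈ A, ket2 β γ η' ∘L a = T}}

/-- `ℒ^π(H, L)`: the operators `T` with `T a = π(a) T` for all `a ∈ A`. Only the values of `π`
on `A` matter. -/
def intertwiners (A : Submodule ℂ (H →L[ℂ] H)) (π : (H →L[ℂ] H) → (L →L[ℂ] L)) :
    Set (H →L[ℂ] L) :=
  {T | ∀ a ∈ A, T ∘L a = π a ∘L T}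

/-- The semi-morphisms `(H, α) → (L, γ)`. -/
def semiMorphisms (α : Submodule ℂ (𝔎 →L[ℂ] H)) (γ : Submodule ℂ (𝔎 →L[ℂ] L)) :
    Set (H →L[ℂ] L) :=
  {T | ∀ ξ ∈ α, T ∘L ξ ∈ γ}

/-- `π ∗ id` at `x ∈ ℒ(H β⊗γ K)`, for a semi-normal morphism `π` from `A ⊆ ℒ(H)`, with respect
to `β`, to operators on `L`, with respect to `lam`: the operator with
`(π ∗ id)(x) (S ⊗ id) = (S ⊗ id) x` for all intertwining semi-morphisms `S`. -/
def fiberMapLeft (β : Submodule ℂ (𝔎 →L[ℂ] H)) (γ : Submodule ℂ (𝔎 →L[ℂ] K))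
    (lam : Submodule ℂ (𝔎 →L[ℂ] L)) (A : Submodule ℂ (H →L[ℂ] H))
    (π : (H →L[ℂ] H) → (L →L[ℂ] L)) (x : RTP β γ →L[ℂ] RTP β γ) :
    RTP lam γ →L[ℂ] RTP lam γ :=
  extendOp
    (fun p : (intertwiners A π ∩ semiMorphisms β lam : Set (H →L[ℂ] L)) × RTP β γ =>
      tensorId β γ lam p.1 p.2)
    (fun p => tensorId β γ lam p.1 (x p.2))

/-- `id ∗ π` at `x ∈ ℒ(H β⊗γ K)`, for a semi-normal morphism `π` from `C ⊆ ℒ(K)`, with respect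
to `γ`, to operators on `L`, with respect to `lam`: the operator with
`(id ∗ π)(x) (id ⊗ T) = (id ⊗ T) x` for all intertwining semi-morphisms `T`. -/
def fiberMapRight (β : Submodule ℂ (𝔎 →L[ℂ] H)) (γ : Submodule ℂ (𝔎 →L[ℂ] K))
    (lam : Submodule ℂ (𝔎 →L[ℂ] L)) (C : Submodule ℂ (K →L[ℂ] K))
    (π : (K →L[ℂ] K) → (L →L[ℂ] L)) (x : RTP β γ →L[ℂ] RTP β γ) :
    RTP β lam →L[ℂ] RTP β lam :=
  extendOp
    (fun p : (intertwiners C π ∩ semiMorphisms γ lam : Set (K →L[ℂ] L)) × RTP β γ =>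
      idTensor β γ lam p.1 p.2)
    (fun p => idTensor β γ lam p.1 (x p.2))

/-- `A ⊆ ℒ(H)` is a `C*`-algebra. -/
structure IsCStarSubalgebra (A : Submodule ℂ (H →L[ℂ] H)) : Prop where
  isClosed : IsClosed (A : Set (H →L[ℂ] H))
  mul_mem : ∀ a ∈ A, ∀ a' ∈ A, a ∘L a' ∈ A
  star_mem : ∀ a ∈ A, adjoint a ∈ A

/-- `A`, with `(H, β, α)`, is a `C*`-`(𝔟†, 𝔟)`-algebra. -/
structure IsCStarBiAlgebra (𝔟 : CStarBase 𝔎) (β α : Submodule ℂ (𝔎 →L[ℂ] H))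
    (A : Submodule ℂ (H →L[ℂ] H)) : Prop where
  module_left : IsCStarModule 𝔟.dagger β
  module_right : IsCStarModule 𝔟 α
  compatible_left : Compatible 𝔟.B β α
  compatible_right : Compatible 𝔟.Bd α β
  algebra : IsCStarSubalgebra A
  rho_left_mem : ∀ b ∈ 𝔟.B, ∀ a ∈ A, rho β b ∘L a ∈ A
  rho_right_mem : ∀ c ∈ 𝔟.Bd, ∀ a ∈ A, rho α c ∘L a ∈ A

/-- `(A, Δ)`, with `(H, β, α)`, is a (semi-normal) Hopf `C*`-bimodule over `𝔟`: `Δ` is a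
coassociative jointly semi-normal morphism from `A` to the fiber product `A α∗β A`. Only the
values of `Δ` on `A` matter. -/
structure IsHopfBimodule (𝔟 : CStarBase 𝔎) (β α : Submodule ℂ (𝔎 →L[ℂ] H))
    (A : Submodule ℂ (H →L[ℂ] H))
    (Δ : (H →L[ℂ] H) → (RTP α β →L[ℂ] RTP α β)) : Prop where
  algebra : IsCStarBiAlgebra 𝔟 β α A
  map_add : ∀ a ∈ A, ∀ a' ∈ A, Δ (a + a') = Δ a + Δ a'
  map_smul : ∀ (z : ℂ), ∀ a ∈ A, Δ (z • a) = z • Δ a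
  map_mul : ∀ a ∈ A, ∀ a' ∈ A, Δ (a ∘L a') = Δ a ∘L Δ a'
  map_star : ∀ a ∈ A, Δ (adjoint a) = adjoint (Δ a)
  mem_fiberProduct : ∀ a ∈ A, Δ a ∈ fiberProduct α β A A
  seminormal_left :
    cspan {T | ∃ S ∈ intertwiners A Δ ∩ (semiMorphisms β (ltri α β β) ∩
        semiMorphisms α (rtri α β α)), ∃ ξ ∈ β, S ∘L ξ = T} = ltri α β β
  seminormal_right :
    cspan {T | ∃ S ∈ intertwiners A Δ ∩ (semiMorphisms β (ltri α β β) ∩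
        semiMorphisms α (rtri α β α)), ∃ ξ ∈ α, S ∘L ξ = T} = rtri α β α
  coassoc : ∀ a ∈ A,
    assoc α β α β ∘L fiberMapLeft α β (rtri α β α) A Δ (Δ a) =
      fiberMapRight α β (ltri α β β) A Δ (Δ a) ∘L assoc α β α β

/-- Complete positivity of a map from `A ⊆ ℒ(H)` to `ℒ(𝔎)`: every amplification to matrices
maps positive matrices to positive matrices. -/
def IsCompletelyPositive (A : Submodule ℂ (H →L[ℂ] H)) (φ : A →ₗ[ℂ] (𝔎 →L[ℂ] 𝔎)) : Prop :=
  ∀ (n : ℕ) (M : Fin n → Fin n → A),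
    (∀ v : Fin n → H, 0 ≤ ∑ i, ∑ j, ⟪v i, (M i j : H →L[ℂ] H) (v j)⟫_ℂ) →
    ∀ ζ : Fin n → 𝔎, 0 ≤ ∑ i, ∑ j, ⟪ζ i, φ (M i j) (ζ j)⟫_ℂ

/-- `φ : A → 𝔅` is a bounded left Haar weight for `(A, Δ)`. -/
structure IsBoundedLeftHaarWeight (𝔟 : CStarBase 𝔎) (β α : Submodule ℂ (𝔎 →L[ℂ] H))
    (A : Submodule ℂ (H →L[ℂ] H)) (Δ : (H →L[ℂ] H) → (RTP α β →L[ℂ] RTP α β))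
    (φ : A →ₗ[ℂ] (𝔎 →L[ℂ] 𝔎)) : Prop where
  hopf : IsHopfBimodule 𝔟 β α A Δ
  mem : ∀ a, φ a ∈ 𝔟.B
  completelyPositive : IsCompletelyPositive A φ
  contractive : ∀ a, ‖φ a‖ ≤ ‖a‖
  map_mul_rho : ∀ a : A, ∀ b ∈ 𝔟.B,
    ∃ h : (a : H →L[ℂ] H) ∘L rho β b ∈ A, φ ⟨_, h⟩ = φ a ∘L b
  left_invariant : ∀ a : A, ∀ ξ ∈ α, ∀ ξ' ∈ α,
    ∃ h : bra1 α β ξ ∘L Δ a ∘L ket1 α β ξ' ∈ A,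
      φ ⟨_, h⟩ = adjoint ξ ∘L rho β (φ a) ∘L ξ'

/-- `φ ∈ Ω_{M(γ)}(A)`, where `(H, γ)` is a module over a base with first algebra `B`:
`φ(a) = ∑ₖ ηₖ† a η'ₖ` for sequences `η, η'` in `M(γ)^∞`. -/
def IsNormalMap (B : NonUnitalStarSubalgebra ℂ (𝔎 →L[ℂ] 𝔎)) (γ : Submodule ℂ (𝔎 →L[ℂ] H))
    (A : Submodule ℂ (H →L[ℂ] H)) (φ : A →ₗ[ℂ] (𝔎 →L[ℂ] 𝔎)) : Prop :=
  ∃ η η' : ℕ → 𝔎 →L[ℂ] H,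
    (∀ k, η k ∈ multiplierSpace B γ) ∧ (∀ k, η' k ∈ multiplierSpace B γ) ∧
    Summable (fun k => adjoint (η k) ∘L η k) ∧ Summable (fun k => adjoint (η' k) ∘L η' k) ∧
    ∀ a : A, HasSum (fun k => adjoint (η k) ∘L (a : H →L[ℂ] H) ∘L η' k) (φ a)

/-- `φ` is a normal bounded left Haar weight for `(A, Δ)`. -/
structure IsNormalBoundedLeftHaarWeight (𝔟 : CStarBase 𝔎) (β α : Submodule ℂ (𝔎 →L[ℂ] H))
    (A : Submodule ℂ (H →L[ℂ] H)) (Δ : (H →L[ℂ] H) → (RTP α β →L[ℂ] RTP α β))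
    (φ : A →ₗ[ℂ] (𝔎 →L[ℂ] 𝔎)) : Prop where
  haar : IsBoundedLeftHaarWeight 𝔟 β α A Δ φ
  normal : IsNormalMap 𝔟.Bd β A φ

/-- The map `a ↦ ξ† a ξ` on `A`. -/
def compression (A : Submodule ℂ (H →L[ℂ] H)) (ξ : 𝔎 →L[ℂ] H) : A →ₗ[ℂ] (𝔎 →L[ℂ] 𝔎) where
  toFun a := adjoint ξ ∘L (a : H →L[ℂ] H) ∘L ξ
  map_add' a b := by ext; simp
  map_smul' z a := by ext; simp

end HopfBimodules

section PseudoMultiplicativeUnitaries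

variable {𝔎 H : Type*} [NormedAddCommGroup 𝔎] [InnerProductSpace ℂ 𝔎] [CompleteSpace 𝔎]
  [NormedAddCommGroup H] [InnerProductSpace ℂ H] [CompleteSpace H]

/-- `(H, hβ, α, β)` is a `C*`-`(𝔟†, 𝔟, 𝔟†)`-module. -/
structure IsCStarTriModule (𝔟 : CStarBase 𝔎) (hβ α β : Submodule ℂ (𝔎 →L[ℂ] H)) : Prop where
  module_hβ : IsCStarModule 𝔟.dagger hβ
  module_α : IsCStarModule 𝔟 α
  module_β : IsCStarModule 𝔟.dagger β
  compatible_hβ_α : Compatible 𝔟.B hβ α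
  compatible_hβ_β : Compatible 𝔟.B hβ β
  compatible_α_hβ : Compatible 𝔟.Bd α hβ
  compatible_α_β : Compatible 𝔟.Bd α β
  compatible_β_hβ : Compatible 𝔟.B β hβ
  compatible_β_α : Compatible 𝔟.B β α

variable {hβ α β : Submodule ℂ (𝔎 →L[ℂ] H)}

/-- A unitary `V : H hβ⊗α H → H α⊗β H`, as an operator. -/
def opOf (V : RTP hβ α ≃ₗᵢ[ℂ] RTP α β) : RTP hβ α →L[ℂ] RTP α β :=
  V.toLinearIsometry.toContinuousLinearMap

/-- The pentagon equation `V₁₂ V₁₃ V₂₃ = V₂₃ V₁₂`, where `V₁₃ = Σ₂₃ (V ⊗ id) (id ⊗ Σ)`. -/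
def Pentagon (V : RTP hβ α ≃ₗᵢ[ℂ] RTP α β) : Prop :=
  assoc α β α β ∘L tensorId (ltri hβ α α) β (rtri α β α) (opOf V) ∘L
      swap23 α β hβ α ∘L tensorId (rtri hβ α β) α (ltri α β hβ) (opOf V) ∘L
      assocInv hβ α β α ∘L idTensor hβ (rtri α β α) (ltri β α α) (flip α β) ∘L
      idTensor hβ (ltri hβ α α) (rtri α β α) (opOf V) ∘L assoc hβ α hβ α =
    idTensor α (ltri hβ α β) (ltri α β β) (opOf V) ∘L assoc α β hβ α ∘L
      tensorId (rtri hβ α hβ) α (rtri α β hβ) (opOf V)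

/-- `(𝔟, H, hβ, α, β, V)` is a `C*`-pseudo-multiplicative unitary. -/
structure IsPseudoMultiplicativeUnitary (𝔟 : CStarBase 𝔎) (hβ α β : Submodule ℂ (𝔎 →L[ℂ] H))
    (V : RTP hβ α ≃ₗᵢ[ℂ] RTP α β) : Prop where
  module : IsCStarTriModule 𝔟 hβ α β
  map_α_α : (opOf V ∘L ·) '' (ltri hβ α α : Set (𝔎 →L[ℂ] RTP hβ α)) = rtri α β α
  map_hβ_β : (opOf V ∘L ·) '' (rtri hβ α β : Set (𝔎 →L[ℂ] RTP hβ α)) = ltri α β hβ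
  map_hβ_hβ : (opOf V ∘L ·) '' (rtri hβ α hβ : Set (𝔎 →L[ℂ] RTP hβ α)) = rtri α β hβ
  map_β_α : (opOf V ∘L ·) '' (ltri hβ α β : Set (𝔎 →L[ℂ] RTP hβ α)) = ltri α β β
  pentagon : Pentagon V

/-- `Â_V = [⟨β|₂ V |α⟩₂]`. -/
def dualLeg (V : RTP hβ α ≃ₗᵢ[ℂ] RTP α β) : Submodule ℂ (H →L[ℂ] H) :=
  cspan {T | ∃ η ∈ β, ∃ ξ ∈ α, bra2 α β η ∘L opOf V ∘L ket2 hβ α ξ = T}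

/-- `Δ̂_V(y) = V† (id ⊗ y) V`, for `y ∈ ρ_β(𝔅)'`. -/
def dualComultiplication (V : RTP hβ α ≃ₗᵢ[ℂ] RTP α β) (y : H →L[ℂ] H) :
    RTP hβ α →L[ℂ] RTP hβ α :=
  adjoint (opOf V) ∘L idTensorComm α β y ∘L opOf V

/-- `V` is regular: `[⟨α|₁ V |α⟩₂] = [α α†]`. -/
def IsRegular (V : RTP hβ α ≃ₗᵢ[ℂ] RTP α β) : Prop :=
  cspan {T | ∃ ξ ∈ α, ∃ ξ' ∈ α, bra1 α β ξ ∘L opOf V ∘L ket2 hβ α ξ' = T} =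
    cspan {T | ∃ ξ ∈ α, ∃ ξ' ∈ α, ξ ∘L adjoint ξ' = T}

/-- `ξ` is a cofixed element for `V`: `ξ ∈ M(α) ∩ M(β)` and `V |ξ⟩₂ = |ξ⟩₂`. -/
structure IsCofixed (𝔟 : CStarBase 𝔎) (V : RTP hβ α ≃ₗᵢ[ℂ] RTP α β) (ξ : 𝔎 →L[ℂ] H) : Prop where
  mem_α : ξ ∈ multiplierSpace 𝔟.B α
  mem_β : ξ ∈ multiplierSpace 𝔟.Bd β
  cofixed : opOf V ∘L ket2 hβ α ξ = ket2 α β ξ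

/-- `V` is proper: `ξ†ξ = id` for some cofixed element `ξ`. -/
def IsProper (𝔟 : CStarBase 𝔎) (V : RTP hβ α ≃ₗᵢ[ℂ] RTP α β) : Prop :=
  ∃ ξ : 𝔎 →L[ℂ] H, IsCofixed 𝔟 V ξ ∧ adjoint ξ ∘L ξ = ContinuousLinearMap.id ℂ 𝔎

end PseudoMultiplicativeUnitaries

end CPMU

end

noncomputable section

namespace CPMU

set_option linter.unusedSectionVars false

/-! ### Closed linear spans and maps that are linear only on a subspace -/

section ClosedSpan

open Filter Topology

variable {E F G : Type*} [NormedAddCommGroup E] [NormedSpace ℂ E] [NormedAddCommGroup F]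
  [NormedSpace ℂ F] [NormedAddCommGroup G] [NormedSpace ℂ G]

/-! Write Â for `dualLeg V`, the closed span of the slices ⟨s|₂V|q⟩₂ with s ∈ β and q ∈ α. The basic
formula is a slice of the pentagon equation, Δ̂(⟨s|₂V|q⟩₂) = ⟨s|₃V₁₃V₂₃|q⟩₃ (`pentagon_slice`): V₁₂
moves past ⟨s|₃ and cancels against V†.

Â is a C*-algebra. Consider ⟨s|₂V(id ⊗ k)V†|p⟩₂. For k = xy† it is the product of the slice
⟨s|₂V|x⟩₂ with the adjoint of the slice ⟨p|₂V|y⟩₂ (`slice_comp_adjoint_slice`). For k = ⟨r|₁V|q⟩₂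
the pentagon turns it into the adjoint of the single slice ⟨p'|₂V|r⟩₂, where p' = ⟨s|₂V|q⟩₂p
(`comp_idTensor_comp`). Regularity says that both kinds of k have the same closed span, and [Âβ] = β
by `le_cspan_slice_comp`. Hence [ÂÂ†] = Â†; the left side is self-adjoint, so Â = Â† = [ÂÂ].

Δ̂ maps into the fiber product because V and V† permute the module structures. In the sliced
pentagon, V|q⟩₂y lies in α ▷ α and V†|s⟩₂ξ lies in hβ ▷ β; approximating them by the generators of
these spaces leaves slices of V behind a ket (`conj_comp_ket2_mem`, `conj_comp_ket1_mem`). Joint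
semi-normality is witnessed by the operators V†|y⟩₁ with y ∈ α. For coassociativity, (Δ̂ ∗ id)Δ̂(a)
is the conjugate of a on the third leg by V₂₃V₁₂ and (id ∗ Δ̂)Δ̂(a) the one by V₁₂V₁₃V₂₃, and the
pentagon equation identifies the two. Since Δ̂ ∗ id and id ∗ Δ̂ are defined through all intertwining
semi-morphisms, it must still be shown that the conjugates satisfy the defining relations; the fiber
product property gives this (`conjLeft_comp_tensorId`, `assoc_conjLeft_comp_idTensor`).

A cofixed ξ₀ satisfies V|ξ⟩₁ξ₀ = V|ξ₀⟩₂ξ = |ξ₀⟩₂ξ for ξ ∈ hβ. Hence ξ₀†⟨ξ|₁Δ̂(a)|ξ'⟩₁ξ₀ = ξ†⟨ξ₀|₂(id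
⊗ a)|ξ₀⟩₂ξ' = ξ†ρ_α(ξ₀†aξ₀)ξ', which is left invariance. The values lie in 𝔅† because Â = [Âρ_α(𝔅†)]
and ρ_α(c)ξ₀ = ξ₀c.

Operators given by `extendOp` take a default value where no extension exists, so a map such as η ↦
|η⟩₂ is known to be linear only on the module. `BddLinOn` records linearity and boundedness on such
a subspace, and lets closed span arguments run there. -/

theorem mem_cspan {s : Set E} {x : E} (hx : x ∈ s) : x ∈ cspan s :=
  Submodule.le_topologicalClosure _ (Submodule.subset_span hx)

theorem isClosed_cspan (s : Set E) : IsClosed (cspan s : Set E) :=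
  Submodule.isClosed_topologicalClosure _

theorem cspan_le {s : Set E} {Y : Submodule ℂ E} (hY : IsClosed (Y : Set E))
    (h : ∀ x ∈ s, x ∈ Y) : cspan s ≤ Y :=
  Submodule.topologicalClosure_minimal _ (Submodule.span_le.2 h) hY

theorem cspan_eq_top {s t : Set E} (hs : cspan s = ⊤) (h : ∀ x ∈ s, x ∈ cspan t) :
    cspan t = ⊤ :=
  top_le_iff.1 (hs ▸ cspan_le (isClosed_cspan t) h)

/-- `f` is linear and bounded on `P`. -/
structure BddLinOn (P : Submodule ℂ E) (f : E → F) : Prop where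
  add : ∀ x ∈ P, ∀ y ∈ P, f (x + y) = f x + f y
  smul : ∀ c : ℂ, ∀ x ∈ P, f (c • x) = c • f x
  bound : ∃ C, ∀ x ∈ P, ‖f x‖ ≤ C * ‖x‖

namespace BddLinOn

variable {P : Submodule ℂ E} {f g : E → F}

theorem exists_clm (hf : BddLinOn P f) : ∃ T : P →L[ℂ] F, ∀ x : P, T x = f x := by
  obtain ⟨C, hC⟩ := hf.bound
  exact ⟨LinearMap.mkContinuous
    { toFun := fun x : P => f x
      map_add' := fun x y => hf.add _ x.2 _ y.2
      map_smul' := fun c x => hf.smul c _ x.2 } C fun x => hC _ x.2, fun x => rfl⟩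

theorem of_clm (T : E →L[ℂ] F) : BddLinOn P T :=
  ⟨fun _ _ _ _ => map_add _ _ _, fun _ _ _ => map_smul _ _ _, ‖T‖, fun x _ => T.le_opNorm x⟩

theorem clm_comp (T : F →L[ℂ] G) (hf : BddLinOn P f) : BddLinOn P (fun x => T (f x)) := by
  obtain ⟨C, hC⟩ := hf.bound
  refine ⟨fun x hx y hy => by simp [hf.add x hx y hy], fun c x hx => by simp [hf.smul c x hx],
    ‖T‖ * C, fun x hx => ?_⟩
  calc _ ≤ ‖T‖ * ‖f x‖ := T.le_opNorm _
    _ ≤ ‖T‖ * (C * ‖x‖) := by gcongr; exact hC x hx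
    _ = _ := by ring

theorem sub (hf : BddLinOn P f) (hg : BddLinOn P g) : BddLinOn P (fun x => f x - g x) := by
  obtain ⟨C, hC⟩ := hf.bound
  obtain ⟨D, hD⟩ := hg.bound
  refine ⟨fun x hx y hy => ?_, fun c x hx => ?_, C + D, fun x hx => ?_⟩
  · rw [hf.add x hx y hy, hg.add x hx y hy]; abel
  · rw [hf.smul c x hx, hg.smul c x hx, smul_sub]
  · refine (norm_sub_le _ _).trans ?_
    rw [add_mul]
    exact add_le_add (hC x hx) (hD x hx)

/-- Composition with a bounded linear map on another subspace. -/
theorem mem_of_cspan (hf : BddLinOn P f) (hP : IsClosed (P : Set E)) {s : Set E}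
    (hs : ∀ x ∈ s, x ∈ P) {Y : Submodule ℂ F} (hY : IsClosed (Y : Set F))
    (h : ∀ x ∈ s, f x ∈ Y) {x : E} (hx : x ∈ cspan s) : f x ∈ Y := by
  obtain ⟨T, hT⟩ := hf.exists_clm
  have hc : IsClosed ((Y.comap (T : P →ₗ[ℂ] F)) : Set P) := hY.preimage T.continuous
  -- As P is closed in E, the preimage of Y stays closed when it is viewed in E, so it contains the
  -- closed span of s.
  have hm : IsClosed (((Y.comap (T : P →ₗ[ℂ] F)).map P.subtype : Submodule ℂ E) : Set E) := by
    rw [Submodule.map_coe]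
    exact hP.isClosedEmbedding_subtypeVal.isClosedMap _ hc
  obtain ⟨y, hy, rfl⟩ := cspan_le hm (s := s)
    (fun x hx => ⟨⟨x, hs x hx⟩, by simpa [hT] using h x hx, rfl⟩) hx
  simpa [hT] using hy

theorem eq_of_cspan (hf : BddLinOn P f) (hg : BddLinOn P g) (hP : IsClosed (P : Set E))
    {s : Set E} (hs : ∀ x ∈ s, x ∈ P) (h : ∀ x ∈ s, f x = g x) {x : E} (hx : x ∈ cspan s) :
    f x = g x := by
  have := (hf.sub hg).mem_of_cspan hP hs (Y := ⊥) (by simp)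
    (fun x hx => by simp [h x hx]) hx
  exact sub_eq_zero.1 (by simpa using this)

/-- A linear map on a closed subspace with closed graph is bounded. -/
theorem of_graph [CompleteSpace E] [CompleteSpace F] (hP : IsClosed (P : Set E))
    (hadd : ∀ x ∈ P, ∀ y ∈ P, f (x + y) = f x + f y)
    (hsmul : ∀ c : ℂ, ∀ x ∈ P, f (c • x) = c • f x)
    (hgraph : ∀ (u : ℕ → E) (x : E) (y : F), (∀ n, u n ∈ P) → x ∈ P → Tendsto u atTop (𝓝 x) →
      Tendsto (fun n => f (u n)) atTop (𝓝 y) → y = f x) : BddLinOn P f := by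
  have : CompleteSpace P := hP.completeSpace_coe
  let g : P →ₗ[ℂ] F :=
    { toFun := fun x : P => f x
      map_add' := fun x y => hadd _ x.2 _ y.2
      map_smul' := fun c x => hsmul c _ x.2 }
  have hg : Continuous g := g.continuous_of_seq_closed_graph fun u x y hu hy =>
    hgraph (fun n => u n) x y (fun n => (u n).2) x.2
      ((continuous_subtype_val.tendsto x).comp hu) hy
  exact ⟨hadd, hsmul, ‖(⟨g, hg⟩ : P →L[ℂ] F)‖, fun x hx =>
    (⟨g, hg⟩ : P →L[ℂ] F).le_opNorm ⟨x, hx⟩⟩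

end BddLinOn

theorem map_mem_of_cspan (T : E →L[ℂ] F) {s : Set E} {Y : Submodule ℂ F}
    (hY : IsClosed (Y : Set F)) (h : ∀ x ∈ s, T x ∈ Y) {x : E} (hx : x ∈ cspan s) : T x ∈ Y :=
  (BddLinOn.of_clm (P := ⊤) T).mem_of_cspan (by simp) (by simp) hY h hx

theorem eqOn_cspan {S T : E →L[ℂ] F} {s : Set E} (h : ∀ x ∈ s, S x = T x) {x : E}
    (hx : x ∈ cspan s) : S x = T x :=
  (BddLinOn.of_clm (P := ⊤) S).eq_of_cspan (.of_clm T) (by simp) (by simp) h hx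

variable {X : Type*} [NormedAddCommGroup X] [NormedSpace ℂ X]

theorem BddLinOn.comp_left {P : Submodule ℂ X} {f : X → E →L[ℂ] F} (hf : BddLinOn P f)
    (A : F →L[ℂ] G) : BddLinOn P (fun x => A ∘L f x) :=
  hf.clm_comp (compL ℂ E F G A)

theorem BddLinOn.comp_right {P : Submodule ℂ X} {f : X → F →L[ℂ] G} (hf : BddLinOn P f)
    (A : E →L[ℂ] F) : BddLinOn P (fun x => f x ∘L A) :=
  hf.clm_comp ((compL ℂ E F G).flip A)

theorem comp_mem_of_cspan_right (A : F →L[ℂ] G) {s : Set (E →L[ℂ] F)}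
    {Y : Submodule ℂ (E →L[ℂ] G)} (hY : IsClosed (Y : Set (E →L[ℂ] G)))
    (h : ∀ x ∈ s, A ∘L x ∈ Y) {x : E →L[ℂ] F} (hx : x ∈ cspan s) : A ∘L x ∈ Y :=
  map_mem_of_cspan (compL ℂ E F G A) hY h hx

theorem comp_mem_of_cspan_left (A : E →L[ℂ] F) {s : Set (F →L[ℂ] G)}
    {Y : Submodule ℂ (E →L[ℂ] G)} (hY : IsClosed (Y : Set (E →L[ℂ] G)))
    (h : ∀ x ∈ s, x ∘L A ∈ Y) {x : F →L[ℂ] G} (hx : x ∈ cspan s) : x ∘L A ∈ Y :=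
  map_mem_of_cspan ((compL ℂ E F G).flip A) hY h hx

end ClosedSpan

/-- `comp_assoc`, with a proof that is not definitional unfolding. -/
theorem assoc_comp {E F G X : Type*} [NormedAddCommGroup E] [NormedSpace ℂ E]
    [NormedAddCommGroup F] [NormedSpace ℂ F] [NormedAddCommGroup G] [NormedSpace ℂ G]
    [NormedAddCommGroup X] [NormedSpace ℂ X] (h : G →L[ℂ] X) (g : F →L[ℂ] G) (f : E →L[ℂ] F) :
    (h ∘L g) ∘L f = h ∘L g ∘L f :=
  ContinuousLinearMap.ext fun _ => rfl

/-! ### Adjoints and closed spans; isometric extension -/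

section Adjoint

variable {E F G : Type*} [NormedAddCommGroup E] [InnerProductSpace ℂ E] [CompleteSpace E]
  [NormedAddCommGroup F] [InnerProductSpace ℂ F] [CompleteSpace F]

theorem adjoint_mem_of_cspan {s : Set (E →L[ℂ] F)} {Y : Submodule ℂ (F →L[ℂ] E)}
    (hY : IsClosed (Y : Set (F →L[ℂ] E))) (h : ∀ x ∈ s, adjoint x ∈ Y) {x : E →L[ℂ] F}
    (hx : x ∈ cspan s) : adjoint x ∈ Y := by
  let Y' : Submodule ℂ (E →L[ℂ] F) :=
    { carrier := {x | adjoint x ∈ Y}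
      add_mem' := fun {a b} ha hb => by
        change adjoint (a + b) ∈ Y
        rw [map_add]; exact Y.add_mem ha hb
      zero_mem' := by change adjoint (0 : E →L[ℂ] F) ∈ Y; simp
      smul_mem' := fun c a ha => by
        change adjoint (c • a) ∈ Y
        rw [map_smulₛₗ]; exact Y.smul_mem _ ha }
  exact cspan_le (Y := Y') (hY.preimage (LinearIsometryEquiv.continuous _)) h hx

/-- Equal Gram matrices give equal norms of all finite linear combinations, so the extension bound
holds with constant 1. -/
theorem exists_isometric_extension {ι : Type*} {f : ι → E} {g : ι → F}
    (hf : cspan (Set.range f) = ⊤) (h : ∀ i j, ⟪g i, g j⟫_ℂ = ⟪f i, f j⟫_ℂ) :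
    ∃ T : E →L[ℂ] F, ∀ i, T (f i) = g i := by
  refine exists_extension hf 1 fun s a => ?_
  have e : ((‖∑ i ∈ s, a i • g i‖ : ℂ)) ^ 2 = (‖∑ i ∈ s, a i • f i‖ : ℂ) ^ 2 := by
    have e1 : ∀ v : E, (‖v‖ : ℂ) ^ 2 = ⟪v, v⟫_ℂ := fun v => (inner_self_eq_norm_sq_to_K v).symm
    have e2 : ∀ v : F, (‖v‖ : ℂ) ^ 2 = ⟪v, v⟫_ℂ := fun v => (inner_self_eq_norm_sq_to_K v).symm
    simp only [e1, e2, sum_inner, inner_sum, inner_smul_left, inner_smul_right, h]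
  have e' : ‖∑ i ∈ s, a i • g i‖ ^ 2 = ‖∑ i ∈ s, a i • f i‖ ^ 2 := by exact_mod_cast e
  rw [one_mul]
  exact ((sq_eq_sq₀ (norm_nonneg _) (norm_nonneg _)).1 e').le

end Adjoint

/-! ### Modules over a base and the representation ρ -/

section Modules

variable {𝔎 H K : Type*} [NormedAddCommGroup 𝔎] [InnerProductSpace ℂ 𝔎] [CompleteSpace 𝔎]
  [NormedAddCommGroup H] [InnerProductSpace ℂ H] [CompleteSpace H]
  [NormedAddCommGroup K] [InnerProductSpace ℂ K] [CompleteSpace K]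
  {𝔟 : CStarBase 𝔎} {α : Submodule ℂ (𝔎 →L[ℂ] H)}

/-- The first algebra of a base as a subspace. -/
def CStarBase.subB (𝔟 : CStarBase 𝔎) : Submodule ℂ (𝔎 →L[ℂ] 𝔎) where
  carrier := 𝔟.B
  add_mem' := fun ha hb => add_mem ha hb
  zero_mem' := zero_mem 𝔟.B
  smul_mem' := fun c _ h => SMulMemClass.smul_mem c h

theorem CStarBase.adjoint_mem {𝔟 : CStarBase 𝔎} {b : 𝔎 →L[ℂ] 𝔎} (hb : b ∈ 𝔟.B) :
    adjoint b ∈ 𝔟.B := star_mem hb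

theorem CStarBase.adjoint_mem_Bd {𝔟 : CStarBase 𝔎} {b : 𝔎 →L[ℂ] 𝔎} (hb : b ∈ 𝔟.Bd) :
    adjoint b ∈ 𝔟.Bd := star_mem hb

theorem CStarBase.ext_B {𝔟 : CStarBase 𝔎} {F : Type*} [NormedAddCommGroup F] [NormedSpace ℂ F]
    {S T : 𝔎 →L[ℂ] F} (h : ∀ b ∈ 𝔟.B, S ∘L b = T ∘L b) : S = T := by
  refine ContinuousLinearMap.ext fun v => ?_
  refine eqOn_cspan (s := {v : 𝔎 | ∃ b ∈ 𝔟.B, ∃ ζ : 𝔎, b ζ = v}) ?_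
    (𝔟.nondegenerate_B ▸ Submodule.mem_top)
  rintro _ ⟨b, hb, ζ, rfl⟩
  exact congrArg (fun f : 𝔎 →L[ℂ] F => f ζ) (h b hb)

namespace IsCStarModule

theorem ext (h : IsCStarModule 𝔟 α) {F : Type*} [NormedAddCommGroup F] [NormedSpace ℂ F]
    {S T : H →L[ℂ] F} (hST : ∀ ξ ∈ α, S ∘L ξ = T ∘L ξ) : S = T :=
  ext_of_total h.total' fun p => congrArg (fun f : 𝔎 →L[ℂ] F => f p.2) (hST p.1 p.1.2)

theorem cspan_inner (h : IsCStarModule 𝔟 α) :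
    cspan {T : 𝔎 →L[ℂ] 𝔎 | ∃ ξ ∈ α, ∃ ξ' ∈ α, adjoint ξ ∘L ξ' = T} = 𝔟.subB :=
  SetLike.coe_injective h.inner_eq

theorem comp_mem (h : IsCStarModule 𝔟 α) {ξ : 𝔎 →L[ℂ] H} (hξ : ξ ∈ α) {b : 𝔎 →L[ℂ] 𝔎}
    (hb : b ∈ 𝔟.B) : ξ ∘L b ∈ α := by
  have := mem_cspan (s := {T : 𝔎 →L[ℂ] H | ∃ ξ ∈ α, ∃ b ∈ 𝔟.B, ξ ∘L b = T}) ⟨ξ, hξ, b, hb, rfl⟩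
  rwa [h.mul_eq] at this

end IsCStarModule

theorem rho_comp (h : IsCStarModule 𝔟 α) {c : 𝔎 →L[ℂ] 𝔎} (hc : c ∈ 𝔟.Bd) {ξ : 𝔎 →L[ℂ] H}
    (hξ : ξ ∈ α) : rho α c ∘L ξ = ξ ∘L c :=
  ContinuousLinearMap.ext fun ζ => rho_apply h hc hξ ζ

theorem rho_eq (h : IsCStarModule 𝔟 α) {c : 𝔎 →L[ℂ] 𝔎} (hc : c ∈ 𝔟.Bd) {T : H →L[ℂ] H}
    (hT : ∀ ξ ∈ α, T ∘L ξ = ξ ∘L c) : T = rho α c :=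
  h.ext fun ξ hξ => (hT ξ hξ).trans (rho_comp h hc hξ).symm

theorem adjoint_rho (h : IsCStarModule 𝔟 α) {c : 𝔎 →L[ℂ] 𝔎} (hc : c ∈ 𝔟.Bd) :
    adjoint (rho α c) = rho α (adjoint c) := by
  refine rho_eq h (CStarBase.adjoint_mem_Bd hc) fun ξ hξ => ?_
  have : adjoint ξ ∘L rho α c = c ∘L adjoint ξ := h.ext fun ξ' hξ' => by
    rw [comp_assoc, rho_comp h hc hξ', ← comp_assoc, comp_assoc c]
    exact (𝔟.commute _ (h.inner_mem hξ hξ') c hc).eq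
  simpa [adjoint_comp] using congrArg adjoint this

/-- On Sξ both sides act by Sξc, because Sξ again belongs to the target module. This is the source
of all the commutation rules between kets, slices and ρ. -/
theorem comp_rho {β : Submodule ℂ (𝔎 →L[ℂ] K)} (h : IsCStarModule 𝔟 α) (h' : IsCStarModule 𝔟 β)
    {S : H →L[ℂ] K} (hS : S ∈ semiMorphisms α β) {c : 𝔎 →L[ℂ] 𝔎} (hc : c ∈ 𝔟.Bd) :
    S ∘L rho α c = rho β c ∘L S :=
  h.ext fun ξ hξ => by
    rw [comp_assoc, rho_comp h hc hξ, comp_assoc, rho_comp h' hc (hS ξ hξ), comp_assoc]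

/-- The relation Tξ = ξc for ξ ∈ α determines T and survives limits in c and T, so the closed graph
theorem gives boundedness without a norm estimate. The same scheme serves for kets and for
`idTensor`. -/
theorem bddLinOn_rho (h : IsCStarModule 𝔟 α) : BddLinOn 𝔟.dagger.subB (rho α) := by
  refine .of_graph 𝔟.isClosed_Bd (fun x hx y hy => ?_) (fun c x hx => ?_)
    fun u x y hu hx h1 h2 => ?_
  · refine (rho_eq h (add_mem hx hy : x + y ∈ 𝔟.Bd) fun ξ hξ => ?_).symm
    rw [add_comp, rho_comp h hx hξ, rho_comp h hy hξ, comp_add]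
  · refine (rho_eq h (SMulMemClass.smul_mem c hx : c • x ∈ 𝔟.Bd) fun ξ hξ => ?_).symm
    rw [smul_comp, rho_comp h hx hξ, comp_smul]
  · refine rho_eq h hx fun ξ hξ => ?_
    have e1 := (((compL ℂ 𝔎 H H).flip ξ).continuous.tendsto y).comp h2
    have e2 := (((compL ℂ 𝔎 𝔎 H) ξ).continuous.tendsto x).comp h1
    refine tendsto_nhds_unique e1 (e2.congr fun n => ?_)
    exact (rho_comp h (hu n) hξ).symm

theorem Compatible.rho_comp_mem {C : NonUnitalStarSubalgebra ℂ (𝔎 →L[ℂ] 𝔎)}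
    {γ : Submodule ℂ (𝔎 →L[ℂ] H)} (h : Compatible C α γ) {c : 𝔎 →L[ℂ] 𝔎} (hc : c ∈ C)
    {ξ : 𝔎 →L[ℂ] H} (hξ : ξ ∈ γ) : rho α c ∘L ξ ∈ γ := by
  have := mem_cspan (s := {T : 𝔎 →L[ℂ] H | ∃ c ∈ C, ∃ ξ ∈ γ, rho α c ∘L ξ = T})
    ⟨c, hc, ξ, hξ, rfl⟩
  rwa [show cspan _ = γ from h] at this

/-- Compatibility makes ρ_α(b) a semi-morphism of γ, and semi-morphisms intertwine ρ_γ. -/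
theorem rho_commute {𝔠 : CStarBase 𝔎} {γ : Submodule ℂ (𝔎 →L[ℂ] H)}
    (h' : IsCStarModule 𝔠 γ) (hc : Compatible 𝔟.Bd α γ) {b c : 𝔎 →L[ℂ] 𝔎} (hb : b ∈ 𝔟.Bd)
    (hcc : c ∈ 𝔠.Bd) : rho α b ∘L rho γ c = rho γ c ∘L rho α b :=
  comp_rho h' h' (fun _ hξ => hc.rho_comp_mem hb hξ) hcc

/-- The common source of the module structures on a relative tensor product: transport α along
operators κᵢ, thought of as kets. The condition [κᵢ†κⱼα] = α makes the inner products of the new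
module span the same algebra as those of α. -/
theorem isCStarModule_cspan {Ω ι : Type*} [NormedAddCommGroup Ω] [InnerProductSpace ℂ Ω]
    [CompleteSpace Ω] {κ : ι → H →L[ℂ] Ω} (hα : IsCStarModule 𝔟 α)
    (htot : cspan (Set.range fun p : ι × H => κ p.1 p.2) = ⊤)
    (hκ : cspan {T | ∃ i j, ∃ ξ ∈ α, adjoint (κ i) ∘L κ j ∘L ξ = T} = α) :
    IsCStarModule 𝔟 (cspan {T | ∃ i, ∃ ξ ∈ α, κ i ∘L ξ = T}) := by
  set X := cspan {T | ∃ i, ∃ ξ ∈ α, κ i ∘L ξ = T} with hX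
  have hm : ∀ i, ∀ ξ ∈ α, κ i ∘L ξ ∈ X := fun i ξ hξ => mem_cspan ⟨i, ξ, hξ, rfl⟩
  have hk : ∀ i j, ∀ ξ ∈ α, adjoint (κ i) ∘L κ j ∘L ξ ∈ α := fun i j ξ hξ => by
    have := mem_cspan (s := {T | ∃ i j, ∃ ξ ∈ α, adjoint (κ i) ∘L κ j ∘L ξ = T})
      ⟨i, j, ξ, hξ, rfl⟩
    rwa [hκ] at this
  have h1 : ∀ i, ∀ ξ ∈ α, ∀ T ∈ X, adjoint (κ i ∘L ξ) ∘L T ∈ 𝔟.subB := fun i ξ hξ T hT => by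
    refine comp_mem_of_cspan_right _ 𝔟.isClosed_B ?_ hT
    rintro _ ⟨j, ξ', hξ', rfl⟩
    rw [adjoint_comp, comp_assoc]
    exact hα.inner_mem hξ (hk i j ξ' hξ')
  have h2 : ∀ T ∈ X, ∀ T' ∈ X, adjoint T ∘L T' ∈ 𝔟.subB := fun T hT T' hT' => by
    have : adjoint T' ∘L T ∈ 𝔟.subB := by
      refine comp_mem_of_cspan_right _ 𝔟.isClosed_B ?_ hT
      rintro _ ⟨j, ξ', hξ', rfl⟩
      have := CStarBase.adjoint_mem (h1 j ξ' hξ' T' hT')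
      change _ ∈ 𝔟.B
      simpa [adjoint_comp] using this
    have := CStarBase.adjoint_mem this
    change _ ∈ 𝔟.B
    simpa [adjoint_comp] using this
  refine ⟨isClosed_cspan _, ?_, ?_, ?_⟩
  · refine cspan_eq_top htot ?_
    rintro _ ⟨⟨i, v⟩, rfl⟩
    refine map_mem_of_cspan (κ i) (isClosed_cspan _) ?_
      (hα.total ▸ (Submodule.mem_top : v ∈ ⊤))
    rintro _ ⟨ξ, hξ, ζ, rfl⟩
    exact mem_cspan ⟨κ i ∘L ξ, hm i ξ hξ, ζ, rfl⟩
  · refine le_antisymm (cspan_le (isClosed_cspan _) ?_) (cspan_le (isClosed_cspan _) ?_)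
    · rintro _ ⟨T, hT, b, hb, rfl⟩
      refine comp_mem_of_cspan_left b (isClosed_cspan _) ?_ hT
      rintro _ ⟨i, ξ, hξ, rfl⟩
      rw [comp_assoc]
      exact hm i _ (hα.comp_mem hξ hb)
    · rintro _ ⟨i, ξ, hξ, rfl⟩
      rw [← hα.mul_eq] at hξ
      refine comp_mem_of_cspan_right _ (isClosed_cspan _) ?_ hξ
      rintro _ ⟨ξ', hξ', b, hb, rfl⟩
      exact mem_cspan ⟨κ i ∘L ξ', hm i ξ' hξ', b, hb, rfl⟩
  · change _ = (𝔟.subB : Set (𝔎 →L[ℂ] 𝔎))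
    refine congrArg SetLike.coe (le_antisymm (cspan_le 𝔟.isClosed_B ?_) ?_)
    · rintro _ ⟨T, hT, T', hT', rfl⟩
      exact h2 T hT T' hT'
    · rw [← hα.cspan_inner]
      refine cspan_le (isClosed_cspan _) ?_
      rintro _ ⟨ξ, hξ, ξ', hξ', rfl⟩
      rw [← hκ] at hξ'
      refine comp_mem_of_cspan_right _ (isClosed_cspan _) ?_ hξ'
      rintro _ ⟨i, j, ξ'', hξ'', rfl⟩
      refine mem_cspan ⟨_, hm i ξ hξ, _, hm j ξ'' hξ'', ?_⟩
      rw [adjoint_comp, comp_assoc]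

end Modules

/-! ### Calculus of kets and bras; the modules α ◁ γ and β ▷ δ -/

section Kets

variable {𝔎 H K : Type*} [NormedAddCommGroup 𝔎] [InnerProductSpace ℂ 𝔎] [CompleteSpace 𝔎]
  [NormedAddCommGroup H] [InnerProductSpace ℂ H] [CompleteSpace H]
  [NormedAddCommGroup K] [InnerProductSpace ℂ K] [CompleteSpace K]
  {𝔟 : CStarBase 𝔎} {β : Submodule ℂ (𝔎 →L[ℂ] H)} {γ : Submodule ℂ (𝔎 →L[ℂ] K)}

theorem adjoint_ket1 (ξ : 𝔎 →L[ℂ] H) : adjoint (ket1 β γ ξ) = bra1 β γ ξ := adjoint_adjoint _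

theorem adjoint_ket2 (η : 𝔎 →L[ℂ] K) : adjoint (ket2 β γ η) = bra2 β γ η := adjoint_adjoint _

/-- The exchange rule: both sides send ζ to ξ ⊗ ζ ⊗ η. -/
theorem ket1_comp (hβ : IsCStarModule 𝔟 β) (hγ : IsCStarModule 𝔟.dagger γ) {ξ : 𝔎 →L[ℂ] H}
    {η : 𝔎 →L[ℂ] K} (hξ : ξ ∈ β) (hη : η ∈ γ) : ket1 β γ ξ ∘L η = ket2 β γ η ∘L ξ :=
  ContinuousLinearMap.ext fun ζ =>
    (ket1_apply hβ hγ ⟨ξ, hξ⟩ ζ ⟨η, hη⟩).trans (ket2_apply hβ hγ ⟨ξ, hξ⟩ ζ ⟨η, hη⟩).symm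

theorem ext_ket1 (hβ : IsCStarModule 𝔟 β) (hγ : IsCStarModule 𝔟.dagger γ) {F : Type*}
    [NormedAddCommGroup F] [NormedSpace ℂ F] {S T : RTP β γ →L[ℂ] F}
    (h : ∀ ξ ∈ β, S ∘L ket1 β γ ξ = T ∘L ket1 β γ ξ) : S = T := by
  refine ext_of_total tmul_total fun p => ?_
  rw [tmulFamily, ← ket1_apply hβ hγ]
  exact congrArg (fun f : K →L[ℂ] F => f _) (h p.1 p.1.2)

theorem ext_ket2 (hβ : IsCStarModule 𝔟 β) (hγ : IsCStarModule 𝔟.dagger γ) {F : Type*}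
    [NormedAddCommGroup F] [NormedSpace ℂ F] {S T : RTP β γ →L[ℂ] F}
    (h : ∀ η ∈ γ, S ∘L ket2 β γ η = T ∘L ket2 β γ η) : S = T := by
  refine ext_of_total tmul_total fun p => ?_
  rw [tmulFamily, ← ket2_apply hβ hγ]
  exact congrArg (fun f : H →L[ℂ] F => f _) (h p.2.2 p.2.2.2)

theorem ket1_total (hβ : IsCStarModule 𝔟 β) (hγ : IsCStarModule 𝔟.dagger γ) {ι : Type*}
    {k : ι → K} (hk : cspan (Set.range k) = ⊤) :
    cspan (Set.range fun p : β × ι => ket1 β γ p.1 (k p.2)) = ⊤ := by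
  refine cspan_eq_top tmul_total ?_
  rintro _ ⟨p, rfl⟩
  rw [tmulFamily, ← ket1_apply hβ hγ]
  refine map_mem_of_cspan _ (isClosed_cspan _) ?_ (hk ▸ (Submodule.mem_top : _ ∈ ⊤))
  rintro _ ⟨i, rfl⟩
  exact mem_cspan ⟨(p.1, i), rfl⟩

theorem ket2_total (hβ : IsCStarModule 𝔟 β) (hγ : IsCStarModule 𝔟.dagger γ) {ι : Type*}
    {k : ι → H} (hk : cspan (Set.range k) = ⊤) :
    cspan (Set.range fun p : γ × ι => ket2 β γ p.1 (k p.2)) = ⊤ := by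
  refine cspan_eq_top tmul_total ?_
  rintro _ ⟨p, rfl⟩
  rw [tmulFamily, ← ket2_apply hβ hγ]
  refine map_mem_of_cspan _ (isClosed_cspan _) ?_ (hk ▸ (Submodule.mem_top : _ ∈ ⊤))
  rintro _ ⟨i, rfl⟩
  exact mem_cspan ⟨(p.2.2, i), rfl⟩

theorem cspan_range_id {E : Type*} [NormedAddCommGroup E] [NormedSpace ℂ E] :
    cspan (Set.range fun x : E => x) = ⊤ :=
  top_le_iff.1 fun x _ => mem_cspan ⟨x, rfl⟩

theorem bra2_comp_ket2 (hβ : IsCStarModule 𝔟 β) (hγ : IsCStarModule 𝔟.dagger γ)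
    {η η' : 𝔎 →L[ℂ] K} (hη : η ∈ γ) (hη' : η' ∈ γ) :
    bra2 β γ η ∘L ket2 β γ η' = rho β (adjoint η ∘L η') := by
  have hm : ∀ η' ∈ γ, adjoint η ∘L η' ∈ 𝔟.Bd := fun η' h => hγ.inner_mem hη h
  refine rho_eq hβ (hm η' hη') fun ξ hξ => ContinuousLinearMap.ext fun ζ => ?_
  exact (congrArg (bra2 β γ η) (ket2_apply hβ hγ ⟨ξ, hξ⟩ ζ ⟨η', hη'⟩)).trans
    (bra2_tmul hβ hγ hm ⟨ξ, hξ⟩ ζ ⟨η', hη'⟩)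

theorem bra1_comp_ket1 (hβ : IsCStarModule 𝔟 β) (hγ : IsCStarModule 𝔟.dagger γ)
    {ξ ξ' : 𝔎 →L[ℂ] H} (hξ : ξ ∈ β) (hξ' : ξ' ∈ β) :
    bra1 β γ ξ ∘L ket1 β γ ξ' = rho γ (adjoint ξ ∘L ξ') := by
  have hm : ∀ ξ' ∈ β, adjoint ξ ∘L ξ' ∈ 𝔟.B := fun ξ' h => hβ.inner_mem hξ h
  refine rho_eq hγ (hm ξ' hξ') fun η hη => ContinuousLinearMap.ext fun ζ => ?_
  exact (congrArg (bra1 β γ ξ) (ket1_apply hβ hγ ⟨ξ', hξ'⟩ ζ ⟨η, hη⟩)).trans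
    (bra1_tmul hβ hγ hm ⟨ξ', hξ'⟩ ζ ⟨η, hη⟩)

/-- Only η†γ ⊆ 𝔅† is asked of η, not η ∈ γ, so that the rule also applies to a cofixed element,
which is merely a multiplier. -/
theorem bra2_comp_ket1' (hβ : IsCStarModule 𝔟 β) (hγ : IsCStarModule 𝔟.dagger γ)
    {ξ : 𝔎 →L[ℂ] H} {η : 𝔎 →L[ℂ] K} (hξ : ξ ∈ β) (hη : ∀ η' ∈ γ, adjoint η ∘L η' ∈ 𝔟.Bd) :
    bra2 β γ η ∘L ket1 β γ ξ = ξ ∘L adjoint η := by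
  refine hγ.ext fun η' hη' => ContinuousLinearMap.ext fun ζ => ?_
  exact (congrArg (bra2 β γ η) (ket1_apply hβ hγ ⟨ξ, hξ⟩ ζ ⟨η', hη'⟩)).trans
    (bra2_tmul hβ hγ hη ⟨ξ, hξ⟩ ζ ⟨η', hη'⟩)

theorem bra1_comp_ket2' (hβ : IsCStarModule 𝔟 β) (hγ : IsCStarModule 𝔟.dagger γ)
    {ξ : 𝔎 →L[ℂ] H} {η : 𝔎 →L[ℂ] K} (hξ : ∀ ξ' ∈ β, adjoint ξ ∘L ξ' ∈ 𝔟.B) (hη : η ∈ γ) :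
    bra1 β γ ξ ∘L ket2 β γ η = η ∘L adjoint ξ := by
  refine hβ.ext fun ξ' hξ' => ContinuousLinearMap.ext fun ζ => ?_
  exact (congrArg (bra1 β γ ξ) (ket2_apply hβ hγ ⟨ξ', hξ'⟩ ζ ⟨η, hη⟩)).trans
    (bra1_tmul hβ hγ hξ ⟨ξ', hξ'⟩ ζ ⟨η, hη⟩)

theorem bra2_comp_ket1 (hβ : IsCStarModule 𝔟 β) (hγ : IsCStarModule 𝔟.dagger γ)
    {ξ : 𝔎 →L[ℂ] H} {η : 𝔎 →L[ℂ] K} (hξ : ξ ∈ β) (hη : η ∈ γ) :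
    bra2 β γ η ∘L ket1 β γ ξ = ξ ∘L adjoint η :=
  bra2_comp_ket1' hβ hγ hξ fun _ h => hγ.inner_mem hη h

theorem bra1_comp_ket2 (hβ : IsCStarModule 𝔟 β) (hγ : IsCStarModule 𝔟.dagger γ)
    {ξ : 𝔎 →L[ℂ] H} {η : 𝔎 →L[ℂ] K} (hξ : ξ ∈ β) (hη : η ∈ γ) :
    bra1 β γ ξ ∘L ket2 β γ η = η ∘L adjoint ξ :=
  bra1_comp_ket2' hβ hγ (fun _ h => hβ.inner_mem hξ h) hη

/-- The exchange rule for a multiplier `η` in the second leg. -/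
theorem ket2_comp' (hβ : IsCStarModule 𝔟 β) (hγ : IsCStarModule 𝔟.dagger γ)
    {ξ : 𝔎 →L[ℂ] H} {η : 𝔎 →L[ℂ] K} (hξ : ξ ∈ β) (hη : ∀ η' ∈ γ, adjoint η ∘L η' ∈ 𝔟.Bd) :
    ket2 β γ η ∘L ξ = ket1 β γ ξ ∘L η := by
  -- For a multiplier only the bra has an explicit formula, so the adjoint identity is checked. On
  -- |η'⟩₂ξ' it says that ξ†ξ' ∈ 𝔅 and η†η' ∈ 𝔅† commute.
  have : adjoint ξ ∘L bra2 β γ η = adjoint η ∘L bra1 β γ ξ := ext_ket2 hβ hγ fun η' hη' => by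
    rw [comp_assoc, comp_assoc, bra1_comp_ket2 hβ hγ hξ hη']
    refine hβ.ext fun ξ' hξ' => ?_
    have e : bra2 β γ η ∘L ket2 β γ η' ∘L ξ' = ξ' ∘L adjoint η ∘L η' := by
      rw [← ket1_comp hβ hγ hξ' hη', ← comp_assoc, bra2_comp_ket1' hβ hγ hξ' hη, comp_assoc]
    simp only [assoc_comp] at e ⊢
    rw [e]
    have hc := (𝔟.commute _ (hβ.inner_mem hξ hξ') _ (hη _ hη')).eq
    simpa only [ContinuousLinearMap.mul_def, assoc_comp] using hc
  simpa [adjoint_comp, adjoint_ket1, ket1, ket2] using congrArg adjoint this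

theorem bddLinOn_ket1 (hβ : IsCStarModule 𝔟 β) (hγ : IsCStarModule 𝔟.dagger γ) :
    BddLinOn β (ket1 β γ) := by
  refine .of_graph hβ.isClosed (fun x hx y hy => hγ.ext fun η hη => ?_)
    (fun c x hx => hγ.ext fun η hη => ?_) fun u x y hu hx h1 h2 => hγ.ext fun η hη => ?_
  · rw [ket1_comp hβ hγ (add_mem hx hy) hη, add_comp, ket1_comp hβ hγ hx hη,
      ket1_comp hβ hγ hy hη, comp_add]
  · rw [ket1_comp hβ hγ (β.smul_mem c hx) hη, smul_comp, ket1_comp hβ hγ hx hη, comp_smul]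
  · rw [ket1_comp hβ hγ hx hη]
    have e1 := (((compL ℂ 𝔎 K (RTP β γ)).flip η).continuous.tendsto y).comp h2
    have e2 := (((compL ℂ 𝔎 H (RTP β γ)) (ket2 β γ η)).continuous.tendsto x).comp h1
    exact tendsto_nhds_unique e1 (e2.congr fun n => (ket1_comp hβ hγ (hu n) hη).symm)

theorem bddLinOn_ket2 (hβ : IsCStarModule 𝔟 β) (hγ : IsCStarModule 𝔟.dagger γ) :
    BddLinOn γ (ket2 β γ) := by
  refine .of_graph hγ.isClosed (fun x hx y hy => hβ.ext fun ξ hξ => ?_)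
    (fun c x hx => hβ.ext fun ξ hξ => ?_) fun u x y hu hx h1 h2 => hβ.ext fun ξ hξ => ?_
  · rw [← ket1_comp hβ hγ hξ (add_mem hx hy), add_comp, ← ket1_comp hβ hγ hξ hx,
      ← ket1_comp hβ hγ hξ hy, comp_add]
  · rw [← ket1_comp hβ hγ hξ (γ.smul_mem c hx), smul_comp, ← ket1_comp hβ hγ hξ hx, comp_smul]
  · rw [← ket1_comp hβ hγ hξ hx]
    have e1 := (((compL ℂ 𝔎 H (RTP β γ)).flip ξ).continuous.tendsto y).comp h2
    have e2 := (((compL ℂ 𝔎 K (RTP β γ)) (ket1 β γ ξ)).continuous.tendsto x).comp h1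
    exact tendsto_nhds_unique e1 (e2.congr fun n => ket1_comp hβ hγ hξ (hu n))

/-- `|ηc⟩₂ = |η⟩₂ ρ_β(c)`. -/
theorem ket2_comp_right (hβ : IsCStarModule 𝔟 β) (hγ : IsCStarModule 𝔟.dagger γ)
    {η : 𝔎 →L[ℂ] K} (hη : η ∈ γ) {c : 𝔎 →L[ℂ] 𝔎} (hc : c ∈ 𝔟.Bd) :
    ket2 β γ (η ∘L c) = ket2 β γ η ∘L rho β c :=
  hβ.ext fun ξ hξ => by
    rw [← ket1_comp hβ hγ hξ (hγ.comp_mem hη hc), comp_assoc, rho_comp hβ hc hξ, ← comp_assoc,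
      ← comp_assoc, ket1_comp hβ hγ hξ hη]

theorem mem_ltri {α : Submodule ℂ (𝔎 →L[ℂ] H)} {η : 𝔎 →L[ℂ] K} {ξ : 𝔎 →L[ℂ] H} (hη : η ∈ γ)
    (hξ : ξ ∈ α) : ket2 β γ η ∘L ξ ∈ ltri β γ α :=
  mem_cspan ⟨η, hη, ξ, hξ, rfl⟩

theorem mem_rtri {δ : Submodule ℂ (𝔎 →L[ℂ] K)} {η : 𝔎 →L[ℂ] K} {ξ : 𝔎 →L[ℂ] H} (hξ : ξ ∈ β)
    (hη : η ∈ δ) : ket1 β γ ξ ∘L η ∈ rtri β γ δ :=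
  mem_cspan ⟨ξ, hξ, η, hη, rfl⟩

/-- Since ⟨η|₂|η'⟩₂ = ρ_β(η†η') and [γ†γ] = 𝔅†, the hypothesis of `isCStarModule_cspan` for the kets
|η⟩₂ is the compatibility [ρ_β(𝔅†)α] = α. The base 𝔠 of α is arbitrary and is inherited by α ◁ γ. -/
theorem isCStarModule_ltri (hβ : IsCStarModule 𝔟 β) (hγ : IsCStarModule 𝔟.dagger γ)
    {𝔠 : CStarBase 𝔎} {α : Submodule ℂ (𝔎 →L[ℂ] H)} (hα : IsCStarModule 𝔠 α)
    (hc : Compatible 𝔟.Bd β α) : IsCStarModule 𝔠 (ltri β γ α) := by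
  have htot : cspan (Set.range fun p : γ × H => ket2 β γ p.1 p.2) = ⊤ :=
    ket2_total (k := fun v : H => v) hβ hγ cspan_range_id
  have key := isCStarModule_cspan (ι := γ) (κ := fun η => ket2 β γ η) hα htot ?_
  · have e : {T | ∃ η ∈ γ, ∃ ξ ∈ α, ket2 β γ η ∘L ξ = T} =
        {T | ∃ η : γ, ∃ ξ ∈ α, ket2 β γ η ∘L ξ = T} := by
      ext T; simp
    rw [ltri, e]
    exact key
  · refine le_antisymm (cspan_le hα.isClosed ?_) ?_
    · rintro _ ⟨η, η', ξ, hξ, rfl⟩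
      rw [← comp_assoc, adjoint_ket2, bra2_comp_ket2 hβ hγ η.2 η'.2]
      exact hc.rho_comp_mem (hγ.inner_mem η.2 η'.2) hξ
    · conv_lhs => rw [← show cspan _ = α from hc]
      refine cspan_le (isClosed_cspan _) ?_
      rintro _ ⟨c, hcB, ξ, hξ, rfl⟩
      replace hcB : c ∈ 𝔟.dagger.subB := hcB
      rw [← hγ.cspan_inner] at hcB
      refine ((bddLinOn_rho hβ).comp_right ξ).mem_of_cspan 𝔟.isClosed_Bd ?_
        (isClosed_cspan _) ?_ hcB
      · rintro _ ⟨η, hη, η', hη', rfl⟩; exact hγ.inner_mem hη hη'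
      · rintro _ ⟨η, hη, η', hη', rfl⟩
        refine mem_cspan ⟨⟨η, hη⟩, ⟨η', hη'⟩, ξ, hξ, ?_⟩
        rw [← comp_assoc, adjoint_ket2, bra2_comp_ket2 hβ hγ hη hη']

theorem isCStarModule_rtri (hβ : IsCStarModule 𝔟 β) (hγ : IsCStarModule 𝔟.dagger γ)
    {𝔠 : CStarBase 𝔎} {δ : Submodule ℂ (𝔎 →L[ℂ] K)} (hδ : IsCStarModule 𝔠 δ)
    (hc : Compatible 𝔟.B γ δ) : IsCStarModule 𝔠 (rtri β γ δ) := by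
  have htot : cspan (Set.range fun p : β × K => ket1 β γ p.1 p.2) = ⊤ :=
    ket1_total (k := fun v : K => v) hβ hγ cspan_range_id
  have key := isCStarModule_cspan (ι := β) (κ := fun ξ => ket1 β γ ξ) hδ htot ?_
  · have e : {T | ∃ ξ ∈ β, ∃ η ∈ δ, ket1 β γ ξ ∘L η = T} =
        {T | ∃ ξ : β, ∃ η ∈ δ, ket1 β γ ξ ∘L η = T} := by
      ext T; simp
    rw [rtri, e]
    exact key
  · refine le_antisymm (cspan_le hδ.isClosed ?_) ?_
    · rintro _ ⟨ξ, ξ', η, hη, rfl⟩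
      rw [← comp_assoc, adjoint_ket1, bra1_comp_ket1 hβ hγ ξ.2 ξ'.2]
      exact hc.rho_comp_mem (hβ.inner_mem ξ.2 ξ'.2) hη
    · conv_lhs => rw [← show cspan _ = δ from hc]
      refine cspan_le (isClosed_cspan _) ?_
      rintro _ ⟨b, hb, η, hη, rfl⟩
      replace hb : b ∈ 𝔟.subB := hb
      rw [← hβ.cspan_inner] at hb
      refine ((bddLinOn_rho hγ).comp_right η).mem_of_cspan 𝔟.isClosed_B ?_
        (isClosed_cspan _) ?_ hb
      · rintro _ ⟨ξ, hξ, ξ', hξ', rfl⟩; exact hβ.inner_mem hξ hξ'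
      · rintro _ ⟨ξ, hξ, ξ', hξ', rfl⟩
        refine mem_cspan ⟨⟨ξ, hξ⟩, ⟨ξ', hξ'⟩, η, hη, ?_⟩
        rw [← comp_assoc, adjoint_ket1, bra1_comp_ket1 hβ hγ hξ hξ']

/-- The ket |η⟩₂ is a semi-morphism from α to α ◁ γ, so `comp_rho` applies. -/
theorem rho_ltri_comp_ket2 (hβ : IsCStarModule 𝔟 β) (hγ : IsCStarModule 𝔟.dagger γ)
    {𝔠 : CStarBase 𝔎} {α : Submodule ℂ (𝔎 →L[ℂ] H)} (hα : IsCStarModule 𝔠 α)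
    (hc : Compatible 𝔟.Bd β α) {η : 𝔎 →L[ℂ] K} (hη : η ∈ γ) {c : 𝔎 →L[ℂ] 𝔎} (hcB : c ∈ 𝔠.Bd) :
    rho (ltri β γ α) c ∘L ket2 β γ η = ket2 β γ η ∘L rho α c :=
  (comp_rho hα (isCStarModule_ltri hβ hγ hα hc) (fun _ hξ => mem_ltri hη hξ) hcB).symm

theorem rho_rtri_comp_ket1 (hβ : IsCStarModule 𝔟 β) (hγ : IsCStarModule 𝔟.dagger γ)
    {𝔠 : CStarBase 𝔎} {δ : Submodule ℂ (𝔎 →L[ℂ] K)} (hδ : IsCStarModule 𝔠 δ)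
    (hc : Compatible 𝔟.B γ δ) {ξ : 𝔎 →L[ℂ] H} (hξ : ξ ∈ β) {c : 𝔎 →L[ℂ] 𝔎} (hcB : c ∈ 𝔠.Bd) :
    rho (rtri β γ δ) c ∘L ket1 β γ ξ = ket1 β γ ξ ∘L rho δ c :=
  (comp_rho hδ (isCStarModule_rtri hβ hγ hδ hc) (fun _ hη => mem_rtri hξ hη) hcB).symm

end Kets

/-! ### Flip, S ⊗ id and id ⊗ T for semi-morphisms -/

section TensorOperators

variable {𝔎 H K H' K' H'' K'' : Type*}
  [NormedAddCommGroup 𝔎] [InnerProductSpace ℂ 𝔎] [CompleteSpace 𝔎]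
  [NormedAddCommGroup H] [InnerProductSpace ℂ H] [CompleteSpace H]
  [NormedAddCommGroup K] [InnerProductSpace ℂ K] [CompleteSpace K]
  [NormedAddCommGroup H'] [InnerProductSpace ℂ H'] [CompleteSpace H']
  [NormedAddCommGroup K'] [InnerProductSpace ℂ K'] [CompleteSpace K']
  [NormedAddCommGroup H''] [InnerProductSpace ℂ H''] [CompleteSpace H'']
  [NormedAddCommGroup K''] [InnerProductSpace ℂ K''] [CompleteSpace K'']
  {𝔟 : CStarBase 𝔎} {β : Submodule ℂ (𝔎 →L[ℂ] H)} {γ : Submodule ℂ (𝔎 →L[ℂ] K)}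
  {β' : Submodule ℂ (𝔎 →L[ℂ] H')} {γ' : Submodule ℂ (𝔎 →L[ℂ] K')}
  {β'' : Submodule ℂ (𝔎 →L[ℂ] H'')} {γ'' : Submodule ℂ (𝔎 →L[ℂ] K'')}

theorem inner_tmul_flip (hβ : IsCStarModule 𝔟 β) (hγ : IsCStarModule 𝔟.dagger γ)
    (p q : β × 𝔎 × γ) :
    ⟪tmul p.2.2 p.2.1 p.1, tmul q.2.2 q.2.1 q.1⟫_ℂ = ⟪tmulFamily β γ p, tmulFamily β γ q⟫_ℂ := by
  rw [tmulFamily, tmulFamily, inner_tmul hβ hγ, inner_tmul (𝔟 := 𝔟.dagger) hγ hβ]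
  exact congrArg (fun f : 𝔎 →L[ℂ] 𝔎 => ⟪p.2.1, f q.2.1⟫_ℂ)
    (hβ.commute hγ p.1.2 q.1.2 p.2.2.2 q.2.2.2).symm.eq

theorem flip_tmul (hβ : IsCStarModule 𝔟 β) (hγ : IsCStarModule 𝔟.dagger γ) (ξ : β) (ζ : 𝔎)
    (η : γ) : flip β γ (tmul ξ ζ η) = tmul η ζ ξ :=
  extendOp_apply (f := tmulFamily β γ) (g := fun p => tmul p.2.2 p.2.1 p.1)
    (exists_isometric_extension tmul_total (inner_tmul_flip hβ hγ)) (ξ, ζ, η)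

theorem flip_ket1 (hβ : IsCStarModule 𝔟 β) (hγ : IsCStarModule 𝔟.dagger γ) {ξ : 𝔎 →L[ℂ] H}
    (hξ : ξ ∈ β) : flip β γ ∘L ket1 β γ ξ = ket2 γ β ξ :=
  hγ.ext fun η hη => ContinuousLinearMap.ext fun ζ =>
    (congrArg (flip β γ) (ket1_apply hβ hγ ⟨ξ, hξ⟩ ζ ⟨η, hη⟩)).trans
      ((flip_tmul hβ hγ ⟨ξ, hξ⟩ ζ ⟨η, hη⟩).trans
        (ket2_apply (𝔟 := 𝔟.dagger) hγ hβ ⟨η, hη⟩ ζ ⟨ξ, hξ⟩).symm)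

theorem flip_ket2 (hβ : IsCStarModule 𝔟 β) (hγ : IsCStarModule 𝔟.dagger γ) {η : 𝔎 →L[ℂ] K}
    (hη : η ∈ γ) : flip β γ ∘L ket2 β γ η = ket1 γ β η :=
  hβ.ext fun ξ hξ => ContinuousLinearMap.ext fun ζ =>
    (congrArg (flip β γ) (ket2_apply hβ hγ ⟨ξ, hξ⟩ ζ ⟨η, hη⟩)).trans
      ((flip_tmul hβ hγ ⟨ξ, hξ⟩ ζ ⟨η, hη⟩).trans
        (ket1_apply (𝔟 := 𝔟.dagger) hγ hβ ⟨η, hη⟩ ζ ⟨ξ, hξ⟩).symm)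

/-- The root r of the Gram matrix of the second leg is an input here, so that one and the same r
computes the norm for a family ξ and for its image under S. -/
theorem norm_sq_sum_tmul_of_root {ι : Type*} [Fintype ι] (hβ : IsCStarModule 𝔟 β)
    (hγ : IsCStarModule 𝔟.dagger γ) (η : ι → γ) {r : ι → ι → 𝔎 →L[ℂ] 𝔎}
    (hr : ∀ i j x y, ⟪(η i : 𝔎 →L[ℂ] K) x, (η j : 𝔎 →L[ℂ] K) y⟫_ℂ = ∑ k, ⟪r k i x, r k j y⟫_ℂ)
    (hc : ∀ d ∈ 𝔟.B, ∀ k j x, d (r k j x) = r k j (d x)) (ξ : ι → β) (z : ι → 𝔎) :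
    ‖∑ i, tmul (ξ i) (z i) (η i)‖ ^ 2 = ∑ k, ‖∑ i, (ξ i : 𝔎 →L[ℂ] H) (r k i (z i))‖ ^ 2 := by
  have h : ((‖∑ i, tmul (ξ i) (z i) (η i)‖ : ℂ)) ^ 2
      = ∑ k, (‖∑ i, (ξ i : 𝔎 →L[ℂ] H) (r k i (z i))‖ : ℂ) ^ 2 := by
    have e1 : ∀ v : RTP β γ, (‖v‖ : ℂ) ^ 2 = ⟪v, v⟫_ℂ :=
      fun v => (inner_self_eq_norm_sq_to_K v).symm
    have e2 : ∀ v : H, (‖v‖ : ℂ) ^ 2 = ⟪v, v⟫_ℂ := fun v => (inner_self_eq_norm_sq_to_K v).symm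
    have e3 : ∀ i j, ⟪tmul (ξ i) (z i) (η i), tmul (ξ j) (z j) (η j)⟫_ℂ =
        ∑ k, ⟪(ξ i : 𝔎 →L[ℂ] H) (r k i (z i)), (ξ j : 𝔎 →L[ℂ] H) (r k j (z j))⟫_ℂ :=
      fun i j => by
      have hd : adjoint (ξ i : 𝔎 →L[ℂ] H) ∘L (ξ j : 𝔎 →L[ℂ] H) ∈ 𝔟.B :=
        hβ.inner_mem (ξ i).2 (ξ j).2
      have e := inner_tmul_flip hβ hγ (ξ i, z i, η i) (ξ j, z j, η j)
      simp only [tmulFamily] at e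
      rw [← e, inner_tmul (𝔟 := 𝔟.dagger) hγ hβ, adjoint_inner_right, hr]
      refine Finset.sum_congr rfl fun k _ => ?_
      rw [← adjoint_inner_right (ξ i : 𝔎 →L[ℂ] H)]
      exact congrArg (fun v => ⟪r k i (z i), v⟫_ℂ) (hc _ hd k j (z j)).symm
    simp only [e1, e2, sum_inner, inner_sum, e3]
    refine (Finset.sum_congr rfl fun i _ => Finset.sum_comm).trans ?_
    exact Finset.sum_comm
  exact_mod_cast h

theorem exists_tensorId (hβ : IsCStarModule 𝔟 β) (hγ : IsCStarModule 𝔟.dagger γ)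
    (hβ' : IsCStarModule 𝔟 β') {S : H →L[ℂ] H'} (hS : S ∈ semiMorphisms β β') :
    ∃ T : RTP β γ →L[ℂ] RTP β' γ, ∀ ξ ∈ β, T ∘L ket1 β γ ξ = ket1 β' γ (S ∘L ξ) := by
  classical
  have hex : ∃ T : RTP β γ →L[ℂ] RTP β' γ, ∀ p : β × 𝔎 × γ,
      T (tmulFamily β γ p) = tmul ⟨S ∘L p.1, hS _ p.1.2⟩ p.2.1 p.2.2 := by
    refine exists_extension tmul_total ‖S‖ fun s a => ?_
    -- The root is taken of the leg that S does not touch. Its entries commute with 𝔅, so both norms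
    -- become sums of squares in H and H', and S can be pulled out of each summand at the cost of
    -- ‖S‖.
    obtain ⟨r, hr, hc⟩ := exists_root (fun p : s => ((p : β × 𝔎 × γ).2.2 : 𝔎 →L[ℂ] K))
    have hcom : ∀ d ∈ 𝔟.B, ∀ k j x, d (r k j x) = r k j (d x) := fun d hd => hc d fun i j =>
      𝔟.commute _ hd _
        (hγ.inner_mem (i : β × 𝔎 × γ).2.2.2 (j : β × 𝔎 × γ).2.2.2)
    rw [sum_smul_tmul]
    have e : ∑ p ∈ s, a p • tmul (⟨S ∘L p.1, hS _ p.1.2⟩ : β') p.2.1 p.2.2 =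
        ∑ p : s, tmul (⟨S ∘L (p : β × 𝔎 × γ).1, hS _ (p : β × 𝔎 × γ).1.2⟩ : β')
          (a p • (p : β × 𝔎 × γ).2.1) (p : β × 𝔎 × γ).2.2 := by
      rw [← Finset.sum_coe_sort]
      exact Finset.sum_congr rfl fun p _ => (map_smul _ _ _).symm
    rw [e]
    refine (sq_le_sq₀ (norm_nonneg _) (by positivity)).mp ?_
    rw [mul_pow, norm_sq_sum_tmul_of_root hβ hγ _ hr hcom,
      norm_sq_sum_tmul_of_root hβ' hγ _ hr hcom, Finset.mul_sum]
    refine Finset.sum_le_sum fun k _ => ?_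
    simp only [comp_apply]
    rw [← map_sum, ← mul_pow]
    gcongr
    exact S.le_opNorm _
  obtain ⟨T, hT⟩ := hex
  refine ⟨T, fun ξ hξ => hγ.ext fun η hη => ContinuousLinearMap.ext fun ζ => ?_⟩
  have e1 := ket1_apply hβ hγ ⟨ξ, hξ⟩ ζ ⟨η, hη⟩
  have e2 := ket1_apply hβ' hγ ⟨S ∘L ξ, hS _ hξ⟩ ζ ⟨η, hη⟩
  exact (congrArg T e1).trans ((hT (⟨ξ, hξ⟩, ζ, ⟨η, hη⟩)).trans e2.symm)

theorem tensorId_ket1 (hβ : IsCStarModule 𝔟 β) (hγ : IsCStarModule 𝔟.dagger γ)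
    (hβ' : IsCStarModule 𝔟 β') {S : H →L[ℂ] H'} (hS : S ∈ semiMorphisms β β') {ξ : 𝔎 →L[ℂ] H}
    (hξ : ξ ∈ β) : tensorId β γ β' S ∘L ket1 β γ ξ = ket1 β' γ (S ∘L ξ) := by
  obtain ⟨T, hT⟩ := exists_tensorId hβ hγ hβ' hS
  refine ContinuousLinearMap.ext fun v => ?_
  exact extendOp_apply (f := fun p : β × K => ket1 β γ p.1 p.2)
    ⟨T, fun p => congrArg (fun f : K →L[ℂ] RTP β' γ => f p.2) (hT p.1 p.1.2)⟩ (⟨ξ, hξ⟩, v)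

theorem tensorId_ket2 (hβ : IsCStarModule 𝔟 β) (hγ : IsCStarModule 𝔟.dagger γ)
    (hβ' : IsCStarModule 𝔟 β') {S : H →L[ℂ] H'} (hS : S ∈ semiMorphisms β β') {η : 𝔎 →L[ℂ] K}
    (hη : η ∈ γ) : tensorId β γ β' S ∘L ket2 β γ η = ket2 β' γ η ∘L S :=
  hβ.ext fun ξ hξ => by
    rw [comp_assoc, ← ket1_comp hβ hγ hξ hη, ← comp_assoc, tensorId_ket1 hβ hγ hβ' hS hξ,
      ket1_comp hβ' hγ (hS ξ hξ) hη, comp_assoc]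

theorem idTensor_ket2 (hβ : IsCStarModule 𝔟 β) (hγ : IsCStarModule 𝔟.dagger γ)
    (hγ' : IsCStarModule 𝔟.dagger γ') {T : K →L[ℂ] K'} (hT : T ∈ semiMorphisms γ γ')
    {η : 𝔎 →L[ℂ] K} (hη : η ∈ γ) : idTensor β γ γ' T ∘L ket2 β γ η = ket2 β γ' (T ∘L η) := by
  -- Existence of id ⊗ T follows from that of T ⊗ id by conjugation with the flip.
  have hex : ∀ η ∈ γ, (flip γ' β ∘L tensorId γ β γ' T ∘L flip β γ) ∘L ket2 β γ η =
      ket2 β γ' (T ∘L η) := fun η hη => by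
    rw [comp_assoc, comp_assoc, flip_ket2 hβ hγ hη,
      tensorId_ket1 (𝔟 := 𝔟.dagger) hγ hβ hγ' hT hη,
      flip_ket1 (𝔟 := 𝔟.dagger) hγ' hβ (hT η hη)]
  refine ContinuousLinearMap.ext fun v => ?_
  exact extendOp_apply (f := fun p : γ × H => ket2 β γ p.1 p.2)
    ⟨flip γ' β ∘L tensorId γ β γ' T ∘L flip β γ, fun p =>
      congrArg (fun f : H →L[ℂ] RTP β γ' => f p.2) (hex p.1 p.1.2)⟩ (⟨η, hη⟩, v)

theorem idTensor_ket1 (hβ : IsCStarModule 𝔟 β) (hγ : IsCStarModule 𝔟.dagger γ)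
    (hγ' : IsCStarModule 𝔟.dagger γ') {T : K →L[ℂ] K'} (hT : T ∈ semiMorphisms γ γ')
    {ξ : 𝔎 →L[ℂ] H} (hξ : ξ ∈ β) : idTensor β γ γ' T ∘L ket1 β γ ξ = ket1 β γ' ξ ∘L T :=
  hγ.ext fun η hη => by
    rw [comp_assoc, ket1_comp hβ hγ hξ hη, ← comp_assoc, idTensor_ket2 hβ hγ hγ' hT hη,
      ← ket1_comp hβ hγ' hξ (hT η hη), comp_assoc]

/-- Tested on |ξ⟩₁, both sides are Sξη†. The adjoint of S need not be a semi-morphism, so this is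
not merely the adjoint of `tensorId_ket2`. -/
theorem bra2_tensorId (hβ : IsCStarModule 𝔟 β) (hγ : IsCStarModule 𝔟.dagger γ)
    (hβ' : IsCStarModule 𝔟 β') {S : H →L[ℂ] H'} (hS : S ∈ semiMorphisms β β') {η : 𝔎 →L[ℂ] K}
    (hη : η ∈ γ) : bra2 β' γ η ∘L tensorId β γ β' S = S ∘L bra2 β γ η :=
  ext_ket1 hβ hγ fun ξ hξ => by
    rw [comp_assoc, tensorId_ket1 hβ hγ hβ' hS hξ, bra2_comp_ket1 hβ' hγ (hS ξ hξ) hη,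
      comp_assoc S, comp_assoc S, bra2_comp_ket1 hβ hγ hξ hη]

theorem bra1_idTensor (hβ : IsCStarModule 𝔟 β) (hγ : IsCStarModule 𝔟.dagger γ)
    (hγ' : IsCStarModule 𝔟.dagger γ') {T : K →L[ℂ] K'} (hT : T ∈ semiMorphisms γ γ')
    {ξ : 𝔎 →L[ℂ] H} (hξ : ξ ∈ β) : bra1 β γ' ξ ∘L idTensor β γ γ' T = T ∘L bra1 β γ ξ :=
  ext_ket2 hβ hγ fun η hη => by
    rw [comp_assoc, idTensor_ket2 hβ hγ hγ' hT hη, bra1_comp_ket2 hβ hγ' hξ (hT η hη),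
      comp_assoc T, comp_assoc T, bra1_comp_ket2 hβ hγ hξ hη]

theorem comp_mem_semiMorphisms {S : H →L[ℂ] H'} {S' : H' →L[ℂ] H''}
    (hS : S ∈ semiMorphisms β β') (hS' : S' ∈ semiMorphisms β' β'') :
    S' ∘L S ∈ semiMorphisms β β'' := fun ξ hξ => hS' _ (hS ξ hξ)

theorem tensorId_comp (hβ : IsCStarModule 𝔟 β) (hγ : IsCStarModule 𝔟.dagger γ)
    (hβ' : IsCStarModule 𝔟 β') (hβ'' : IsCStarModule 𝔟 β'') {S : H →L[ℂ] H'}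
    {S' : H' →L[ℂ] H''} (hS : S ∈ semiMorphisms β β') (hS' : S' ∈ semiMorphisms β' β'') :
    tensorId β γ β'' (S' ∘L S) = tensorId β' γ β'' S' ∘L tensorId β γ β' S :=
  ext_ket1 hβ hγ fun ξ hξ => by
    rw [tensorId_ket1 hβ hγ hβ'' (comp_mem_semiMorphisms hS hS') hξ,
      comp_assoc (tensorId β' γ β'' S'),
      tensorId_ket1 hβ hγ hβ' hS hξ, tensorId_ket1 hβ' hγ hβ'' hS' (hS ξ hξ), comp_assoc]

theorem idTensor_comp (hβ : IsCStarModule 𝔟 β) (hγ : IsCStarModule 𝔟.dagger γ)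
    (hγ' : IsCStarModule 𝔟.dagger γ') (hγ'' : IsCStarModule 𝔟.dagger γ'') {T : K →L[ℂ] K'}
    {T' : K' →L[ℂ] K''} (hT : T ∈ semiMorphisms γ γ') (hT' : T' ∈ semiMorphisms γ' γ'') :
    idTensor β γ γ'' (T' ∘L T) = idTensor β γ' γ'' T' ∘L idTensor β γ γ' T :=
  ext_ket1 hβ hγ fun ξ hξ => by
    rw [idTensor_ket1 hβ hγ hγ'' (comp_mem_semiMorphisms hT hT') hξ, comp_assoc,
      idTensor_ket1 hβ hγ hγ' hT hξ, ← comp_assoc (idTensor β γ' γ'' T'),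
      idTensor_ket1 hβ hγ' hγ'' hT' hξ, comp_assoc]

theorem tensorId_id (hβ : IsCStarModule 𝔟 β) (hγ : IsCStarModule 𝔟.dagger γ) :
    tensorId β γ β (ContinuousLinearMap.id ℂ H) = ContinuousLinearMap.id ℂ (RTP β γ) :=
  ext_ket1 hβ hγ fun ξ hξ => by
    rw [tensorId_ket1 hβ hγ hβ (fun ξ hξ => by rwa [id_comp]) hξ, id_comp, id_comp]

theorem idTensor_id (hβ : IsCStarModule 𝔟 β) (hγ : IsCStarModule 𝔟.dagger γ) :
    idTensor β γ γ (ContinuousLinearMap.id ℂ K) = ContinuousLinearMap.id ℂ (RTP β γ) :=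
  ext_ket1 hβ hγ fun ξ hξ => by
    rw [idTensor_ket1 hβ hγ hγ (fun ξ hξ => by rwa [id_comp]) hξ, id_comp, comp_id]

theorem tensorId_comp_idTensor (hβ : IsCStarModule 𝔟 β) (hγ : IsCStarModule 𝔟.dagger γ)
    (hβ' : IsCStarModule 𝔟 β') (hγ' : IsCStarModule 𝔟.dagger γ') {S : H →L[ℂ] H'}
    {T : K →L[ℂ] K'} (hS : S ∈ semiMorphisms β β') (hT : T ∈ semiMorphisms γ γ') :
    tensorId β γ' β' S ∘L idTensor β γ γ' T = idTensor β' γ γ' T ∘L tensorId β γ β' S :=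
  ext_ket2 hβ hγ fun η hη => by
    rw [comp_assoc, idTensor_ket2 hβ hγ hγ' hT hη, tensorId_ket2 hβ hγ' hβ' hS (hT η hη),
      comp_assoc, tensorId_ket2 hβ hγ hβ' hS hη, ← comp_assoc, idTensor_ket2 hβ' hγ hγ' hT hη]

/-- The semi-morphisms as a subspace. -/
def semiMorphismSpace (γ : Submodule ℂ (𝔎 →L[ℂ] K)) (γ' : Submodule ℂ (𝔎 →L[ℂ] K')) :
    Submodule ℂ (K →L[ℂ] K') where
  carrier := semiMorphisms γ γ'
  add_mem' := fun ha hb ξ hξ => by rw [add_comp]; exact add_mem (ha ξ hξ) (hb ξ hξ)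
  zero_mem' := fun ξ _ => by rw [zero_comp]; exact zero_mem γ'
  smul_mem' := fun c a ha ξ hξ => by rw [smul_comp]; exact γ'.smul_mem c (ha ξ hξ)

theorem isClosed_semiMorphismSpace (hγ' : IsClosed (γ' : Set (𝔎 →L[ℂ] K'))) :
    IsClosed (semiMorphismSpace γ γ' : Set (K →L[ℂ] K')) := by
  have : (semiMorphismSpace γ γ' : Set (K →L[ℂ] K')) =
      ⋂ ξ ∈ γ, ((compL ℂ 𝔎 K K').flip ξ) ⁻¹' (γ' : Set (𝔎 →L[ℂ] K')) := by
    ext T; simp [semiMorphismSpace, semiMorphisms]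
  rw [this]
  exact isClosed_biInter fun ξ _ => hγ'.preimage (ContinuousLinearMap.continuous _)

theorem bddLinOn_idTensor (hβ : IsCStarModule 𝔟 β) (hγ : IsCStarModule 𝔟.dagger γ)
    (hγ' : IsCStarModule 𝔟.dagger γ') :
    BddLinOn (semiMorphismSpace γ γ') (idTensor β γ γ') := by
  refine .of_graph (isClosed_semiMorphismSpace hγ'.isClosed)
    (fun x hx y hy => ext_ket1 hβ hγ fun ξ hξ => ?_)
    (fun c x hx => ext_ket1 hβ hγ fun ξ hξ => ?_) fun u x y hu hx h1 h2 =>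
      ext_ket1 hβ hγ fun ξ hξ => ?_
  · rw [idTensor_ket1 hβ hγ hγ' (add_mem hx hy : x + y ∈ semiMorphismSpace γ γ') hξ, add_comp,
      idTensor_ket1 hβ hγ hγ' hx hξ, idTensor_ket1 hβ hγ hγ' hy hξ, comp_add]
  · rw [idTensor_ket1 hβ hγ hγ' ((semiMorphismSpace γ γ').smul_mem c hx) hξ, smul_comp,
      idTensor_ket1 hβ hγ hγ' hx hξ, comp_smul]
  · rw [idTensor_ket1 hβ hγ hγ' hx hξ]
    have e1 := (((compL ℂ K (RTP β γ) (RTP β γ')).flip (ket1 β γ ξ)).continuous.tendsto y).comp h2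
    have e2 := (((compL ℂ K K' (RTP β γ')) (ket1 β γ' ξ)).continuous.tendsto x).comp h1
    exact tendsto_nhds_unique e1 (e2.congr fun n => (idTensor_ket1 hβ hγ hγ' (hu n) hξ).symm)

/-- Links the amplification used in the definition of Δ̂ to the one with a full calculus, for those
y that preserve γ. -/
theorem idTensorComm_eq (hβ : IsCStarModule 𝔟 β) (hγ : IsCStarModule 𝔟.dagger γ)
    {y : K →L[ℂ] K} (hy : y ∈ semiMorphisms γ γ) :
    idTensorComm β γ y = idTensor β γ γ y :=
  extendOp_eq (ket1_total (k := fun v : K => v) hβ hγ cspan_range_id) fun p =>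
    congrArg (fun f : K →L[ℂ] RTP β γ => f p.2) (idTensor_ket1 hβ hγ hγ hy p.1.2)

end TensorOperators

/-! ### Associativity and leg exchange on threefold tensor products -/

section ThreeLegs

variable {𝔎 H K L : Type*}
  [NormedAddCommGroup 𝔎] [InnerProductSpace ℂ 𝔎] [CompleteSpace 𝔎]
  [NormedAddCommGroup H] [InnerProductSpace ℂ H] [CompleteSpace H]
  [NormedAddCommGroup K] [InnerProductSpace ℂ K] [CompleteSpace K]
  [NormedAddCommGroup L] [InnerProductSpace ℂ L] [CompleteSpace L]
  {𝔟 𝔠 : CStarBase 𝔎}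

theorem inner_ket2_ket2 {β : Submodule ℂ (𝔎 →L[ℂ] H)} {γ : Submodule ℂ (𝔎 →L[ℂ] K)}
    (hβ : IsCStarModule 𝔟 β) (hγ : IsCStarModule 𝔟.dagger γ) {η η' : 𝔎 →L[ℂ] K} (hη : η ∈ γ)
    (hη' : η' ∈ γ) (v w : H) :
    ⟪ket2 β γ η v, ket2 β γ η' w⟫_ℂ = ⟪v, rho β (adjoint η ∘L η') w⟫_ℂ := by
  rw [← bra2_comp_ket2 hβ hγ hη hη', ← adjoint_ket2, comp_apply, adjoint_inner_right]

theorem inner_ket1_ket1 {β : Submodule ℂ (𝔎 →L[ℂ] H)} {γ : Submodule ℂ (𝔎 →L[ℂ] K)}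
    (hβ : IsCStarModule 𝔟 β) (hγ : IsCStarModule 𝔟.dagger γ) {ξ ξ' : 𝔎 →L[ℂ] H} (hξ : ξ ∈ β)
    (hξ' : ξ' ∈ β) (v w : K) :
    ⟪ket1 β γ ξ v, ket1 β γ ξ' w⟫_ℂ = ⟪v, rho γ (adjoint ξ ∘L ξ') w⟫_ℂ := by
  rw [← bra1_comp_ket1 hβ hγ hξ hξ', ← adjoint_ket1, comp_apply, adjoint_inner_right]

section Assoc

variable {β : Submodule ℂ (𝔎 →L[ℂ] H)} {γ ε : Submodule ℂ (𝔎 →L[ℂ] K)}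
  {φ : Submodule ℂ (𝔎 →L[ℂ] L)}
  (hβ : IsCStarModule 𝔟 β) (hγ : IsCStarModule 𝔟.dagger γ) (hε : IsCStarModule 𝔠 ε)
  (hφ : IsCStarModule 𝔠.dagger φ) (hγε : Compatible 𝔟.B γ ε) (hεγ : Compatible 𝔠.Bd ε γ)

include hβ hγ hε hφ hγε hεγ

theorem assoc_total₁ : cspan (Set.range fun p : β × K × φ =>
    ket2 (rtri β γ ε) φ p.2.2 (ket1 β γ p.1 p.2.1)) = ⊤ := by
  refine cspan_eq_top (ket2_total (isCStarModule_rtri hβ hγ hε hγε) hφ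
    (ket1_total (k := fun v : K => v) hβ hγ cspan_range_id)) ?_
  rintro _ ⟨⟨l, ξ, k⟩, rfl⟩
  exact mem_cspan ⟨(ξ, k, l), rfl⟩

theorem assoc_total₂ : cspan (Set.range fun p : β × K × φ =>
    ket1 β (ltri ε φ γ) p.1 (ket2 ε φ p.2.2 p.2.1)) = ⊤ := by
  refine cspan_eq_top (ket1_total hβ (isCStarModule_ltri hε hφ hγ hεγ)
    (ket2_total (k := fun v : K => v) hε hφ cspan_range_id)) ?_
  rintro _ ⟨⟨ξ, l, k⟩, rfl⟩
  exact mem_cspan ⟨(ξ, k, l), rfl⟩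

/-- The two bracketings apply ρ_γ(ξ†ξ') and ρ_ε(l†l') to the middle leg in opposite orders, and
these commute by compatibility. `assoc` and `assocInv` therefore exist as isometric extensions. -/
theorem assoc_inner (p q : β × K × φ) :
    ⟪ket1 β (ltri ε φ γ) p.1 (ket2 ε φ p.2.2 p.2.1),
      ket1 β (ltri ε φ γ) q.1 (ket2 ε φ q.2.2 q.2.1)⟫_ℂ =
    ⟪ket2 (rtri β γ ε) φ p.2.2 (ket1 β γ p.1 p.2.1),
      ket2 (rtri β γ ε) φ q.2.2 (ket1 β γ q.1 q.2.1)⟫_ℂ := by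
  obtain ⟨ξ, k, l⟩ := p
  obtain ⟨ξ', k', l'⟩ := q
  have hl : adjoint (l : 𝔎 →L[ℂ] L) ∘L (l' : 𝔎 →L[ℂ] L) ∈ 𝔠.Bd := hφ.inner_mem l.2 l'.2
  have hx : adjoint (ξ : 𝔎 →L[ℂ] H) ∘L (ξ' : 𝔎 →L[ℂ] H) ∈ 𝔟.B := hβ.inner_mem ξ.2 ξ'.2
  rw [inner_ket1_ket1 hβ (isCStarModule_ltri hε hφ hγ hεγ) ξ.2 ξ'.2,
    inner_ket2_ket2 (isCStarModule_rtri hβ hγ hε hγε) hφ l.2 l'.2]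
  have e1 := congrArg (fun f : K →L[ℂ] RTP ε φ => f k')
    (rho_ltri_comp_ket2 hε hφ hγ hεγ l'.2 (c := adjoint (ξ : 𝔎 →L[ℂ] H) ∘L ξ') hx)
  have e2 := congrArg (fun f : K →L[ℂ] RTP β γ => f k')
    (rho_rtri_comp_ket1 hβ hγ hε hγε ξ'.2 (c := adjoint (l : 𝔎 →L[ℂ] L) ∘L l') hl)
  simp only [comp_apply] at e1 e2
  rw [e1, e2, inner_ket1_ket1 hβ hγ ξ.2 ξ'.2, inner_ket2_ket2 hε hφ l.2 l'.2]
  exact congrArg (fun f : K →L[ℂ] K => ⟪k, f k'⟫_ℂ) (rho_commute hγ hεγ hl hx)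

theorem assoc_ket2_ket1 {ξ : 𝔎 →L[ℂ] H} {l : 𝔎 →L[ℂ] L} (hξ : ξ ∈ β) (hl : l ∈ φ) :
    assoc β γ ε φ ∘L ket2 (rtri β γ ε) φ l ∘L ket1 β γ ξ =
      ket1 β (ltri ε φ γ) ξ ∘L ket2 ε φ l :=
  ContinuousLinearMap.ext fun k => extendOp_apply
    (f := fun p : β × K × φ => ket2 (rtri β γ ε) φ p.2.2 (ket1 β γ p.1 p.2.1))
    (g := fun p => ket1 β (ltri ε φ γ) p.1 (ket2 ε φ p.2.2 p.2.1))
    (exists_isometric_extension (assoc_total₁ hβ hγ hε hφ hγε hεγ)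
      (assoc_inner hβ hγ hε hφ hγε hεγ)) (⟨ξ, hξ⟩, k, ⟨l, hl⟩)

theorem assocInv_ket1_ket2 {ξ : 𝔎 →L[ℂ] H} {l : 𝔎 →L[ℂ] L} (hξ : ξ ∈ β) (hl : l ∈ φ) :
    assocInv β γ ε φ ∘L ket1 β (ltri ε φ γ) ξ ∘L ket2 ε φ l =
      ket2 (rtri β γ ε) φ l ∘L ket1 β γ ξ :=
  ContinuousLinearMap.ext fun k => extendOp_apply
    (f := fun p : β × K × φ => ket1 β (ltri ε φ γ) p.1 (ket2 ε φ p.2.2 p.2.1))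
    (g := fun p => ket2 (rtri β γ ε) φ p.2.2 (ket1 β γ p.1 p.2.1))
    (exists_isometric_extension (assoc_total₂ hβ hγ hε hφ hγε hεγ)
      fun p q => (assoc_inner hβ hγ hε hφ hγε hεγ p q).symm) (⟨ξ, hξ⟩, k, ⟨l, hl⟩)

theorem assocInv_comp_assoc :
    assocInv β γ ε φ ∘L assoc β γ ε φ = ContinuousLinearMap.id ℂ _ :=
  ext_ket2 (isCStarModule_rtri hβ hγ hε hγε) hφ fun l hl => ext_ket1 hβ hγ fun ξ hξ => by
    rw [comp_assoc, comp_assoc, comp_assoc, assoc_ket2_ket1 hβ hγ hε hφ hγε hεγ hξ hl,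
      assocInv_ket1_ket2 hβ hγ hε hφ hγε hεγ hξ hl, id_comp]

theorem assoc_comp_assocInv :
    assoc β γ ε φ ∘L assocInv β γ ε φ = ContinuousLinearMap.id ℂ _ :=
  ext_ket1 hβ (isCStarModule_ltri hε hφ hγ hεγ) fun ξ hξ => ext_ket2 hε hφ fun l hl => by
    rw [comp_assoc, comp_assoc, comp_assoc, assocInv_ket1_ket2 hβ hγ hε hφ hγε hεγ hξ hl,
      assoc_ket2_ket1 hβ hγ hε hφ hγε hεγ hξ hl, id_comp]

/-- A ket in the third leg is id ⊗ |l⟩₂ after rebracketing. This turns the pentagon equation into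
statements on twofold tensor products. -/
theorem assoc_ket2 {l : 𝔎 →L[ℂ] L} (hl : l ∈ φ) :
    assoc β γ ε φ ∘L ket2 (rtri β γ ε) φ l = idTensor β γ (ltri ε φ γ) (ket2 ε φ l) :=
  ext_ket1 hβ hγ fun ξ hξ => by
    rw [comp_assoc, assoc_ket2_ket1 hβ hγ hε hφ hγε hεγ hξ hl,
      idTensor_ket1 hβ hγ (isCStarModule_ltri hε hφ hγ hεγ) (fun _ h => mem_ltri hl h) hξ]

theorem idTensor_bra2_comp_assoc {l : 𝔎 →L[ℂ] L} (hl : l ∈ φ)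
    (hbra : bra2 ε φ l ∈ semiMorphisms (ltri ε φ γ) γ) :
    idTensor β (ltri ε φ γ) γ (bra2 ε φ l) ∘L assoc β γ ε φ = bra2 (rtri β γ ε) φ l := by
  have hR := isCStarModule_rtri hβ hγ hε hγε
  refine ext_ket2 hR hφ fun l' hl' => ext_ket1 hβ hγ fun ξ hξ => ?_
  rw [comp_assoc, comp_assoc, comp_assoc, assoc_ket2_ket1 hβ hγ hε hφ hγε hεγ hξ hl',
    ← comp_assoc, idTensor_ket1 hβ (isCStarModule_ltri hε hφ hγ hεγ) hγ hbra hξ, comp_assoc,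
    bra2_comp_ket2 hε hφ hl hl', ← comp_assoc (bra2 _ _ _), bra2_comp_ket2 hR hφ hl hl',
    rho_rtri_comp_ket1 hβ hγ hε hγε hξ (hφ.inner_mem hl hl')]

end Assoc

section Swap

variable {p q : Submodule ℂ (𝔎 →L[ℂ] K)} {x : Submodule ℂ (𝔎 →L[ℂ] H)}
  {y : Submodule ℂ (𝔎 →L[ℂ] L)}
  (hp : IsCStarModule 𝔟 p) (hx : IsCStarModule 𝔟.dagger x) (hq : IsCStarModule 𝔠 q)
  (hy : IsCStarModule 𝔠.dagger y) (hpq : Compatible 𝔟.Bd p q) (hqp : Compatible 𝔠.Bd q p)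

include hp hx hq hy hpq hqp

theorem swap23_ket2_ket2 {s : 𝔎 →L[ℂ] H} {t : 𝔎 →L[ℂ] L} (hs : s ∈ x) (ht : t ∈ y) :
    swap23 p x q y ∘L ket2 (ltri p x q) y t ∘L ket2 p x s =
      ket2 (ltri q y p) x s ∘L ket2 q y t := by
  have hPQ := isCStarModule_ltri hp hx hq hpq
  have hQP := isCStarModule_ltri hq hy hp hqp
  refine ContinuousLinearMap.ext fun k => extendOp_apply
    (f := fun t : x × y × K => ket2 (ltri p x q) y t.2.1 (ket2 p x t.1 t.2.2))
    (g := fun t => ket2 (ltri q y p) x t.1 (ket2 q y t.2.1 t.2.2))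
    (exists_isometric_extension ?_ ?_) (⟨s, hs⟩, ⟨t, ht⟩, k)
  · refine cspan_eq_top (ket2_total hPQ hy
      (ket2_total (k := fun v : K => v) hp hx cspan_range_id)) ?_
    rintro _ ⟨⟨l, ξ, k⟩, rfl⟩
    exact mem_cspan ⟨(ξ, l, k), rfl⟩
  · rintro ⟨ξ, l, k⟩ ⟨ξ', l', k'⟩
    have hl : adjoint (l : 𝔎 →L[ℂ] L) ∘L (l' : 𝔎 →L[ℂ] L) ∈ 𝔠.Bd := hy.inner_mem l.2 l'.2
    have hξ : adjoint (ξ : 𝔎 →L[ℂ] H) ∘L (ξ' : 𝔎 →L[ℂ] H) ∈ 𝔟.Bd := hx.inner_mem ξ.2 ξ'.2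
    rw [inner_ket2_ket2 hQP hx ξ.2 ξ'.2, inner_ket2_ket2 hPQ hy l.2 l'.2]
    have e1 := congrArg (fun f : K →L[ℂ] RTP q y => f k')
      (rho_ltri_comp_ket2 hq hy hp hqp l'.2 (c := adjoint (ξ : 𝔎 →L[ℂ] H) ∘L ξ') hξ)
    have e2 := congrArg (fun f : K →L[ℂ] RTP p x => f k')
      (rho_ltri_comp_ket2 hp hx hq hpq ξ'.2 (c := adjoint (l : 𝔎 →L[ℂ] L) ∘L l') hl)
    simp only [comp_apply] at e1 e2
    rw [e1, e2, inner_ket2_ket2 hp hx ξ.2 ξ'.2, inner_ket2_ket2 hq hy l.2 l'.2]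
    exact congrArg (fun f : K →L[ℂ] K => ⟪k, f k'⟫_ℂ) (rho_commute hp hqp hl hξ)

theorem swap23_ket2 {t : 𝔎 →L[ℂ] L} (ht : t ∈ y) :
    swap23 p x q y ∘L ket2 (ltri p x q) y t = tensorId p x (ltri q y p) (ket2 q y t) :=
  ext_ket2 hp hx fun s hs => by
    rw [comp_assoc, swap23_ket2_ket2 hp hx hq hy hpq hqp hs ht,
      tensorId_ket2 hp hx (isCStarModule_ltri hq hy hp hqp) (fun _ h => mem_ltri ht h) hs]

end Swap

end ThreeLegs

/-! ### Bras and flips as semi-morphisms -/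

section Slices

variable {𝔎 H K : Type*} [NormedAddCommGroup 𝔎] [InnerProductSpace ℂ 𝔎] [CompleteSpace 𝔎]
  [NormedAddCommGroup H] [InnerProductSpace ℂ H] [CompleteSpace H]
  [NormedAddCommGroup K] [InnerProductSpace ℂ K] [CompleteSpace K]
  {𝔟 : CStarBase 𝔎} {β : Submodule ℂ (𝔎 →L[ℂ] H)} {γ : Submodule ℂ (𝔎 →L[ℂ] K)}

theorem bra2_mem_semiMorphisms (hβ : IsCStarModule 𝔟 β) (hγ : IsCStarModule 𝔟.dagger γ)
    {δ : Submodule ℂ (𝔎 →L[ℂ] H)} (hδ : IsClosed (δ : Set (𝔎 →L[ℂ] H)))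
    (hc : Compatible 𝔟.Bd β δ) {η : 𝔎 →L[ℂ] K} (hη : η ∈ γ) :
    bra2 β γ η ∈ semiMorphisms (ltri β γ δ) δ := fun X hX => by
  refine comp_mem_of_cspan_right _ hδ ?_ hX
  rintro _ ⟨η', hη', ξ, hξ, rfl⟩
  rw [← comp_assoc, bra2_comp_ket2 hβ hγ hη hη']
  exact hc.rho_comp_mem (hγ.inner_mem hη hη') hξ

theorem bra1_mem_semiMorphisms (hβ : IsCStarModule 𝔟 β) (hγ : IsCStarModule 𝔟.dagger γ)
    {δ : Submodule ℂ (𝔎 →L[ℂ] K)} (hδ : IsClosed (δ : Set (𝔎 →L[ℂ] K)))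
    (hc : Compatible 𝔟.B γ δ) {ξ : 𝔎 →L[ℂ] H} (hξ : ξ ∈ β) :
    bra1 β γ ξ ∈ semiMorphisms (rtri β γ δ) δ := fun X hX => by
  refine comp_mem_of_cspan_right _ hδ ?_ hX
  rintro _ ⟨ξ', hξ', η, hη, rfl⟩
  rw [← comp_assoc, bra1_comp_ket1 hβ hγ hξ hξ']
  exact hc.rho_comp_mem (hβ.inner_mem hξ hξ') hη

theorem flip_mem_semiMorphisms (hβ : IsCStarModule 𝔟 β) (hγ : IsCStarModule 𝔟.dagger γ)
    {δ : Submodule ℂ (𝔎 →L[ℂ] K)} : flip β γ ∈ semiMorphisms (rtri β γ δ) (ltri γ β δ) :=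
  fun X hX => by
  refine comp_mem_of_cspan_right _ (isClosed_cspan _) ?_ hX
  rintro _ ⟨ξ, hξ, η, hη, rfl⟩
  rw [← comp_assoc, flip_ket1 hβ hγ hξ]
  exact mem_ltri hξ hη

theorem flip_mem_semiMorphisms' (hβ : IsCStarModule 𝔟 β) (hγ : IsCStarModule 𝔟.dagger γ)
    {δ : Submodule ℂ (𝔎 →L[ℂ] H)} : flip β γ ∈ semiMorphisms (ltri β γ δ) (rtri γ β δ) :=
  fun X hX => by
  refine comp_mem_of_cspan_right _ (isClosed_cspan _) ?_ hX
  rintro _ ⟨η, hη, ξ, hξ, rfl⟩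
  rw [← comp_assoc, flip_ket2 hβ hγ hη]
  exact mem_rtri hη hξ

end Slices

/-! ### Slices of V, the operator V₁₃ and the sliced pentagon equation -/

section Unitary

variable {𝔎 H : Type*} [NormedAddCommGroup 𝔎] [InnerProductSpace ℂ 𝔎] [CompleteSpace 𝔎]
  [NormedAddCommGroup H] [InnerProductSpace ℂ H] [CompleteSpace H]
  {𝔟 : CStarBase 𝔎} {hβ α β : Submodule ℂ (𝔎 →L[ℂ] H)} {V : RTP hβ α ≃ₗᵢ[ℂ] RTP α β}

theorem adjoint_opOf_comp : adjoint (opOf V) ∘L opOf V = ContinuousLinearMap.id ℂ _ :=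
  ContinuousLinearMap.ext fun v => ext_inner_left ℂ fun u => by
    rw [comp_apply, adjoint_inner_right]
    exact V.inner_map_map u v

theorem opOf_comp_adjoint : opOf V ∘L adjoint (opOf V) = ContinuousLinearMap.id ℂ _ :=
  ContinuousLinearMap.ext fun v => by
    obtain ⟨u, rfl⟩ := V.surjective v
    change opOf V ((adjoint (opOf V) ∘L opOf V) u) = V u
    rw [adjoint_opOf_comp]; rfl

theorem opOf_mem_semiMorphisms {γ : Submodule ℂ (𝔎 →L[ℂ] RTP hβ α)}
    {δ : Submodule ℂ (𝔎 →L[ℂ] RTP α β)}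
    (h : (opOf V ∘L ·) '' (γ : Set (𝔎 →L[ℂ] RTP hβ α)) = δ) :
    opOf V ∈ semiMorphisms γ δ := fun X hX => by
  have : opOf V ∘L X ∈ (δ : Set (𝔎 →L[ℂ] RTP α β)) := h ▸ ⟨X, hX, rfl⟩
  exact this

theorem adjoint_opOf_mem_semiMorphisms {γ : Submodule ℂ (𝔎 →L[ℂ] RTP hβ α)}
    {δ : Submodule ℂ (𝔎 →L[ℂ] RTP α β)}
    (h : (opOf V ∘L ·) '' (γ : Set (𝔎 →L[ℂ] RTP hβ α)) = δ) :
    adjoint (opOf V) ∈ semiMorphisms δ γ := fun X hX => by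
  have hX' : X ∈ (δ : Set (𝔎 →L[ℂ] RTP α β)) := hX
  rw [← h] at hX'
  obtain ⟨Y, hY, rfl⟩ := hX'
  change adjoint (opOf V) ∘L opOf V ∘L Y ∈ γ
  rw [← comp_assoc, adjoint_opOf_comp, id_comp]
  exact hY

/-- `⟨η|₂ V |ξ⟩₂`. -/
def slice (V : RTP hβ α ≃ₗᵢ[ℂ] RTP α β) (η ξ : 𝔎 →L[ℂ] H) : H →L[ℂ] H :=
  bra2 α β η ∘L opOf V ∘L ket2 hβ α ξ

theorem slice_mem {η ξ : 𝔎 →L[ℂ] H} (hη : η ∈ β) (hξ : ξ ∈ α) : slice V η ξ ∈ dualLeg V :=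
  mem_cspan ⟨η, hη, ξ, hξ, rfl⟩

/-- The rearrangement `H ⊗ (H α⊗β H) ≅ (H hβ⊗α H) ⊗ H` exchanging the last two legs. -/
def rearrange (hβ α β : Submodule ℂ (𝔎 →L[ℂ] H)) :
    RTP hβ (rtri α β α) →L[ℂ] RTP (rtri hβ α β) α :=
  assocInv hβ α β α ∘L idTensor hβ (rtri α β α) (ltri β α α) (flip α β)

/-- `V₁₃`, up to rearranging legs. -/
def leg13 (V : RTP hβ α ≃ₗᵢ[ℂ] RTP α β) :
    RTP hβ (rtri α β α) →L[ℂ] RTP (ltri hβ α α) β :=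
  swap23 α β hβ α ∘L tensorId (rtri hβ α β) α (ltri α β hβ) (opOf V) ∘L rearrange hβ α β

variable (hV : IsPseudoMultiplicativeUnitary 𝔟 hβ α β V)

include hV

namespace IsPseudoMultiplicativeUnitary

theorem opOf₁ : opOf V ∈ semiMorphisms (ltri hβ α α) (rtri α β α) :=
  opOf_mem_semiMorphisms hV.map_α_α

theorem opOf₂ : opOf V ∈ semiMorphisms (rtri hβ α β) (ltri α β hβ) :=
  opOf_mem_semiMorphisms hV.map_hβ_β

theorem opOf₃ : opOf V ∈ semiMorphisms (rtri hβ α hβ) (rtri α β hβ) :=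
  opOf_mem_semiMorphisms hV.map_hβ_hβ

theorem opOf₄ : opOf V ∈ semiMorphisms (ltri hβ α β) (ltri α β β) :=
  opOf_mem_semiMorphisms hV.map_β_α

theorem rtri_α_β_α : IsCStarModule 𝔟 (rtri α β α) :=
  isCStarModule_rtri hV.module.module_α hV.module.module_β hV.module.module_α
    hV.module.compatible_β_α

theorem rtri_α_β_hβ : IsCStarModule 𝔟.dagger (rtri α β hβ) :=
  isCStarModule_rtri hV.module.module_α hV.module.module_β hV.module.module_hβ
    hV.module.compatible_β_hβ

theorem ltri_α_β_hβ : IsCStarModule 𝔟.dagger (ltri α β hβ) :=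
  isCStarModule_ltri hV.module.module_α hV.module.module_β hV.module.module_hβ
    hV.module.compatible_α_hβ

theorem ltri_α_β_β : IsCStarModule 𝔟.dagger (ltri α β β) :=
  isCStarModule_ltri hV.module.module_α hV.module.module_β hV.module.module_β
    hV.module.compatible_α_β

theorem ltri_β_α_α : IsCStarModule 𝔟 (ltri β α α) :=
  isCStarModule_ltri (𝔟 := 𝔟.dagger) hV.module.module_β hV.module.module_α hV.module.module_α
    hV.module.compatible_β_α

theorem ltri_hβ_α_α : IsCStarModule 𝔟 (ltri hβ α α) :=
  isCStarModule_ltri (𝔟 := 𝔟.dagger) hV.module.module_hβ hV.module.module_α hV.module.module_α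
    hV.module.compatible_hβ_α

theorem ltri_hβ_α_β : IsCStarModule 𝔟.dagger (ltri hβ α β) :=
  isCStarModule_ltri (𝔟 := 𝔟.dagger) hV.module.module_hβ hV.module.module_α hV.module.module_β
    hV.module.compatible_hβ_β

theorem rtri_hβ_α_hβ : IsCStarModule 𝔟.dagger (rtri hβ α hβ) :=
  isCStarModule_rtri (𝔟 := 𝔟.dagger) hV.module.module_hβ hV.module.module_α hV.module.module_hβ
    hV.module.compatible_α_hβ

theorem rtri_hβ_α_β : IsCStarModule 𝔟.dagger (rtri hβ α β) :=
  isCStarModule_rtri (𝔟 := 𝔟.dagger) hV.module.module_hβ hV.module.module_α hV.module.module_β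
    hV.module.compatible_α_β

theorem slice_mem_semiMorphisms {η ξ : 𝔎 →L[ℂ] H} (hη : η ∈ β) (hξ : ξ ∈ α) :
    slice V η ξ ∈ semiMorphisms β β := fun X hX => by
  rw [slice, comp_assoc, comp_assoc]
  exact bra2_mem_semiMorphisms hV.module.module_α hV.module.module_β
    hV.module.module_β.isClosed hV.module.compatible_α_β hη _ (hV.opOf₄ _ (mem_ltri hξ hX))

/-- Comes from V(β ◁ α) = β ◁ β. Because of it, id ⊗ a exists and depends linearly on a ∈ Â. -/
theorem dualLeg_le : dualLeg V ≤ semiMorphismSpace β β := by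
  refine cspan_le (isClosed_semiMorphismSpace hV.module.module_β.isClosed) ?_
  rintro _ ⟨η, hη, ξ, hξ, rfl⟩
  exact hV.slice_mem_semiMorphisms hη hξ

/-- Comes from V(hβ ▷ β) = hβ ◁ β. It is what converts ρ_β into ρ_hβ when a slice of V₁₃ is compared
with a slice of V. -/
theorem slice₁_mem_semiMorphisms {η ξ : 𝔎 →L[ℂ] H} (hη : η ∈ β) (hξ : ξ ∈ hβ) :
    bra2 α β η ∘L opOf V ∘L ket1 hβ α ξ ∈ semiMorphisms β hβ := fun X hX => by
  rw [comp_assoc, comp_assoc]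
  exact bra2_mem_semiMorphisms hV.module.module_α hV.module.module_β
    hV.module.module_hβ.isClosed hV.module.compatible_α_hβ hη _ (hV.opOf₂ _ (mem_rtri hξ hX))

/-- `[Â_V β] = β`. -/
theorem le_cspan_slice_comp :
    β ≤ cspan {T | ∃ η ∈ β, ∃ ξ ∈ α, ∃ η' ∈ β, slice V η ξ ∘L η' = T} := by
  conv_lhs => rw [← show cspan _ = β from hV.module.compatible_α_β]
  refine cspan_le (isClosed_cspan _) ?_
  rintro _ ⟨c, hc, η', hη', rfl⟩
  replace hc : c ∈ 𝔟.dagger.subB := hc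
  rw [← hV.module.module_β.cspan_inner] at hc
  refine ((bddLinOn_rho hV.module.module_α).comp_right η').mem_of_cspan 𝔟.isClosed_Bd ?_
    (isClosed_cspan _) ?_ hc
  · rintro _ ⟨η, hη, η', hη', rfl⟩; exact hV.module.module_β.inner_mem hη hη'
  · rintro _ ⟨η, hη, η'', hη'', rfl⟩
    rw [← bra2_comp_ket2 hV.module.module_α hV.module.module_β hη hη'', comp_assoc]
    -- By now β has been written as [ρ_α(𝔅†)β] and ρ_α(η†η'') as ⟨η|₂|η''⟩₂. Inserting VV† puts
    -- V†|η''⟩₂η' into β ◁ α, where it is approximated by sums of |ξ⟩₂ζ.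
    have h := adjoint_opOf_mem_semiMorphisms hV.map_β_α _ (mem_ltri hη'' hη')
    have e : bra2 α β η ∘L ket2 α β η'' ∘L η' =
        (bra2 α β η ∘L opOf V) ∘L (adjoint (opOf V) ∘L ket2 α β η'' ∘L η') := by
      rw [comp_assoc, ← comp_assoc (opOf V), opOf_comp_adjoint, id_comp]
    rw [e]
    refine comp_mem_of_cspan_right _ (isClosed_cspan _) ?_ h
    rintro _ ⟨ξ, hξ, ζ, hζ, rfl⟩
    exact mem_cspan ⟨η, hη, ξ, hξ, ζ, hζ, by rw [slice]; simp only [assoc_comp]⟩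

theorem flip_comp_mem : flip α β ∈ semiMorphisms (rtri α β α) (ltri β α α) :=
  flip_mem_semiMorphisms hV.module.module_α hV.module.module_β

theorem rearrange_ket1_ket1 {ξ y : 𝔎 →L[ℂ] H} (hξ : ξ ∈ hβ) (hy : y ∈ α) :
    rearrange hβ α β ∘L ket1 hβ (rtri α β α) ξ ∘L ket1 α β y =
      ket2 (rtri hβ α β) α y ∘L ket1 hβ α ξ := by
  have m := hV.module
  have e1 : idTensor hβ (rtri α β α) (ltri β α α) (flip α β) ∘L ket1 hβ (rtri α β α) ξ =
      ket1 hβ (ltri β α α) ξ ∘L flip α β :=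
    idTensor_ket1 (𝔟 := 𝔟.dagger) m.module_hβ hV.rtri_α_β_α hV.ltri_β_α_α hV.flip_comp_mem hξ
  have e2 : flip α β ∘L ket1 α β y = ket2 β α y := flip_ket1 m.module_α m.module_β hy
  have e3 : assocInv hβ α β α ∘L ket1 hβ (ltri β α α) ξ ∘L ket2 β α y =
      ket2 (rtri hβ α β) α y ∘L ket1 hβ α ξ :=
    assocInv_ket1_ket2 (𝔟 := 𝔟.dagger) (𝔠 := 𝔟.dagger) m.module_hβ m.module_α m.module_β
      m.module_α m.compatible_α_β m.compatible_β_α hξ hy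
  rw [rearrange]
  simp only [assoc_comp]
  rw [← comp_assoc _ (ket1 hβ (rtri α β α) ξ), e1, comp_assoc, e2, e3]

/-- V₁₃ ignores the second leg: with y inserted there, it is V followed by the insertion of y. -/
theorem swap23_tensorId_ket2 {y : 𝔎 →L[ℂ] H} (hy : y ∈ α) :
    swap23 α β hβ α ∘L tensorId (rtri hβ α β) α (ltri α β hβ) (opOf V) ∘L
      ket2 (rtri hβ α β) α y = tensorId α β (ltri hβ α α) (ket2 hβ α y) ∘L opOf V := by
  have m := hV.module
  have e4 : tensorId (rtri hβ α β) α (ltri α β hβ) (opOf V) ∘L ket2 (rtri hβ α β) α y =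
      ket2 (ltri α β hβ) α y ∘L opOf V :=
    tensorId_ket2 (𝔟 := 𝔟.dagger) hV.rtri_hβ_α_β m.module_α hV.ltri_α_β_hβ hV.opOf₂ hy
  have e5 : swap23 α β hβ α ∘L ket2 (ltri α β hβ) α y =
      tensorId α β (ltri hβ α α) (ket2 hβ α y) :=
    swap23_ket2 (𝔟 := 𝔟) (𝔠 := 𝔟.dagger) m.module_α m.module_β m.module_hβ m.module_α
      m.compatible_α_hβ m.compatible_hβ_α hy
  rw [e4, ← comp_assoc, e5]

theorem leg13_ket1_ket1 {ξ y : 𝔎 →L[ℂ] H} (hξ : ξ ∈ hβ) (hy : y ∈ α) :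
    leg13 V ∘L ket1 hβ (rtri α β α) ξ ∘L ket1 α β y =
      tensorId α β (ltri hβ α α) (ket2 hβ α y) ∘L opOf V ∘L ket1 hβ α ξ := by
  have e := congrArg (fun f => f ∘L ket1 hβ α ξ) (hV.swap23_tensorId_ket2 hy)
  simp only [assoc_comp] at e
  rw [leg13]
  simp only [assoc_comp]
  rw [hV.rearrange_ket1_ket1 hξ hy, e]

theorem pentagon_left_ket2 {q : 𝔎 →L[ℂ] H} (hq : q ∈ α) :
    (idTensor α (ltri hβ α β) (ltri α β β) (opOf V) ∘L assoc α β hβ α ∘L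
      tensorId (rtri hβ α hβ) α (rtri α β hβ) (opOf V)) ∘L ket2 (rtri hβ α hβ) α q =
    idTensor α β (ltri α β β) (opOf V ∘L ket2 hβ α q) ∘L opOf V := by
  have m := hV.module
  have e1 : tensorId (rtri hβ α hβ) α (rtri α β hβ) (opOf V) ∘L ket2 (rtri hβ α hβ) α q =
      ket2 (rtri α β hβ) α q ∘L opOf V :=
    tensorId_ket2 (𝔟 := 𝔟.dagger) hV.rtri_hβ_α_hβ m.module_α hV.rtri_α_β_hβ hV.opOf₃ hq
  have e2 : assoc α β hβ α ∘L ket2 (rtri α β hβ) α q =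
      idTensor α β (ltri hβ α β) (ket2 hβ α q) :=
    assoc_ket2 (𝔟 := 𝔟) (𝔠 := 𝔟.dagger) m.module_α m.module_β m.module_hβ m.module_α
      m.compatible_β_hβ m.compatible_hβ_β hq
  rw [idTensor_comp m.module_α m.module_β hV.ltri_hβ_α_β hV.ltri_α_β_β
    (fun _ h => mem_ltri hq h) hV.opOf₄, comp_assoc, comp_assoc, e1, ← comp_assoc (assoc _ _ _ _),
    e2, comp_assoc]

/-- `Δ̂(⟨s|₂ V |q⟩₂) = ⟨s|₃ V₁₃ V₂₃ |q⟩₃`. -/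
theorem pentagon_slice {s q : 𝔎 →L[ℂ] H} (hs : s ∈ β) (hq : q ∈ α) :
    adjoint (opOf V) ∘L idTensor α β β (slice V s q) ∘L opOf V =
      bra2 (ltri hβ α α) β s ∘L leg13 V ∘L
        idTensor hβ α (rtri α β α) (opOf V ∘L ket2 hβ α q) := by
  have m := hV.module
  have hp := congrArg (fun f => f ∘L ket2 (rtri hβ α hβ) α q) hV.pentagon
  beta_reduce at hp
  rw [hV.pentagon_left_ket2 hq] at hp
  have e0 : assoc hβ α hβ α ∘L ket2 (rtri hβ α hβ) α q =
      idTensor hβ α (ltri hβ α α) (ket2 hβ α q) :=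
    assoc_ket2 (𝔟 := 𝔟.dagger) (𝔠 := 𝔟.dagger) m.module_hβ m.module_α m.module_hβ m.module_α
      m.compatible_α_hβ m.compatible_hβ_α hq
  have e1 : idTensor hβ α (rtri α β α) (opOf V ∘L ket2 hβ α q) =
      idTensor hβ (ltri hβ α α) (rtri α β α) (opOf V) ∘L
        idTensor hβ α (ltri hβ α α) (ket2 hβ α q) :=
    idTensor_comp (𝔟 := 𝔟.dagger) m.module_hβ m.module_α hV.ltri_hβ_α_α hV.rtri_α_β_α
      (fun _ h => mem_ltri hq h) hV.opOf₁
  have hp' : assoc α β α β ∘L tensorId (ltri hβ α α) β (rtri α β α) (opOf V) ∘L leg13 V ∘L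
      idTensor hβ α (rtri α β α) (opOf V ∘L ket2 hβ α q) =
      idTensor α β (ltri α β β) (opOf V ∘L ket2 hβ α q) ∘L opOf V := by
    rw [← hp, e1, ← e0, leg13, rearrange]
    simp only [assoc_comp]
  have e2 : assoc α β α β ∘L ket2 (rtri α β α) β s = idTensor α β (ltri α β β) (ket2 α β s) :=
    assoc_ket2 (𝔟 := 𝔟) (𝔠 := 𝔟) m.module_α m.module_β m.module_α m.module_β
      m.compatible_β_α m.compatible_α_β hs
  have e3 : bra2 (rtri α β α) β s ∘L tensorId (ltri hβ α α) β (rtri α β α) (opOf V) =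
      opOf V ∘L bra2 (ltri hβ α α) β s :=
    bra2_tensorId hV.ltri_hβ_α_α m.module_β hV.rtri_α_β_α hV.opOf₁ hs
  have hb : bra2 α β s ∈ semiMorphisms (ltri α β β) β :=
    bra2_mem_semiMorphisms m.module_α m.module_β m.module_β.isClosed m.compatible_α_β hs
  have e4 : idTensor α (ltri α β β) β (bra2 α β s) ∘L assoc α β α β =
      bra2 (rtri α β α) β s :=
    idTensor_bra2_comp_assoc (𝔟 := 𝔟) (𝔠 := 𝔟) m.module_α m.module_β m.module_α m.module_β
      m.compatible_β_α m.compatible_α_β hs hb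
  have e5 : idTensor α β β (slice V s q) = idTensor α (ltri α β β) β (bra2 α β s) ∘L
      idTensor α β (ltri α β β) (opOf V ∘L ket2 hβ α q) :=
    idTensor_comp m.module_α m.module_β hV.ltri_α_β_β m.module_β
      (fun X hX => hV.opOf₄ _ (mem_ltri hq hX)) hb
  rw [e5, comp_assoc, ← hp', ← comp_assoc (idTensor _ _ _ _) (assoc _ _ _ _), e4,
    ← comp_assoc (bra2 _ _ _), e3, comp_assoc, ← comp_assoc, adjoint_opOf_comp, id_comp]

end IsPseudoMultiplicativeUnitary

end Unitary

/-! ### Adjoints of amplifications and of ρ -/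

section Adjoints

variable {𝔎 H K K' : Type*} [NormedAddCommGroup 𝔎] [InnerProductSpace ℂ 𝔎] [CompleteSpace 𝔎]
  [NormedAddCommGroup H] [InnerProductSpace ℂ H] [CompleteSpace H]
  [NormedAddCommGroup K] [InnerProductSpace ℂ K] [CompleteSpace K]
  [NormedAddCommGroup K'] [InnerProductSpace ℂ K'] [CompleteSpace K']
  {𝔟 : CStarBase 𝔎} {β : Submodule ℂ (𝔎 →L[ℂ] H)} {γ : Submodule ℂ (𝔎 →L[ℂ] K)}
  {γ' : Submodule ℂ (𝔎 →L[ℂ] K')}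

theorem adjoint_idTensor (hβ : IsCStarModule 𝔟 β) (hγ : IsCStarModule 𝔟.dagger γ)
    (hγ' : IsCStarModule 𝔟.dagger γ') {T : K →L[ℂ] K'} (hT : T ∈ semiMorphisms γ γ')
    (hT' : adjoint T ∈ semiMorphisms γ' γ) :
    adjoint (idTensor β γ γ' T) = idTensor β γ' γ (adjoint T) :=
  ext_ket1 hβ hγ' fun ξ hξ => by
    have := congrArg adjoint (bra1_idTensor hβ hγ hγ' hT hξ)
    rw [adjoint_comp, adjoint_comp, bra1, bra1] at this
    rw [idTensor_ket1 hβ hγ' hγ hT' hξ]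
    exact this

theorem rho_comp_bra2 (hβ : IsCStarModule 𝔟 β) (hγ : IsCStarModule 𝔟.dagger γ)
    {η : 𝔎 →L[ℂ] K} (hη : η ∈ γ) {c : 𝔎 →L[ℂ] 𝔎} (hc : c ∈ 𝔟.Bd) :
    rho β c ∘L bra2 β γ η = bra2 β γ (η ∘L adjoint c) := by
  have := congrArg adjoint (ket2_comp_right hβ hγ hη (CStarBase.adjoint_mem_Bd hc))
  rw [adjoint_comp, adjoint_ket2, adjoint_ket2, adjoint_rho hβ (CStarBase.adjoint_mem_Bd hc),
    adjoint_adjoint] at this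
  exact this.symm

/-- `|x⟩₂⟨y|₂ = id ⊗ xy†`. -/
theorem ket2_comp_bra2 (hβ : IsCStarModule 𝔟 β) (hγ : IsCStarModule 𝔟.dagger γ)
    {x y : 𝔎 →L[ℂ] K} (hx : x ∈ γ) (hy : y ∈ γ) :
    ket2 β γ x ∘L bra2 β γ y = idTensor β γ γ (x ∘L adjoint y) := by
  have hxy : x ∘L adjoint y ∈ semiMorphisms γ γ := fun z hz => by
    rw [comp_assoc]; exact hγ.comp_mem hx (hγ.inner_mem hy hz)
  refine ext_ket1 hβ hγ fun ξ hξ => ?_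
  rw [idTensor_ket1 hβ hγ hγ hxy hξ, comp_assoc, bra2_comp_ket1 hβ hγ hξ hy, ← comp_assoc,
    ← comp_assoc, ket1_comp hβ hγ hξ hx]

end Adjoints

/-! ### Â is a C*-algebra, by regularity; Δ̂ on the second leg -/

section DualLeg

variable {𝔎 H : Type*} [NormedAddCommGroup 𝔎] [InnerProductSpace ℂ 𝔎] [CompleteSpace 𝔎]
  [NormedAddCommGroup H] [InnerProductSpace ℂ H] [CompleteSpace H]
  {𝔟 : CStarBase 𝔎} {hβ α β : Submodule ℂ (𝔎 →L[ℂ] H)} {V : RTP hβ α ≃ₗᵢ[ℂ] RTP α β}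

theorem adjoint_slice (η ξ : 𝔎 →L[ℂ] H) :
    adjoint (slice V η ξ) = bra2 hβ α ξ ∘L adjoint (opOf V) ∘L ket2 α β η := by
  rw [slice, adjoint_comp, adjoint_comp, adjoint_ket2, comp_assoc]; rfl

/-- `V† (id ⊗ a) V`. -/
def conj (V : RTP hβ α ≃ₗᵢ[ℂ] RTP α β) (a : H →L[ℂ] H) : RTP hβ α →L[ℂ] RTP hβ α :=
  adjoint (opOf V) ∘L idTensor α β β a ∘L opOf V

namespace IsPseudoMultiplicativeUnitary

variable (hV : IsPseudoMultiplicativeUnitary 𝔟 hβ α β V)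

include hV

theorem slice₃_mem_semiMorphisms {r q : 𝔎 →L[ℂ] H} (hr : r ∈ α) (hq : q ∈ α) :
    bra1 α β r ∘L opOf V ∘L ket2 hβ α q ∈ semiMorphisms α α := fun X hX => by
  rw [comp_assoc, comp_assoc]
  exact bra1_mem_semiMorphisms hV.module.module_α hV.module.module_β
    hV.module.module_α.isClosed hV.module.compatible_β_α hr _ (hV.opOf₁ _ (mem_ltri hq hX))

theorem bra2_leg13_ket1_ket1 {s ξ y : 𝔎 →L[ℂ] H} (hs : s ∈ β) (hξ : ξ ∈ hβ) (hy : y ∈ α) :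
    bra2 (ltri hβ α α) β s ∘L leg13 V ∘L ket1 hβ (rtri α β α) ξ ∘L ket1 α β y =
      ket2 hβ α y ∘L bra2 α β s ∘L opOf V ∘L ket1 hβ α ξ := by
  rw [hV.leg13_ket1_ket1 hξ hy, ← comp_assoc,
    bra2_tensorId hV.module.module_α hV.module.module_β hV.ltri_hβ_α_α
      (fun _ h => mem_ltri hy h) hs, comp_assoc]

/-- Slice the middle leg of ⟨s|₃V₁₃V₂₃|q⟩₃ by r. As V₁₃ does not see that leg, r moves on to V₂₃ and
produces ⟨r|₁V|q⟩₂, an operator that regularity controls. -/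
theorem bra2_comp_conj_slice {s q r : 𝔎 →L[ℂ] H} (hs : s ∈ β) (hq : q ∈ α) (hr : r ∈ α) :
    bra2 hβ α r ∘L conj V (slice V s q) =
      bra2 α β s ∘L opOf V ∘L idTensor hβ α α (bra1 α β r ∘L opOf V ∘L ket2 hβ α q) := by
  have m := hV.module
  rw [conj, hV.pentagon_slice hs hq]
  refine ext_ket1 (𝔟 := 𝔟.dagger) m.module_hβ m.module_α fun ξ hξ => ?_
  have e1 : idTensor hβ α (rtri α β α) (opOf V ∘L ket2 hβ α q) ∘L ket1 hβ α ξ =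
      ket1 hβ (rtri α β α) ξ ∘L opOf V ∘L ket2 hβ α q :=
    idTensor_ket1 (𝔟 := 𝔟.dagger) m.module_hβ m.module_α hV.rtri_α_β_α
      (fun X hX => hV.opOf₁ _ (mem_ltri hq hX)) hξ
  have e2 : idTensor hβ α α (bra1 α β r ∘L opOf V ∘L ket2 hβ α q) ∘L ket1 hβ α ξ =
      ket1 hβ α ξ ∘L bra1 α β r ∘L opOf V ∘L ket2 hβ α q :=
    idTensor_ket1 (𝔟 := 𝔟.dagger) m.module_hβ m.module_α m.module_α
      (hV.slice₃_mem_semiMorphisms hr hq) hξ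
  have e3 : bra2 hβ α r ∘L bra2 (ltri hβ α α) β s ∘L leg13 V ∘L ket1 hβ (rtri α β α) ξ =
      (bra2 α β s ∘L opOf V ∘L ket1 hβ α ξ) ∘L bra1 α β r := by
    refine ext_ket1 m.module_α m.module_β fun y hy => ?_
    simp only [assoc_comp]
    rw [hV.bra2_leg13_ket1_ket1 hs hξ hy, ← comp_assoc (bra2 hβ α r),
      bra2_comp_ket2 (𝔟 := 𝔟.dagger) m.module_hβ m.module_α hr hy,
      bra1_comp_ket1 m.module_α m.module_β hr hy]
    have := comp_rho (𝔟 := 𝔟.dagger) m.module_β m.module_hβ (hV.slice₁_mem_semiMorphisms hs hξ)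
      (c := adjoint r ∘L y) (m.module_α.inner_mem hr hy)
    rw [← this]
    simp only [assoc_comp]
  simp only [assoc_comp]
  rw [e1, e2]
  have := congrArg (fun f => f ∘L (opOf V ∘L ket2 hβ α q)) e3
  simpa only [assoc_comp] using this

/-- Composing the previous formula with V†|p⟩₂ cancels VV†, and then a = ⟨s|₂V|q⟩₂ is absorbed into
the ket: (id ⊗ a)|p⟩₂ = |ap⟩₂. -/
theorem comp_idTensor_comp {s q r p : 𝔎 →L[ℂ] H} (hs : s ∈ β) (hq : q ∈ α) (hr : r ∈ α)
    (hp : p ∈ β) :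
    bra2 α β s ∘L opOf V ∘L idTensor hβ α α (bra1 α β r ∘L opOf V ∘L ket2 hβ α q) ∘L
      adjoint (opOf V) ∘L ket2 α β p = adjoint (slice V (slice V s q ∘L p) r) := by
  have m := hV.module
  have h := hV.bra2_comp_conj_slice hs hq hr
  calc _ = (bra2 α β s ∘L opOf V ∘L
        idTensor hβ α α (bra1 α β r ∘L opOf V ∘L ket2 hβ α q)) ∘L
          (adjoint (opOf V) ∘L ket2 α β p) := by simp only [assoc_comp]
    _ = (bra2 hβ α r ∘L conj V (slice V s q)) ∘L (adjoint (opOf V) ∘L ket2 α β p) := by rw [h]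
    _ = bra2 hβ α r ∘L adjoint (opOf V) ∘L idTensor α β β (slice V s q) ∘L
          (opOf V ∘L adjoint (opOf V)) ∘L ket2 α β p := by rw [conj]; simp only [assoc_comp]
    _ = adjoint (slice V (slice V s q ∘L p) r) := by
      rw [opOf_comp_adjoint, id_comp, idTensor_ket2 m.module_α m.module_β m.module_β
        (hV.slice_mem_semiMorphisms hs hq) hp, adjoint_slice]

theorem slice_comp_adjoint_slice {s x y p : 𝔎 →L[ℂ] H} (hx : x ∈ α) (hy : y ∈ α) :
    slice V s x ∘L adjoint (slice V p y) =
      bra2 α β s ∘L opOf V ∘L idTensor hβ α α (x ∘L adjoint y) ∘L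
        adjoint (opOf V) ∘L ket2 α β p := by
  have h : ket2 hβ α x ∘L bra2 hβ α y = idTensor hβ α α (x ∘L adjoint y) :=
    ket2_comp_bra2 (𝔟 := 𝔟.dagger) hV.module.module_hβ hV.module.module_α hx hy
  rw [adjoint_slice, slice, ← h]
  simp only [assoc_comp]

theorem bddLinOn_comp_idTensor_comp (s p : 𝔎 →L[ℂ] H) :
    BddLinOn (semiMorphismSpace α α) fun k => bra2 α β s ∘L opOf V ∘L idTensor hβ α α k ∘L
      adjoint (opOf V) ∘L ket2 α β p :=
  (((bddLinOn_idTensor (𝔟 := 𝔟.dagger) hV.module.module_hβ hV.module.module_α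
    hV.module.module_α).comp_right (adjoint (opOf V) ∘L ket2 α β p)).comp_left (opOf V)).comp_left
      (bra2 α β s)

theorem comp_adjoint_mem_semiMorphisms {x y : 𝔎 →L[ℂ] H} (hx : x ∈ α) (hy : y ∈ α) :
    x ∘L adjoint y ∈ semiMorphisms α α := fun z hz => by
  rw [comp_assoc]
  exact hV.module.module_α.comp_mem hx (hV.module.module_α.inner_mem hy hz)

variable (hreg : IsRegular V)

include hreg

/-- The half [ÂÂ†] ⊆ Â†: regularity replaces xy† in the middle by operators ⟨r|₁V|q⟩₂, each of which
yields the adjoint of one slice. -/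
theorem slice_comp_adjoint_slice_mem {s x y p : 𝔎 →L[ℂ] H} (hs : s ∈ β) (hx : x ∈ α)
    (hy : y ∈ α) (hp : p ∈ β) : slice V s x ∘L adjoint (slice V p y) ∈
      cspan {T | ∃ η ∈ β, ∃ ξ ∈ α, adjoint (slice V η ξ) = T} := by
  rw [hV.slice_comp_adjoint_slice hx hy]
  have hk : x ∘L adjoint y ∈ cspan {T | ∃ ξ ∈ α, ∃ ξ' ∈ α, ξ ∘L adjoint ξ' = T} :=
    mem_cspan ⟨x, hx, y, hy, rfl⟩
  rw [← show cspan _ = cspan _ from hreg] at hk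
  refine (hV.bddLinOn_comp_idTensor_comp s p).mem_of_cspan
    (isClosed_semiMorphismSpace hV.module.module_α.isClosed) ?_ (isClosed_cspan _) ?_ hk
  · rintro _ ⟨r, hr, q, hq, rfl⟩; exact hV.slice₃_mem_semiMorphisms hr hq
  · rintro _ ⟨r, hr, q, hq, rfl⟩
    rw [hV.comp_idTensor_comp hs hq hr hp]
    exact mem_cspan ⟨_, hV.slice_mem_semiMorphisms hs hq p hp, r, hr, rfl⟩

/-- The half Â† ⊆ [ÂÂ†]: by [Âβ] = β the vector p may be taken of the form aη' with a a slice, and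
then regularity is read in the other direction. -/
theorem adjoint_slice_mem_cspan {p r : 𝔎 →L[ℂ] H} (hp : p ∈ β) (hr : r ∈ α) :
    adjoint (slice V p r) ∈ cspan {T | ∃ s ∈ β, ∃ x ∈ α, ∃ p ∈ β, ∃ y ∈ α,
      slice V s x ∘L adjoint (slice V p y) = T} := by
  have m := hV.module
  rw [adjoint_slice]
  refine (((bddLinOn_ket2 m.module_α m.module_β).comp_left (adjoint (opOf V))).comp_left
    (bra2 hβ α r)).mem_of_cspan m.module_β.isClosed ?_ (isClosed_cspan _) ?_
      (hV.le_cspan_slice_comp hp)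
  · rintro _ ⟨s, hs, q, hq, η', hη', rfl⟩; exact hV.slice_mem_semiMorphisms hs hq _ hη'
  · rintro _ ⟨s, hs, q, hq, η', hη', rfl⟩
    rw [← adjoint_slice, ← hV.comp_idTensor_comp hs hq hr hη']
    have hk : bra1 α β r ∘L opOf V ∘L ket2 hβ α q ∈
        cspan {T | ∃ ξ ∈ α, ∃ ξ' ∈ α, ξ ∘L adjoint ξ' = T} := by
      rw [← show cspan _ = cspan _ from hreg]
      exact mem_cspan ⟨r, hr, q, hq, rfl⟩
    refine (hV.bddLinOn_comp_idTensor_comp s η').mem_of_cspan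
      (isClosed_semiMorphismSpace m.module_α.isClosed) ?_ (isClosed_cspan _) ?_ hk
    · rintro _ ⟨x, hx, y, hy, rfl⟩; exact hV.comp_adjoint_mem_semiMorphisms hx hy
    · rintro _ ⟨x, hx, y, hy, rfl⟩
      rw [← hV.slice_comp_adjoint_slice hx hy]
      exact mem_cspan ⟨s, hs, x, hx, η', hη', y, hy, rfl⟩

theorem slice_comp_adjoint_slice_mem_dualLeg {s x y p : 𝔎 →L[ℂ] H} (hs : s ∈ β) (hx : x ∈ α)
    (hy : y ∈ α) (hp : p ∈ β) : slice V s x ∘L adjoint (slice V p y) ∈ dualLeg V := by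
  -- The known inclusion ends in the span of adjoint slices. Exchanging the two slices and then
  -- taking adjoints moves it into Â itself.
  have h := hV.slice_comp_adjoint_slice_mem hreg hp hy hx hs
  have h' : adjoint (slice V p y ∘L adjoint (slice V s x)) ∈ dualLeg V := by
    refine adjoint_mem_of_cspan (isClosed_cspan _) ?_ h
    rintro _ ⟨η, hη, ξ, hξ, rfl⟩
    rw [adjoint_adjoint]
    exact slice_mem hη hξ
  rwa [adjoint_comp, adjoint_adjoint] at h'

theorem adjoint_slice_mem {p r : 𝔎 →L[ℂ] H} (hp : p ∈ β) (hr : r ∈ α) :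
    adjoint (slice V p r) ∈ dualLeg V := by
  refine cspan_le (isClosed_cspan _) ?_ (hV.adjoint_slice_mem_cspan hreg hp hr)
  rintro _ ⟨s, hs, x, hx, p, hp, y, hy, rfl⟩
  exact hV.slice_comp_adjoint_slice_mem_dualLeg hreg hs hx hy hp

theorem adjoint_mem_dualLeg {a : H →L[ℂ] H} (ha : a ∈ dualLeg V) : adjoint a ∈ dualLeg V := by
  refine adjoint_mem_of_cspan (isClosed_cspan _) ?_ ha
  rintro _ ⟨η, hη, ξ, hξ, rfl⟩
  exact hV.adjoint_slice_mem hreg hη hξ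

theorem dualLeg_le_cspan_adjoint :
    dualLeg V ≤ cspan {T | ∃ η ∈ β, ∃ ξ ∈ α, adjoint (slice V η ξ) = T} := fun a ha => by
  rw [← adjoint_adjoint a]
  refine adjoint_mem_of_cspan (isClosed_cspan _) ?_ (hV.adjoint_mem_dualLeg hreg ha)
  rintro _ ⟨η, hη, ξ, hξ, rfl⟩
  exact mem_cspan ⟨η, hη, ξ, hξ, rfl⟩

theorem comp_mem_dualLeg {a b : H →L[ℂ] H} (ha : a ∈ dualLeg V) (hb : b ∈ dualLeg V) :
    a ∘L b ∈ dualLeg V := by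
  refine comp_mem_of_cspan_right a (isClosed_cspan _) ?_ (hV.dualLeg_le_cspan_adjoint hreg hb)
  rintro _ ⟨p, hp, y, hy, rfl⟩
  refine comp_mem_of_cspan_left _ (isClosed_cspan _) ?_ ha
  rintro _ ⟨s, hs, x, hx, rfl⟩
  exact hV.slice_comp_adjoint_slice_mem_dualLeg hreg hs hx hy hp

theorem isCStarSubalgebra_dualLeg : IsCStarSubalgebra (dualLeg V) :=
  ⟨isClosed_cspan _, fun _ ha _ hb => hV.comp_mem_dualLeg hreg ha hb,
    fun _ ha => hV.adjoint_mem_dualLeg hreg ha⟩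

omit hreg in
theorem rho_α_comp_mem {c : 𝔎 →L[ℂ] 𝔎} (hc : c ∈ 𝔟.Bd) {a : H →L[ℂ] H}
    (ha : a ∈ dualLeg V) : rho α c ∘L a ∈ dualLeg V := by
  refine comp_mem_of_cspan_right _ (isClosed_cspan _) ?_ ha
  rintro _ ⟨η, hη, ξ, hξ, rfl⟩
  rw [← comp_assoc, rho_comp_bra2 hV.module.module_α hV.module.module_β hη hc]
  exact slice_mem (hV.module.module_β.comp_mem hη (CStarBase.adjoint_mem_Bd hc)) hξ

/-- An adjoint slice starts with the bra ⟨ξ|₂ on hβ ⊗ α, which absorbs ρ_hβ(b). Thus Â = Â† is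
needed here, in contrast to ρ_α. -/
theorem rho_hβ_comp_mem {b : 𝔎 →L[ℂ] 𝔎} (hb : b ∈ 𝔟.B) {a : H →L[ℂ] H}
    (ha : a ∈ dualLeg V) : rho hβ b ∘L a ∈ dualLeg V := by
  refine comp_mem_of_cspan_right _ (isClosed_cspan _) ?_ (hV.dualLeg_le_cspan_adjoint hreg ha)
  rintro _ ⟨η, hη, ξ, hξ, rfl⟩
  rw [adjoint_slice, ← comp_assoc,
    rho_comp_bra2 (𝔟 := 𝔟.dagger) hV.module.module_hβ hV.module.module_α hξ hb, ← adjoint_slice]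
  exact hV.adjoint_slice_mem hreg hη
    (hV.module.module_α.comp_mem hξ (CStarBase.adjoint_mem hb))

theorem comp_rho_α_mem {c : 𝔎 →L[ℂ] 𝔎} (hc : c ∈ 𝔟.Bd) {a : H →L[ℂ] H}
    (ha : a ∈ dualLeg V) : a ∘L rho α c ∈ dualLeg V := by
  have h := hV.adjoint_mem_dualLeg hreg
    (hV.rho_α_comp_mem (CStarBase.adjoint_mem_Bd hc) (hV.adjoint_mem_dualLeg hreg ha))
  rwa [adjoint_comp, adjoint_adjoint, adjoint_rho hV.module.module_α
    (CStarBase.adjoint_mem_Bd hc), adjoint_adjoint] at h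

/-- `Â_V = [Â_V ρ_α(𝔅†)]`. -/
theorem dualLeg_le_cspan_comp_rho :
    dualLeg V ≤ cspan {T | ∃ a ∈ dualLeg V, ∃ c ∈ 𝔟.Bd, a ∘L rho α c = T} := by
  have m := hV.module
  refine (hV.dualLeg_le_cspan_adjoint hreg).trans (cspan_le (isClosed_cspan _) ?_)
  rintro _ ⟨η, hη, ξ, hξ, rfl⟩
  rw [adjoint_slice]
  rw [← m.module_β.mul_eq] at hη
  refine (((bddLinOn_ket2 m.module_α m.module_β).comp_left (adjoint (opOf V))).comp_left
    (bra2 hβ α ξ)).mem_of_cspan m.module_β.isClosed ?_ (isClosed_cspan _) ?_ hη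
  · rintro _ ⟨η, hη, c, hc, rfl⟩; exact m.module_β.comp_mem hη hc
  · rintro _ ⟨η, hη, c, hc, rfl⟩
    rw [ket2_comp_right m.module_α m.module_β hη hc]
    exact mem_cspan ⟨_, hV.adjoint_slice_mem hreg hη hξ, c, hc,
      by rw [adjoint_slice]; simp only [assoc_comp]⟩

omit hreg in
theorem dualComultiplication_eq {a : H →L[ℂ] H} (ha : a ∈ dualLeg V) :
    dualComultiplication V a = conj V a := by
  rw [dualComultiplication, idTensorComm_eq hV.module.module_α hV.module.module_β
    (hV.dualLeg_le ha), conj]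

omit hreg in
theorem bddLinOn_conj : BddLinOn (semiMorphismSpace β β) (conj V) :=
  ((bddLinOn_idTensor hV.module.module_α hV.module.module_β hV.module.module_β).comp_right
    (opOf V)).comp_left (adjoint (opOf V))

theorem adjoint_conj {a : H →L[ℂ] H} (ha : a ∈ dualLeg V) :
    adjoint (conj V a) = conj V (adjoint a) := by
  rw [conj, adjoint_comp, adjoint_comp, adjoint_adjoint,
    adjoint_idTensor hV.module.module_α hV.module.module_β hV.module.module_β (hV.dualLeg_le ha)
      (hV.dualLeg_le (hV.adjoint_mem_dualLeg hreg ha)), comp_assoc]; rfl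

omit hreg in
theorem conj_comp {a b : H →L[ℂ] H} (ha : a ∈ dualLeg V) (hb : b ∈ dualLeg V) :
    conj V (a ∘L b) = conj V a ∘L conj V b := by
  rw [conj, idTensor_comp hV.module.module_α hV.module.module_β hV.module.module_β
    hV.module.module_β (hV.dualLeg_le hb) (hV.dualLeg_le ha), conj, conj]
  simp only [assoc_comp]
  rw [← comp_assoc (opOf V) (adjoint (opOf V)), opOf_comp_adjoint, id_comp]

omit hreg in
theorem leg13_ket2 {q y : 𝔎 →L[ℂ] H} (hq : q ∈ α) (hy : y ∈ α) :
    leg13 V ∘L ket2 hβ (rtri α β α) (ket1 α β y ∘L q) =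
      tensorId α β (ltri hβ α α) (ket2 hβ α y) ∘L opOf V ∘L ket2 hβ α q := by
  have m := hV.module
  refine m.module_hβ.ext fun ξ hξ => ?_
  have e1 : ket1 hβ (rtri α β α) ξ ∘L ket1 α β y ∘L q =
      ket2 hβ (rtri α β α) (ket1 α β y ∘L q) ∘L ξ :=
    ket1_comp (𝔟 := 𝔟.dagger) m.module_hβ hV.rtri_α_β_α hξ (mem_rtri hy hq)
  have e2 : ket1 hβ α ξ ∘L q = ket2 hβ α q ∘L ξ :=
    ket1_comp (𝔟 := 𝔟.dagger) m.module_hβ m.module_α hξ hq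
  have e3 := congrArg (fun f => f ∘L q) (hV.leg13_ket1_ket1 hξ hy)
  simp only [assoc_comp] at e3 ⊢
  rw [← e1, e3, e2]

omit hreg in
theorem conj_comp_ket2_mem {y : 𝔎 →L[ℂ] H} {b : H →L[ℂ] H} (hb : b ∈ dualLeg V)
    (hy : y ∈ α) :
    conj V b ∘L ket2 hβ α y ∈ cspan {T | ∃ η' ∈ α, ∃ a ∈ dualLeg V, ket2 hβ α η' ∘L a = T} := by
  have m := hV.module
  refine (hV.bddLinOn_conj.comp_right (ket2 hβ α y)).mem_of_cspan
    (isClosed_semiMorphismSpace m.module_β.isClosed) ?_ (isClosed_cspan _) ?_ hb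
  · rintro _ ⟨s, hs, q, hq, rfl⟩; exact hV.slice_mem_semiMorphisms hs hq
  rintro _ ⟨s, hs, q, hq, rfl⟩
  change conj V (slice V s q) ∘L ket2 hβ α y ∈ _
  have e1 : idTensor hβ α (rtri α β α) (opOf V ∘L ket2 hβ α q) ∘L ket2 hβ α y =
      ket2 hβ (rtri α β α) ((opOf V ∘L ket2 hβ α q) ∘L y) :=
    idTensor_ket2 (𝔟 := 𝔟.dagger) m.module_hβ m.module_α hV.rtri_α_β_α
      (fun X hX => hV.opOf₁ _ (mem_ltri hq hX)) hy
  rw [conj, hV.pentagon_slice hs hq]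
  simp only [assoc_comp]
  rw [e1]
  -- V(α ◁ α) = α ▷ α lets V|q⟩₂y be approximated by sums of |y'⟩₁q'. Then y' sits in the second
  -- leg, where it passes V₁₃ as a ket, and q' in the third, where it completes the slice
  -- ⟨s|₂V|q'⟩₂.
  have hω : (opOf V ∘L ket2 hβ α q) ∘L y ∈ rtri α β α := hV.opOf₁ _ (mem_ltri hq hy)
  refine (((bddLinOn_ket2 (𝔟 := 𝔟.dagger) m.module_hβ hV.rtri_α_β_α).comp_left
    (leg13 V)).comp_left (bra2 (ltri hβ α α) β s)).mem_of_cspan (isClosed_cspan _) ?_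
      (isClosed_cspan _) ?_ hω
  · rintro _ ⟨y', hy', q', hq', rfl⟩; exact mem_rtri hy' hq'
  · rintro _ ⟨y', hy', q', hq', rfl⟩
    rw [hV.leg13_ket2 hq' hy', ← comp_assoc, bra2_tensorId m.module_α m.module_β hV.ltri_hβ_α_α
      (fun _ h => mem_ltri hy' h) hs]
    exact mem_cspan ⟨y', hy', slice V s q', slice_mem hs hq', by rw [slice, comp_assoc]⟩

end IsPseudoMultiplicativeUnitary

end DualLeg

/-! ### Δ̂ maps into the fiber product; joint semi-normality -/

section FiberProduct

variable {𝔎 H : Type*} [NormedAddCommGroup 𝔎] [InnerProductSpace ℂ 𝔎] [CompleteSpace 𝔎]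
  [NormedAddCommGroup H] [InnerProductSpace ℂ H] [CompleteSpace H]
  {𝔟 : CStarBase 𝔎} {hβ α β : Submodule ℂ (𝔎 →L[ℂ] H)} {V : RTP hβ α ≃ₗᵢ[ℂ] RTP α β}

namespace IsPseudoMultiplicativeUnitary

variable (hV : IsPseudoMultiplicativeUnitary 𝔟 hβ α β V)

include hV

theorem bra1_rearrange_ket1_ket1 {ω : 𝔎 →L[ℂ] RTP hβ α} {ξ y : 𝔎 →L[ℂ] H}
    (hω : ω ∈ rtri hβ α β) (hξ : ξ ∈ hβ) (hy : y ∈ α) :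
    bra1 (rtri hβ α β) α ω ∘L rearrange hβ α β ∘L ket1 hβ (rtri α β α) ξ ∘L ket1 α β y =
      y ∘L adjoint ω ∘L ket1 hβ α ξ := by
  rw [hV.rearrange_ket1_ket1 hξ hy, ← comp_assoc,
    bra1_comp_ket2 (𝔟 := 𝔟.dagger) hV.rtri_hβ_α_β hV.module.module_α hω hy, comp_assoc]

/-- Slicing the first and third legs at once by |ξ⟩₁s is slicing them separately; `rearrange` only
brings these two legs together. -/
theorem bra1_rearrange {ξ s : 𝔎 →L[ℂ] H} (hξ : ξ ∈ hβ) (hs : s ∈ β) :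
    bra1 (rtri hβ α β) α (ket1 hβ α ξ ∘L s) ∘L rearrange hβ α β =
      bra2 α β s ∘L bra1 hβ (rtri α β α) ξ := by
  have m := hV.module
  refine ext_ket1 (𝔟 := 𝔟.dagger) m.module_hβ hV.rtri_α_β_α fun ξ' hξ' =>
    ext_ket1 m.module_α m.module_β fun y hy => ?_
  have hc : adjoint ξ ∘L ξ' ∈ 𝔟.Bd := m.module_hβ.inner_mem hξ hξ'
  have e1 : bra1 hβ α ξ ∘L ket1 hβ α ξ' = rho α (adjoint ξ ∘L ξ') :=
    bra1_comp_ket1 (𝔟 := 𝔟.dagger) m.module_hβ m.module_α hξ hξ'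
  have e2 : bra1 hβ (rtri α β α) ξ ∘L ket1 hβ (rtri α β α) ξ' =
      rho (rtri α β α) (adjoint ξ ∘L ξ') :=
    bra1_comp_ket1 (𝔟 := 𝔟.dagger) m.module_hβ hV.rtri_α_β_α hξ hξ'
  have e3 : rho (rtri α β α) (adjoint ξ ∘L ξ') ∘L ket1 α β y =
      ket1 α β y ∘L rho α (adjoint ξ ∘L ξ') :=
    rho_rtri_comp_ket1 m.module_α m.module_β m.module_α m.compatible_β_α hy hc
  simp only [assoc_comp]
  rw [hV.bra1_rearrange_ket1_ket1 (mem_rtri hξ hs) hξ' hy, adjoint_comp, adjoint_ket1,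
    comp_assoc, e1, ← comp_assoc (bra1 hβ (rtri α β α) ξ), e2, e3, ← comp_assoc (bra2 α β s),
    bra2_comp_ket1 m.module_α m.module_β hy hs, comp_assoc]

/-- On the first and third legs, ⟨ξ|₁⟨s|₂V is the bra of V†|s⟩₂ξ, which lies in hβ ▷ β. The unitary
is thereby absorbed into a vector that can be approximated by sums of |x⟩₁y. -/
theorem bra1_bra2_leg13 {ξ s : 𝔎 →L[ℂ] H} (hξ : ξ ∈ hβ) (hs : s ∈ β) :
    bra1 hβ α ξ ∘L bra2 (ltri hβ α α) β s ∘L leg13 V =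
      bra1 (rtri hβ α β) α (adjoint (opOf V) ∘L ket2 α β s ∘L ξ) ∘L rearrange hβ α β := by
  have m := hV.module
  have hω : adjoint (opOf V) ∘L ket2 α β s ∘L ξ ∈ rtri hβ α β :=
    adjoint_opOf_mem_semiMorphisms hV.map_hβ_β _ (mem_ltri hs hξ)
  refine ext_ket1 (𝔟 := 𝔟.dagger) m.module_hβ hV.rtri_α_β_α fun ξ' hξ' =>
    ext_ket1 m.module_α m.module_β fun y hy => ?_
  have e1 : bra1 hβ α ξ ∘L ket2 hβ α y = y ∘L adjoint ξ :=
    bra1_comp_ket2 (𝔟 := 𝔟.dagger) m.module_hβ m.module_α hξ hy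
  simp only [assoc_comp]
  rw [hV.bra2_leg13_ket1_ket1 hs hξ' hy, hV.bra1_rearrange_ket1_ket1 hω hξ' hy, ← comp_assoc, e1,
    adjoint_comp, adjoint_comp, adjoint_adjoint, adjoint_ket2]
  simp only [assoc_comp]

theorem adjoint_conj_slice_comp_ket1_mem (hreg : IsRegular V) {ξ s q : 𝔎 →L[ℂ] H} (hξ : ξ ∈ hβ)
    (hs : s ∈ β) (hq : q ∈ α) : adjoint (conj V (slice V s q)) ∘L ket1 hβ α ξ ∈
      cspan {T | ∃ ξ' ∈ hβ, ∃ a ∈ dualLeg V, ket1 hβ α ξ' ∘L a = T} := by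
  have m := hV.module
  have hω : adjoint (opOf V) ∘L ket2 α β s ∘L ξ ∈ rtri hβ α β :=
    adjoint_opOf_mem_semiMorphisms hV.map_hβ_β _ (mem_ltri hs hξ)
  set W := idTensor hβ α (rtri α β α) (opOf V ∘L ket2 hβ α q) with hW
  -- Bras are conjugate-linear in ω. The adjoint is taken so that the approximation of ω is applied
  -- to the linear map ω ↦ |ω⟩₁.
  have key : ∀ ω, adjoint (bra1 (rtri hβ α β) α ω ∘L rearrange hβ α β ∘L W) =
      (adjoint W ∘L adjoint (rearrange hβ α β)) ∘L ket1 (rtri hβ α β) α ω := fun ω => by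
    rw [adjoint_comp, adjoint_comp, ket1]
  have e : adjoint (conj V (slice V s q)) ∘L ket1 hβ α ξ =
      (adjoint W ∘L adjoint (rearrange hβ α β)) ∘L
        ket1 (rtri hβ α β) α (adjoint (opOf V) ∘L ket2 α β s ∘L ξ) := by
    have h := hV.bra1_bra2_leg13 hξ hs
    rw [← key, ← comp_assoc, ← h, ket1, ← adjoint_comp, conj, hV.pentagon_slice hs hq, ← hW]
    simp only [assoc_comp]
  rw [e]
  refine ((bddLinOn_ket1 (𝔟 := 𝔟.dagger) hV.rtri_hβ_α_β m.module_α).comp_left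
    (adjoint W ∘L adjoint (rearrange hβ α β))).mem_of_cspan (isClosed_cspan _) ?_
      (isClosed_cspan _) ?_ hω
  · rintro _ ⟨x, hx, y, hy, rfl⟩; exact mem_rtri hx hy
  · rintro _ ⟨x, hx, y, hy, rfl⟩
    have e2 : bra1 hβ (rtri α β α) x ∘L W = (opOf V ∘L ket2 hβ α q) ∘L bra1 hβ α x :=
      bra1_idTensor (𝔟 := 𝔟.dagger) m.module_hβ m.module_α hV.rtri_α_β_α
        (fun X hX => hV.opOf₁ _ (mem_ltri hq hX)) hx
    have e3 : bra1 (rtri hβ α β) α (ket1 hβ α x ∘L y) ∘L rearrange hβ α β ∘L W =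
        slice V y q ∘L bra1 hβ α x := by
      rw [← comp_assoc, hV.bra1_rearrange hx hy, comp_assoc, e2, slice]
      simp only [assoc_comp]
    rw [← key, e3, adjoint_comp]
    exact mem_cspan ⟨x, hx, _, hV.adjoint_slice_mem hreg hy hq, rfl⟩

theorem conj_comp_ket1_mem (hreg : IsRegular V) {ξ : 𝔎 →L[ℂ] H} {a : H →L[ℂ] H}
    (ha : a ∈ dualLeg V) (hξ : ξ ∈ hβ) : conj V a ∘L ket1 hβ α ξ ∈
      cspan {T | ∃ ξ' ∈ hβ, ∃ a ∈ dualLeg V, ket1 hβ α ξ' ∘L a = T} := by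
  refine (hV.bddLinOn_conj.comp_right (ket1 hβ α ξ)).mem_of_cspan
    (isClosed_semiMorphismSpace hV.module.module_β.isClosed) ?_ (isClosed_cspan _) ?_
      (hV.dualLeg_le_cspan_adjoint hreg ha)
  · rintro _ ⟨s, hs, q, hq, rfl⟩; exact hV.dualLeg_le (hV.adjoint_slice_mem hreg hs hq)
  · rintro _ ⟨s, hs, q, hq, rfl⟩
    rw [← hV.adjoint_conj hreg (slice_mem hs hq)]
    exact hV.adjoint_conj_slice_comp_ket1_mem hreg hξ hs hq

theorem dualComultiplication_mem_fiberProduct (hreg : IsRegular V) {a : H →L[ℂ] H}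
    (ha : a ∈ dualLeg V) :
    dualComultiplication V a ∈ fiberProduct hβ α (dualLeg V) (dualLeg V) := by
  have ha' := hV.adjoint_mem_dualLeg hreg ha
  rw [hV.dualComultiplication_eq ha]
  refine ⟨fun ξ hξ => ⟨hV.conj_comp_ket1_mem hreg ha hξ, ?_⟩,
    fun η hη => ⟨hV.conj_comp_ket2_mem ha hη, ?_⟩⟩
  · rw [hV.adjoint_conj hreg ha]; exact hV.conj_comp_ket1_mem hreg ha' hξ
  · rw [hV.adjoint_conj hreg ha]; exact hV.conj_comp_ket2_mem ha' hη

theorem isCStarBiAlgebra (hreg : IsRegular V) :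
    IsCStarBiAlgebra 𝔟.dagger α hβ (dualLeg V) where
  module_left := hV.module.module_α
  module_right := hV.module.module_hβ
  compatible_left := hV.module.compatible_α_hβ
  compatible_right := hV.module.compatible_hβ_α
  algebra := hV.isCStarSubalgebra_dualLeg hreg
  rho_left_mem := fun _ hb _ ha => hV.rho_α_comp_mem hb ha
  rho_right_mem := fun _ hc _ ha => hV.rho_hβ_comp_mem hreg hc ha

/-- In V†(id ⊗ a)V · V†|y⟩₁ the inner VV† cancels and id ⊗ a passes |y⟩₁. These operators alone give
joint semi-normality, as V† maps α ▷ α onto α ◁ α and α ▷ hβ onto hβ ▷ hβ. -/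
theorem adjoint_opOf_comp_ket1_mem_intertwiners {y : 𝔎 →L[ℂ] H} (hy : y ∈ α) :
    adjoint (opOf V) ∘L ket1 α β y ∈ intertwiners (dualLeg V) (dualComultiplication V) :=
  fun a ha => by
    have m := hV.module
    rw [hV.dualComultiplication_eq ha, conj]
    simp only [assoc_comp]
    rw [← comp_assoc (opOf V) (adjoint (opOf V)), opOf_comp_adjoint, id_comp,
      idTensor_ket1 m.module_α m.module_β m.module_β (hV.dualLeg_le ha) hy]

theorem adjoint_opOf_comp_ket1_mem_semiMorphisms {y : 𝔎 →L[ℂ] H} (hy : y ∈ α) :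
    adjoint (opOf V) ∘L ket1 α β y ∈
      semiMorphisms α (ltri hβ α α) ∩ semiMorphisms hβ (rtri hβ α hβ) :=
  ⟨fun _ hξ => by
      rw [comp_assoc]
      exact adjoint_opOf_mem_semiMorphisms hV.map_α_α _ (mem_rtri hy hξ),
    fun _ hξ => by
      rw [comp_assoc]
      exact adjoint_opOf_mem_semiMorphisms hV.map_hβ_hβ _ (mem_rtri hy hξ)⟩

theorem cspan_comp_eq_ltri :
    cspan {T | ∃ S ∈ intertwiners (dualLeg V) (dualComultiplication V) ∩
      (semiMorphisms α (ltri hβ α α) ∩ semiMorphisms hβ (rtri hβ α hβ)), ∃ ξ ∈ α, S ∘L ξ = T} =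
    ltri hβ α α := by
  refine le_antisymm (cspan_le (isClosed_cspan _) ?_) fun X hX => ?_
  · rintro _ ⟨S, hS, ξ, hξ, rfl⟩; exact hS.2.1 ξ hξ
  · have h : adjoint (opOf V) ∘L opOf V ∘L X = X := by
      rw [← comp_assoc, adjoint_opOf_comp, id_comp]
    rw [← h]
    refine comp_mem_of_cspan_right _ (isClosed_cspan _) ?_ (hV.opOf₁ X hX)
    rintro _ ⟨y, hy, ξ, hξ, rfl⟩
    exact mem_cspan ⟨_, ⟨hV.adjoint_opOf_comp_ket1_mem_intertwiners hy,
      hV.adjoint_opOf_comp_ket1_mem_semiMorphisms hy⟩, ξ, hξ, by rw [comp_assoc]⟩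

theorem cspan_comp_eq_rtri :
    cspan {T | ∃ S ∈ intertwiners (dualLeg V) (dualComultiplication V) ∩
      (semiMorphisms α (ltri hβ α α) ∩ semiMorphisms hβ (rtri hβ α hβ)), ∃ ξ ∈ hβ, S ∘L ξ = T} =
    rtri hβ α hβ := by
  refine le_antisymm (cspan_le (isClosed_cspan _) ?_) fun X hX => ?_
  · rintro _ ⟨S, hS, ξ, hξ, rfl⟩; exact hS.2.2 ξ hξ
  · have h : adjoint (opOf V) ∘L opOf V ∘L X = X := by
      rw [← comp_assoc, adjoint_opOf_comp, id_comp]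
    rw [← h]
    refine comp_mem_of_cspan_right _ (isClosed_cspan _) ?_ (hV.opOf₃ X hX)
    rintro _ ⟨y, hy, ξ, hξ, rfl⟩
    exact mem_cspan ⟨_, ⟨hV.adjoint_opOf_comp_ket1_mem_intertwiners hy,
      hV.adjoint_opOf_comp_ket1_mem_semiMorphisms hy⟩, ξ, hξ, by rw [comp_assoc]⟩

end IsPseudoMultiplicativeUnitary

end FiberProduct

/-! ### Conjugation formulas on three legs -/

section Coassociativity

variable {𝔎 H : Type*} [NormedAddCommGroup 𝔎] [InnerProductSpace ℂ 𝔎] [CompleteSpace 𝔎]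
  [NormedAddCommGroup H] [InnerProductSpace ℂ H] [CompleteSpace H]
  {𝔟 : CStarBase 𝔎} {hβ α β : Submodule ℂ (𝔎 →L[ℂ] H)} {V : RTP hβ α ≃ₗᵢ[ℂ] RTP α β}

/-- `V₁₂† (id ⊗ x) V₁₂`. -/
def conjLeft (V : RTP hβ α ≃ₗᵢ[ℂ] RTP α β) (x : RTP hβ α →L[ℂ] RTP hβ α) :
    RTP (rtri hβ α hβ) α →L[ℂ] RTP (rtri hβ α hβ) α :=
  tensorId (rtri α β hβ) α (rtri hβ α hβ) (adjoint (opOf V)) ∘L assocInv α β hβ α ∘L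
    idTensor α (ltri hβ α β) (ltri hβ α β) x ∘L assoc α β hβ α ∘L
      tensorId (rtri hβ α hβ) α (rtri α β hβ) (opOf V)

/-- The inverse of `rearrange`. -/
def rearrangeInv (hβ α β : Submodule ℂ (𝔎 →L[ℂ] H)) :
    RTP (rtri hβ α β) α →L[ℂ] RTP hβ (rtri α β α) :=
  idTensor hβ (ltri β α α) (rtri α β α) (flip β α) ∘L assoc hβ α β α

/-- The amplification `z ↦ z₁₃` of `z ∈ ℒ(H, H hβ⊗α H)`. -/
def amplify (hβ α β : Submodule ℂ (𝔎 →L[ℂ] H)) (z : H →L[ℂ] RTP hβ α) :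
    RTP α β →L[ℂ] RTP hβ (rtri α β α) :=
  rearrangeInv hβ α β ∘L flip α (rtri hβ α β) ∘L idTensor α β (rtri hβ α β) z

/-- `V₁₂† z₂₃ V` for `z ∈ ℒ(H, H hβ⊗α H)`. -/
def conjKet2 (V : RTP hβ α ≃ₗᵢ[ℂ] RTP α β) (z : H →L[ℂ] RTP hβ α) :
    RTP hβ α →L[ℂ] RTP (rtri hβ α hβ) α :=
  tensorId (rtri α β hβ) α (rtri hβ α hβ) (adjoint (opOf V)) ∘L assocInv α β hβ α ∘L
    idTensor α β (ltri hβ α β) z ∘L opOf V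

/-- `V₂₃† z₁₃ V` for `z ∈ ℒ(H, H hβ⊗α H)`. -/
def conjKet1 (V : RTP hβ α ≃ₗᵢ[ℂ] RTP α β) (z : H →L[ℂ] RTP hβ α) :
    RTP hβ α →L[ℂ] RTP hβ (ltri hβ α α) :=
  idTensor hβ (rtri α β α) (ltri hβ α α) (adjoint (opOf V)) ∘L amplify hβ α β z ∘L opOf V

namespace IsPseudoMultiplicativeUnitary

variable (hV : IsPseudoMultiplicativeUnitary 𝔟 hβ α β V)

include hV

theorem idTensor_mem_semiMorphisms {a : H →L[ℂ] H} (ha : a ∈ dualLeg V) :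
    idTensor α β β a ∈ semiMorphisms (ltri α β β) (ltri α β β) := fun X hX => by
  have m := hV.module
  refine comp_mem_of_cspan_right _ (isClosed_cspan _) ?_ hX
  rintro _ ⟨η, hη, ξ, hξ, rfl⟩
  rw [← comp_assoc, idTensor_ket2 m.module_α m.module_β m.module_β (hV.dualLeg_le ha) hη]
  exact mem_ltri (hV.dualLeg_le ha _ hη) hξ

theorem conj_mem_semiMorphisms {a : H →L[ℂ] H} (ha : a ∈ dualLeg V) :
    conj V a ∈ semiMorphisms (ltri hβ α β) (ltri hβ α β) :=
  comp_mem_semiMorphisms (comp_mem_semiMorphisms hV.opOf₄ (hV.idTensor_mem_semiMorphisms ha))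
    (adjoint_opOf_mem_semiMorphisms hV.map_β_α)

theorem ket2_comp_mem {η : 𝔎 →L[ℂ] H} {a : H →L[ℂ] H} (hη : η ∈ α) (ha : a ∈ dualLeg V) :
    ket2 hβ α η ∘L a ∈ semiMorphisms β (ltri hβ α β) := fun X hX => by
  rw [comp_assoc]; exact mem_ltri hη (hV.dualLeg_le ha X hX)

theorem ket1_comp_mem {ξ : 𝔎 →L[ℂ] H} {a : H →L[ℂ] H} (hξ : ξ ∈ hβ) (ha : a ∈ dualLeg V) :
    ket1 hβ α ξ ∘L a ∈ semiMorphisms β (rtri hβ α β) := fun X hX => by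
  rw [comp_assoc]; exact mem_rtri hξ (hV.dualLeg_le ha X hX)

/-- After a third-leg ket, the conjugate depends on a only through z = Δ̂(a)|η⟩₂. It can thus be
computed by approximating z by sums of |η'⟩₂b with b ∈ Â, for which `conjKet2_ket2_comp` gives
|η'⟩₂Δ̂(b). -/
theorem conjLeft_comp_ket2 {η : 𝔎 →L[ℂ] H} {a : H →L[ℂ] H} (hη : η ∈ α)
    (ha : a ∈ dualLeg V) :
    conjLeft V (conj V a) ∘L ket2 (rtri hβ α hβ) α η = conjKet2 V (conj V a ∘L ket2 hβ α η) := by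
  have m := hV.module
  have e1 : tensorId (rtri hβ α hβ) α (rtri α β hβ) (opOf V) ∘L ket2 (rtri hβ α hβ) α η =
      ket2 (rtri α β hβ) α η ∘L opOf V :=
    tensorId_ket2 (𝔟 := 𝔟.dagger) hV.rtri_hβ_α_hβ m.module_α hV.rtri_α_β_hβ hV.opOf₃ hη
  have e2 : assoc α β hβ α ∘L ket2 (rtri α β hβ) α η =
      idTensor α β (ltri hβ α β) (ket2 hβ α η) :=
    assoc_ket2 (𝔟 := 𝔟) (𝔠 := 𝔟.dagger) m.module_α m.module_β m.module_hβ m.module_α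
      m.compatible_β_hβ m.compatible_hβ_β hη
  rw [conjLeft, conjKet2, idTensor_comp m.module_α m.module_β hV.ltri_hβ_α_β hV.ltri_hβ_α_β
    (fun _ h => mem_ltri hη h) (hV.conj_mem_semiMorphisms ha)]
  simp only [assoc_comp]
  rw [e1, ← comp_assoc (assoc _ _ _ _), e2]

theorem conjKet2_ket2_comp {η : 𝔎 →L[ℂ] H} {a : H →L[ℂ] H} (hη : η ∈ α)
    (ha : a ∈ dualLeg V) :
    conjKet2 V (ket2 hβ α η ∘L a) = ket2 (rtri hβ α hβ) α η ∘L conj V a := by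
  have m := hV.module
  have e1 : tensorId (rtri α β hβ) α (rtri hβ α hβ) (adjoint (opOf V)) ∘L
      ket2 (rtri α β hβ) α η = ket2 (rtri hβ α hβ) α η ∘L adjoint (opOf V) :=
    tensorId_ket2 (𝔟 := 𝔟.dagger) hV.rtri_α_β_hβ m.module_α hV.rtri_hβ_α_hβ
      (adjoint_opOf_mem_semiMorphisms hV.map_hβ_hβ) hη
  have e2 : assoc α β hβ α ∘L ket2 (rtri α β hβ) α η =
      idTensor α β (ltri hβ α β) (ket2 hβ α η) :=
    assoc_ket2 (𝔟 := 𝔟) (𝔠 := 𝔟.dagger) m.module_α m.module_β m.module_hβ m.module_α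
      m.compatible_β_hβ m.compatible_hβ_β hη
  have e3 : assocInv α β hβ α ∘L assoc α β hβ α = ContinuousLinearMap.id ℂ _ :=
    assocInv_comp_assoc (𝔟 := 𝔟) (𝔠 := 𝔟.dagger) m.module_α m.module_β m.module_hβ m.module_α
      m.compatible_β_hβ m.compatible_hβ_β
  rw [conjKet2, idTensor_comp m.module_α m.module_β m.module_β hV.ltri_hβ_α_β
    (hV.dualLeg_le ha) (fun _ h => mem_ltri hη h), ← e2, conj]
  simp only [assoc_comp]
  rw [← comp_assoc (assocInv _ _ _ _), e3, id_comp, ← comp_assoc, e1, comp_assoc]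

theorem bddLinOn_conjKet2 : BddLinOn (semiMorphismSpace β (ltri hβ α β)) (conjKet2 V) :=
  (((bddLinOn_idTensor hV.module.module_α hV.module.module_β hV.ltri_hβ_α_β).comp_right
    (opOf V)).comp_left (assocInv α β hβ α)).comp_left
      (tensorId (rtri α β hβ) α (rtri hβ α hβ) (adjoint (opOf V)))

/-- The defining relation of (Δ̂ ∗ id)(Δ̂(a)). On |η⟩₂, S ⊗ id becomes S; the fiber product property
approximates Δ̂(a)|η⟩₂ by sums of |η'⟩₂b, and there the claim is just Δ̂(b)S = Sb. -/
theorem conjLeft_comp_tensorId {a : H →L[ℂ] H} (ha : a ∈ dualLeg V) {S : H →L[ℂ] RTP hβ α}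
    (hS : S ∈ intertwiners (dualLeg V) (dualComultiplication V))
    (hS' : S ∈ semiMorphisms hβ (rtri hβ α hβ)) :
    conjLeft V (conj V a) ∘L tensorId hβ α (rtri hβ α hβ) S =
      tensorId hβ α (rtri hβ α hβ) S ∘L conj V a := by
  have m := hV.module
  have e1 : ∀ η ∈ α, tensorId hβ α (rtri hβ α hβ) S ∘L ket2 hβ α η =
      ket2 (rtri hβ α hβ) α η ∘L S := fun η hη =>
    tensorId_ket2 (𝔟 := 𝔟.dagger) m.module_hβ m.module_α hV.rtri_hβ_α_hβ hS' hη
  refine ext_ket2 (𝔟 := 𝔟.dagger) m.module_hβ m.module_α fun η hη => ?_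
  rw [comp_assoc, e1 η hη, ← comp_assoc, hV.conjLeft_comp_ket2 hη ha, comp_assoc]
  refine (hV.bddLinOn_conjKet2.comp_right S).eq_of_cspan
    ((BddLinOn.of_clm (ContinuousLinearMap.id ℂ _)).comp_left
      (tensorId hβ α (rtri hβ α hβ) S))
    (isClosed_semiMorphismSpace hV.ltri_hβ_α_β.isClosed) ?_ ?_ (hV.conj_comp_ket2_mem ha hη)
  · rintro _ ⟨η', hη', b, hb, rfl⟩; exact hV.ket2_comp_mem hη' hb
  · rintro _ ⟨η', hη', b, hb, rfl⟩
    rw [hV.conjKet2_ket2_comp hη' hb, ContinuousLinearMap.id_apply, ← comp_assoc, e1 η' hη',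
      comp_assoc, comp_assoc, hS b hb, hV.dualComultiplication_eq hb]

theorem flip_mem_semiMorphisms_rtri : flip β α ∈ semiMorphisms (ltri β α α) (rtri α β α) :=
  flip_mem_semiMorphisms' (𝔟 := 𝔟.dagger) hV.module.module_β hV.module.module_α

theorem rearrangeInv_ket2_ket1 {ξ y : 𝔎 →L[ℂ] H} (hξ : ξ ∈ hβ) (hy : y ∈ α) :
    rearrangeInv hβ α β ∘L ket2 (rtri hβ α β) α y ∘L ket1 hβ α ξ =
      ket1 hβ (rtri α β α) ξ ∘L ket1 α β y := by
  have m := hV.module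
  have e1 : assoc hβ α β α ∘L ket2 (rtri hβ α β) α y ∘L ket1 hβ α ξ =
      ket1 hβ (ltri β α α) ξ ∘L ket2 β α y :=
    assoc_ket2_ket1 (𝔟 := 𝔟.dagger) (𝔠 := 𝔟.dagger) m.module_hβ m.module_α m.module_β
      m.module_α m.compatible_α_β m.compatible_β_α hξ hy
  have e2 : idTensor hβ (ltri β α α) (rtri α β α) (flip β α) ∘L ket1 hβ (ltri β α α) ξ =
      ket1 hβ (rtri α β α) ξ ∘L flip β α :=
    idTensor_ket1 (𝔟 := 𝔟.dagger) m.module_hβ hV.ltri_β_α_α hV.rtri_α_β_α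
      hV.flip_mem_semiMorphisms_rtri hξ
  have e3 : flip β α ∘L ket2 β α y = ket1 α β y :=
    flip_ket2 (𝔟 := 𝔟.dagger) m.module_β m.module_α hy
  rw [rearrangeInv, comp_assoc, e1, ← comp_assoc, e2, comp_assoc, e3]

theorem rearrange_comp_rearrangeInv :
    rearrange hβ α β ∘L rearrangeInv hβ α β = ContinuousLinearMap.id ℂ _ :=
  ext_ket2 (𝔟 := 𝔟.dagger) hV.rtri_hβ_α_β hV.module.module_α fun y hy =>
    ext_ket1 (𝔟 := 𝔟.dagger) hV.module.module_hβ hV.module.module_α fun ξ hξ => by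
      rw [comp_assoc, comp_assoc, hV.rearrangeInv_ket2_ket1 hξ hy,
        hV.rearrange_ket1_ket1 hξ hy, id_comp]

theorem amplify_comp_ket1 {z : H →L[ℂ] RTP hβ α} (hz : z ∈ semiMorphisms β (rtri hβ α β))
    {y : 𝔎 →L[ℂ] H} (hy : y ∈ α) :
    amplify hβ α β z ∘L ket1 α β y = rearrangeInv hβ α β ∘L ket2 (rtri hβ α β) α y ∘L z := by
  have m := hV.module
  have e1 : flip α (rtri hβ α β) ∘L ket1 α (rtri hβ α β) y = ket2 (rtri hβ α β) α y :=
    flip_ket1 m.module_α hV.rtri_hβ_α_β hy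
  rw [amplify, comp_assoc, comp_assoc,
    idTensor_ket1 m.module_α m.module_β hV.rtri_hβ_α_β hz hy,
    ← comp_assoc (flip α (rtri hβ α β)), e1]

theorem amplify_ket1_comp {ξ : 𝔎 →L[ℂ] H} {a : H →L[ℂ] H} (hξ : ξ ∈ hβ)
    (ha : a ∈ dualLeg V) :
    amplify hβ α β (ket1 hβ α ξ ∘L a) = ket1 hβ (rtri α β α) ξ ∘L idTensor α β β a := by
  have m := hV.module
  refine ext_ket1 m.module_α m.module_β fun y hy => ?_
  have e := congrArg (fun f => f ∘L a) (hV.rearrangeInv_ket2_ket1 hξ hy)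
  simp only [assoc_comp] at e
  rw [hV.amplify_comp_ket1 (hV.ket1_comp_mem hξ ha) hy, e, comp_assoc,
    idTensor_ket1 m.module_α m.module_β m.module_β (hV.dualLeg_le ha) hy]

/-- The first-leg counterpart of `conjKet2_ket2_comp`: amplifying |ξ⟩₁a gives |ξ⟩₁(id ⊗ a), and
conjugating the last two legs by V turns id ⊗ a into Δ̂(a). -/
theorem conjKet1_ket1_comp {ξ : 𝔎 →L[ℂ] H} {a : H →L[ℂ] H} (hξ : ξ ∈ hβ)
    (ha : a ∈ dualLeg V) :
    conjKet1 V (ket1 hβ α ξ ∘L a) = ket1 hβ (ltri hβ α α) ξ ∘L conj V a := by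
  have e : idTensor hβ (rtri α β α) (ltri hβ α α) (adjoint (opOf V)) ∘L
      ket1 hβ (rtri α β α) ξ = ket1 hβ (ltri hβ α α) ξ ∘L adjoint (opOf V) :=
    idTensor_ket1 (𝔟 := 𝔟.dagger) hV.module.module_hβ hV.rtri_α_β_α hV.ltri_hβ_α_α
      (adjoint_opOf_mem_semiMorphisms hV.map_α_α) hξ
  rw [conjKet1, hV.amplify_ket1_comp hξ ha, comp_assoc, ← comp_assoc, e, conj, comp_assoc]

theorem bddLinOn_conjKet1 : BddLinOn (semiMorphismSpace β (rtri hβ α β)) (conjKet1 V) :=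
  ((((bddLinOn_idTensor hV.module.module_α hV.module.module_β hV.rtri_hβ_α_β).comp_left
    (flip α (rtri hβ α β))).comp_left (rearrangeInv hβ α β)).comp_right (opOf V)).comp_left
      (idTensor hβ (rtri α β α) (ltri hβ α α) (adjoint (opOf V)))

theorem conj_comp_ket1_mem_semiMorphisms (hreg : IsRegular V) {ξ : 𝔎 →L[ℂ] H} {a : H →L[ℂ] H}
    (hξ : ξ ∈ hβ) (ha : a ∈ dualLeg V) :
    conj V a ∘L ket1 hβ α ξ ∈ semiMorphismSpace β (rtri hβ α β) := by
  refine cspan_le (isClosed_semiMorphismSpace (isClosed_cspan _)) ?_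
    (hV.conj_comp_ket1_mem hreg ha hξ)
  rintro _ ⟨ξ', hξ', b, hb, rfl⟩; exact hV.ket1_comp_mem hξ' hb

/-- `V₁₃ z₁₃ = a₃ V₁₃ |ξ⟩₁` for `z = Δ̂(a) |ξ⟩₁`. -/
theorem leg13_comp_amplify (hreg : IsRegular V) {ξ : 𝔎 →L[ℂ] H} {a : H →L[ℂ] H}
    (hξ : ξ ∈ hβ) (ha : a ∈ dualLeg V) :
    leg13 V ∘L amplify hβ α β (conj V a ∘L ket1 hβ α ξ) =
      idTensor (ltri hβ α α) β β a ∘L leg13 V ∘L ket1 hβ (rtri α β α) ξ := by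
  have m := hV.module
  refine ext_ket1 m.module_α m.module_β fun y hy => ?_
  have e1 := hV.swap23_tensorId_ket2 hy
  have e2 : tensorId α β (ltri hβ α α) (ket2 hβ α y) ∘L idTensor α β β a =
      idTensor (ltri hβ α α) β β a ∘L tensorId α β (ltri hβ α α) (ket2 hβ α y) :=
    tensorId_comp_idTensor m.module_α m.module_β hV.ltri_hβ_α_α m.module_β
      (fun _ h => mem_ltri hy h) (hV.dualLeg_le ha)
  have e3 : leg13 V ∘L rearrangeInv hβ α β ∘L ket2 (rtri hβ α β) α y =
      tensorId α β (ltri hβ α α) (ket2 hβ α y) ∘L opOf V := by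
    rw [← e1, leg13]
    simp only [assoc_comp]
    rw [← comp_assoc (rearrange hβ α β), hV.rearrange_comp_rearrangeInv, id_comp]
  have e4 : opOf V ∘L conj V a = idTensor α β β a ∘L opOf V := by
    rw [conj, ← comp_assoc, opOf_comp_adjoint, id_comp]
  calc _ = (leg13 V ∘L rearrangeInv hβ α β ∘L ket2 (rtri hβ α β) α y) ∘L
        conj V a ∘L ket1 hβ α ξ := by
        rw [comp_assoc, hV.amplify_comp_ket1 (hV.conj_comp_ket1_mem_semiMorphisms hreg hξ ha) hy]
        simp only [assoc_comp]
    _ = tensorId α β (ltri hβ α α) (ket2 hβ α y) ∘L (opOf V ∘L conj V a) ∘L ket1 hβ α ξ := by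
        rw [e3]; simp only [assoc_comp]
    _ = (tensorId α β (ltri hβ α α) (ket2 hβ α y) ∘L idTensor α β β a) ∘L
          opOf V ∘L ket1 hβ α ξ := by rw [e4]; simp only [assoc_comp]
    _ = _ := by
        rw [e2]
        simp only [assoc_comp]
        rw [hV.leg13_ket1_ket1 hξ hy]

end IsPseudoMultiplicativeUnitary

end Coassociativity

/-! ### Coassociativity from the pentagon equation -/

section Coassociativity

variable {𝔎 H : Type*} [NormedAddCommGroup 𝔎] [InnerProductSpace ℂ 𝔎] [CompleteSpace 𝔎]
  [NormedAddCommGroup H] [InnerProductSpace ℂ H] [CompleteSpace H]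
  {𝔟 : CStarBase 𝔎} {hβ α β : Submodule ℂ (𝔎 →L[ℂ] H)} {V : RTP hβ α ≃ₗᵢ[ℂ] RTP α β}

/-- `V₂₃ V₁₂`. -/
def legs (V : RTP hβ α ≃ₗᵢ[ℂ] RTP α β) :
    RTP (rtri hβ α hβ) α →L[ℂ] RTP α (ltri α β β) :=
  idTensor α (ltri hβ α β) (ltri α β β) (opOf V) ∘L assoc α β hβ α ∘L
    tensorId (rtri hβ α hβ) α (rtri α β hβ) (opOf V)

namespace IsPseudoMultiplicativeUnitary

variable (hV : IsPseudoMultiplicativeUnitary 𝔟 hβ α β V)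

include hV

theorem legs_eq : legs V = assoc α β α β ∘L tensorId (ltri hβ α α) β (rtri α β α) (opOf V) ∘L
    leg13 V ∘L idTensor hβ (ltri hβ α α) (rtri α β α) (opOf V) ∘L assoc hβ α hβ α := by
  rw [legs, ← hV.pentagon, leg13, rearrange]
  simp only [assoc_comp]

/-- V₂₃V₁₂ has a left inverse, assembled from V† on the two pairs of legs. Identities may therefore
be checked after applying it, where the pentagon equation is available. -/
theorem legs_cancel {E : Type*} [NormedAddCommGroup E] [NormedSpace ℂ E]
    {X Y : E →L[ℂ] RTP (rtri hβ α hβ) α} (h : legs V ∘L X = legs V ∘L Y) : X = Y := by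
  have m := hV.module
  have e1 : tensorId (rtri α β hβ) α (rtri hβ α hβ) (adjoint (opOf V)) ∘L
      tensorId (rtri hβ α hβ) α (rtri α β hβ) (opOf V) = ContinuousLinearMap.id ℂ _ := by
    have e := tensorId_comp (𝔟 := 𝔟.dagger) hV.rtri_hβ_α_hβ m.module_α hV.rtri_α_β_hβ
      hV.rtri_hβ_α_hβ hV.opOf₃ (adjoint_opOf_mem_semiMorphisms hV.map_hβ_hβ)
    rw [← e, adjoint_opOf_comp]
    exact tensorId_id (𝔟 := 𝔟.dagger) hV.rtri_hβ_α_hβ m.module_α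
  have e2 : assocInv α β hβ α ∘L assoc α β hβ α = ContinuousLinearMap.id ℂ _ :=
    assocInv_comp_assoc (𝔟 := 𝔟) (𝔠 := 𝔟.dagger) m.module_α m.module_β m.module_hβ m.module_α
      m.compatible_β_hβ m.compatible_hβ_β
  have e3 : idTensor α (ltri α β β) (ltri hβ α β) (adjoint (opOf V)) ∘L
      idTensor α (ltri hβ α β) (ltri α β β) (opOf V) = ContinuousLinearMap.id ℂ _ := by
    rw [← idTensor_comp m.module_α hV.ltri_hβ_α_β hV.ltri_α_β_β hV.ltri_hβ_α_β hV.opOf₄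
      (adjoint_opOf_mem_semiMorphisms hV.map_β_α), adjoint_opOf_comp]
    exact idTensor_id m.module_α hV.ltri_hβ_α_β
  have e : (tensorId (rtri α β hβ) α (rtri hβ α hβ) (adjoint (opOf V)) ∘L assocInv α β hβ α ∘L
      idTensor α (ltri α β β) (ltri hβ α β) (adjoint (opOf V))) ∘L legs V =
      ContinuousLinearMap.id ℂ _ := by
    rw [legs]
    simp only [assoc_comp]
    rw [← comp_assoc (idTensor _ _ _ _), e3, id_comp, ← comp_assoc (assocInv _ _ _ _), e2,
      id_comp, e1]
  rw [← id_comp X, ← id_comp Y, ← e, comp_assoc _ _ X, h, comp_assoc _ _ Y]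

theorem legs_comp_conjLeft {a : H →L[ℂ] H} (ha : a ∈ dualLeg V) :
    legs V ∘L conjLeft V (conj V a) =
      idTensor α (ltri α β β) (ltri α β β) (idTensor α β β a) ∘L legs V := by
  have m := hV.module
  have e1 : tensorId (rtri hβ α hβ) α (rtri α β hβ) (opOf V) ∘L
      tensorId (rtri α β hβ) α (rtri hβ α hβ) (adjoint (opOf V)) =
        ContinuousLinearMap.id ℂ _ := by
    have e := tensorId_comp (𝔟 := 𝔟.dagger) hV.rtri_α_β_hβ m.module_α hV.rtri_hβ_α_hβ
      hV.rtri_α_β_hβ (adjoint_opOf_mem_semiMorphisms hV.map_hβ_hβ) hV.opOf₃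
    rw [← e, opOf_comp_adjoint]
    exact tensorId_id (𝔟 := 𝔟.dagger) hV.rtri_α_β_hβ m.module_α
  have e2 : assoc α β hβ α ∘L assocInv α β hβ α = ContinuousLinearMap.id ℂ _ :=
    assoc_comp_assocInv (𝔟 := 𝔟) (𝔠 := 𝔟.dagger) m.module_α m.module_β m.module_hβ m.module_α
      m.compatible_β_hβ m.compatible_hβ_β
  have e3 : idTensor α (ltri hβ α β) (ltri α β β) (opOf V) ∘L
      idTensor α (ltri hβ α β) (ltri hβ α β) (conj V a) =
      idTensor α (ltri α β β) (ltri α β β) (idTensor α β β a) ∘L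
        idTensor α (ltri hβ α β) (ltri α β β) (opOf V) := by
    rw [← idTensor_comp m.module_α hV.ltri_hβ_α_β hV.ltri_hβ_α_β hV.ltri_α_β_β
        (hV.conj_mem_semiMorphisms ha) hV.opOf₄,
      ← idTensor_comp m.module_α hV.ltri_hβ_α_β hV.ltri_α_β_β hV.ltri_α_β_β hV.opOf₄
        (hV.idTensor_mem_semiMorphisms ha), conj, ← comp_assoc (opOf V), opOf_comp_adjoint,
      id_comp]
  rw [legs, conjLeft]
  simp only [assoc_comp]
  rw [← comp_assoc (tensorId (rtri hβ α hβ) α (rtri α β hβ) (opOf V)), e1, id_comp,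
    ← comp_assoc (assoc α β hβ α) (assocInv α β hβ α), e2, id_comp, ← comp_assoc, e3, comp_assoc]

/-- The action of a on the third leg does not depend on the bracketing. -/
theorem idTensor_comp_assoc {a : H →L[ℂ] H} (ha : a ∈ dualLeg V) :
    idTensor α (ltri α β β) (ltri α β β) (idTensor α β β a) ∘L assoc α β α β =
      assoc α β α β ∘L idTensor (rtri α β α) β β a := by
  have m := hV.module
  have h : ∀ s ∈ β, assoc α β α β ∘L ket2 (rtri α β α) β s =
      idTensor α β (ltri α β β) (ket2 α β s) := fun s hs =>
    assoc_ket2 (𝔟 := 𝔟) (𝔠 := 𝔟) m.module_α m.module_β m.module_α m.module_β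
      m.compatible_β_α m.compatible_α_β hs
  refine ext_ket2 hV.rtri_α_β_α m.module_β fun s hs => ?_
  rw [comp_assoc, h s hs, comp_assoc,
    idTensor_ket2 hV.rtri_α_β_α m.module_β m.module_β (hV.dualLeg_le ha) hs,
    h _ (hV.dualLeg_le ha s hs),
    ← idTensor_comp m.module_α m.module_β hV.ltri_α_β_β hV.ltri_α_β_β
      (fun _ hX => mem_ltri hs hX) (hV.idTensor_mem_semiMorphisms ha),
    idTensor_ket2 m.module_α m.module_β m.module_β (hV.dualLeg_le ha) hs]

theorem assoc_comp_assocInv_hβ : assoc hβ α hβ α ∘L assocInv hβ α hβ α =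
    ContinuousLinearMap.id ℂ _ :=
  have m := hV.module
  assoc_comp_assocInv (𝔟 := 𝔟.dagger) (𝔠 := 𝔟.dagger) m.module_hβ m.module_α m.module_hβ
    m.module_α m.compatible_α_hβ m.compatible_hβ_α

theorem assocInv_comp_assoc_hβ : assocInv hβ α hβ α ∘L assoc hβ α hβ α =
    ContinuousLinearMap.id ℂ _ :=
  have m := hV.module
  assocInv_comp_assoc (𝔟 := 𝔟.dagger) (𝔠 := 𝔟.dagger) m.module_hβ m.module_α m.module_hβ
    m.module_α m.compatible_α_hβ m.compatible_hβ_α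

theorem legs_comp_assocInv : legs V ∘L assocInv hβ α hβ α = assoc α β α β ∘L
    tensorId (ltri hβ α α) β (rtri α β α) (opOf V) ∘L leg13 V ∘L
      idTensor hβ (ltri hβ α α) (rtri α β α) (opOf V) := by
  rw [hV.legs_eq]
  simp only [assoc_comp]
  rw [hV.assoc_comp_assocInv_hβ, comp_id]

theorem conjLeft_comp_assocInv_comp_ket1 (hreg : IsRegular V) {ξ : 𝔎 →L[ℂ] H} {a : H →L[ℂ] H}
    (hξ : ξ ∈ hβ) (ha : a ∈ dualLeg V) :
    conjLeft V (conj V a) ∘L assocInv hβ α hβ α ∘L ket1 hβ (ltri hβ α α) ξ =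
      assocInv hβ α hβ α ∘L conjKet1 V (conj V a ∘L ket1 hβ α ξ) := by
  have m := hV.module
  have e1 : idTensor hβ (ltri hβ α α) (rtri α β α) (opOf V) ∘L ket1 hβ (ltri hβ α α) ξ =
      ket1 hβ (rtri α β α) ξ ∘L opOf V :=
    idTensor_ket1 (𝔟 := 𝔟.dagger) m.module_hβ hV.ltri_hβ_α_α hV.rtri_α_β_α hV.opOf₁ hξ
  have e2 : idTensor hβ (ltri hβ α α) (rtri α β α) (opOf V) ∘L
      idTensor hβ (rtri α β α) (ltri hβ α α) (adjoint (opOf V)) =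
        ContinuousLinearMap.id ℂ _ := by
    have e := idTensor_comp (𝔟 := 𝔟.dagger) m.module_hβ hV.rtri_α_β_α hV.ltri_hβ_α_α
      hV.rtri_α_β_α (adjoint_opOf_mem_semiMorphisms hV.map_α_α) hV.opOf₁
    rw [← e, opOf_comp_adjoint]
    exact idTensor_id (𝔟 := 𝔟.dagger) m.module_hβ hV.rtri_α_β_α
  have e3 : tensorId (ltri hβ α α) β (rtri α β α) (opOf V) ∘L idTensor (ltri hβ α α) β β a =
      idTensor (rtri α β α) β β a ∘L tensorId (ltri hβ α α) β (rtri α β α) (opOf V) :=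
    tensorId_comp_idTensor hV.ltri_hβ_α_α m.module_β hV.rtri_α_β_α m.module_β hV.opOf₁
      (hV.dualLeg_le ha)
  -- On the left, V₂₃V₁₂ carries the conjugate back to a on the third leg; the pentagon then
  -- replaces V₂₃V₁₂ by V₁₂V₁₃V₂₃, and a commutes with V₁₂. On the right, V₂₃ cancels V₂₃†, leaving
  -- V₁₃z₁₃ with z = Δ̂(a)|ξ⟩₁, which `leg13_comp_amplify` evaluates.
  refine hV.legs_cancel ?_
  calc _ = idTensor α (ltri α β β) (ltri α β β) (idTensor α β β a) ∘L
        (legs V ∘L assocInv hβ α hβ α) ∘L ket1 hβ (ltri hβ α α) ξ := by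
        rw [← comp_assoc, hV.legs_comp_conjLeft ha]; simp only [assoc_comp]
    _ = (idTensor α (ltri α β β) (ltri α β β) (idTensor α β β a) ∘L assoc α β α β) ∘L
        tensorId (ltri hβ α α) β (rtri α β α) (opOf V) ∘L leg13 V ∘L
          ket1 hβ (rtri α β α) ξ ∘L opOf V := by
        rw [hV.legs_comp_assocInv]; simp only [assoc_comp]; rw [e1]
    _ = assoc α β α β ∘L (idTensor (rtri α β α) β β a ∘L
        tensorId (ltri hβ α α) β (rtri α β α) (opOf V)) ∘L leg13 V ∘L
          ket1 hβ (rtri α β α) ξ ∘L opOf V := by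
        rw [hV.idTensor_comp_assoc ha]; simp only [assoc_comp]
    _ = assoc α β α β ∘L tensorId (ltri hβ α α) β (rtri α β α) (opOf V) ∘L
        (idTensor (ltri hβ α α) β β a ∘L leg13 V ∘L ket1 hβ (rtri α β α) ξ) ∘L opOf V := by
        rw [← e3]; simp only [assoc_comp]
    _ = (legs V ∘L assocInv hβ α hβ α) ∘L conjKet1 V (conj V a ∘L ket1 hβ α ξ) := by
        rw [← hV.leg13_comp_amplify hreg hξ ha, hV.legs_comp_assocInv, conjKet1]
        simp only [assoc_comp]
        rw [← comp_assoc (idTensor hβ (ltri hβ α α) (rtri α β α) (opOf V)), e2, id_comp]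
    _ = _ := by simp only [assoc_comp]

/-- `(id ∗ Δ̂)(Δ̂(a))`, as a conjugate of `(Δ̂ ∗ id)(Δ̂(a))`, commutes past `id ⊗ S`. -/
theorem assoc_conjLeft_comp_idTensor (hreg : IsRegular V) {a : H →L[ℂ] H} (ha : a ∈ dualLeg V)
    {S : H →L[ℂ] RTP hβ α} (hS : S ∈ intertwiners (dualLeg V) (dualComultiplication V))
    (hS' : S ∈ semiMorphisms α (ltri hβ α α)) :
    (assoc hβ α hβ α ∘L conjLeft V (conj V a) ∘L assocInv hβ α hβ α) ∘L
        idTensor hβ α (ltri hβ α α) S =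
      idTensor hβ α (ltri hβ α α) S ∘L conj V a := by
  have m := hV.module
  have e1 : ∀ ξ ∈ hβ, idTensor hβ α (ltri hβ α α) S ∘L ket1 hβ α ξ =
      ket1 hβ (ltri hβ α α) ξ ∘L S := fun ξ hξ =>
    idTensor_ket1 (𝔟 := 𝔟.dagger) m.module_hβ m.module_α hV.ltri_hβ_α_α hS' hξ
  refine ext_ket1 (𝔟 := 𝔟.dagger) m.module_hβ m.module_α fun ξ hξ => ?_
  have e2 : (assoc hβ α hβ α ∘L conjLeft V (conj V a) ∘L assocInv hβ α hβ α) ∘L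
      ket1 hβ (ltri hβ α α) ξ = conjKet1 V (conj V a ∘L ket1 hβ α ξ) := by
    rw [comp_assoc, comp_assoc, hV.conjLeft_comp_assocInv_comp_ket1 hreg hξ ha, ← comp_assoc,
      hV.assoc_comp_assocInv_hβ, id_comp]
  rw [comp_assoc, e1 ξ hξ, ← comp_assoc, e2, comp_assoc]
  refine (hV.bddLinOn_conjKet1.comp_right S).eq_of_cspan
    ((BddLinOn.of_clm (ContinuousLinearMap.id ℂ _)).comp_left
      (idTensor hβ α (ltri hβ α α) S))
    (isClosed_semiMorphismSpace hV.rtri_hβ_α_β.isClosed) ?_ ?_ (hV.conj_comp_ket1_mem hreg ha hξ)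
  · rintro _ ⟨ξ', hξ', b, hb, rfl⟩; exact hV.ket1_comp_mem hξ' hb
  · rintro _ ⟨ξ', hξ', b, hb, rfl⟩
    rw [hV.conjKet1_ket1_comp hξ' hb, ContinuousLinearMap.id_apply, ← comp_assoc, e1 ξ' hξ',
      comp_assoc, comp_assoc, hS b hb, hV.dualComultiplication_eq hb]

/-- Semi-normality makes the vectors (S ⊗ id)ω total, so Δ̂ ∗ id at Δ̂(a) is the only operator with
the defining relation, and the conjugate satisfies that relation. -/
theorem fiberMapLeft_eq {a : H →L[ℂ] H} (ha : a ∈ dualLeg V) :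
    fiberMapLeft hβ α (rtri hβ α hβ) (dualLeg V) (dualComultiplication V)
      (dualComultiplication V a) = conjLeft V (conj V a) := by
  have m := hV.module
  refine extendOp_eq ?_ fun p => ?_
  · refine cspan_eq_top (ket1_total (𝔟 := 𝔟.dagger) hV.rtri_hβ_α_hβ m.module_α
      (cspan_range_id (E := H))) ?_
    rintro _ ⟨⟨⟨X, hX⟩, k⟩, rfl⟩
    have hX' := hX
    rw [← hV.cspan_comp_eq_rtri] at hX'
    refine ((bddLinOn_ket1 (𝔟 := 𝔟.dagger) hV.rtri_hβ_α_hβ m.module_α).clm_comp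
      (ContinuousLinearMap.apply ℂ _ k)).mem_of_cspan hV.rtri_hβ_α_hβ.isClosed ?_
        (isClosed_cspan _) ?_ hX'
    · rintro _ ⟨S, hS, ξ, hξ, rfl⟩; exact hS.2.2 ξ hξ
    · rintro _ ⟨S, hS, ξ, hξ, rfl⟩
      have e : tensorId hβ α (rtri hβ α hβ) S ∘L ket1 hβ α ξ = ket1 (rtri hβ α hβ) α (S ∘L ξ) :=
        tensorId_ket1 (𝔟 := 𝔟.dagger) m.module_hβ m.module_α hV.rtri_hβ_α_hβ hS.2.2 hξ
      exact mem_cspan ⟨(⟨S, hS.1, hS.2.2⟩, ket1 hβ α ξ k), congrArg (fun f => f k) e⟩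
  · rw [hV.dualComultiplication_eq ha]
    exact congrArg (fun f => f p.2) (hV.conjLeft_comp_tensorId ha p.1.2.1 p.1.2.2)

theorem fiberMapRight_eq (hreg : IsRegular V) {a : H →L[ℂ] H} (ha : a ∈ dualLeg V) :
    fiberMapRight hβ α (ltri hβ α α) (dualLeg V) (dualComultiplication V)
      (dualComultiplication V a) =
        assoc hβ α hβ α ∘L conjLeft V (conj V a) ∘L assocInv hβ α hβ α := by
  have m := hV.module
  refine extendOp_eq ?_ fun p => ?_
  · refine cspan_eq_top (ket2_total (𝔟 := 𝔟.dagger) m.module_hβ hV.ltri_hβ_α_α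
      (cspan_range_id (E := H))) ?_
    rintro _ ⟨⟨⟨X, hX⟩, k⟩, rfl⟩
    have hX' := hX
    rw [← hV.cspan_comp_eq_ltri] at hX'
    refine ((bddLinOn_ket2 (𝔟 := 𝔟.dagger) m.module_hβ hV.ltri_hβ_α_α).clm_comp
      (ContinuousLinearMap.apply ℂ _ k)).mem_of_cspan hV.ltri_hβ_α_α.isClosed ?_
        (isClosed_cspan _) ?_ hX'
    · rintro _ ⟨S, hS, ξ, hξ, rfl⟩; exact hS.2.1 ξ hξ
    · rintro _ ⟨S, hS, ξ, hξ, rfl⟩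
      have e : idTensor hβ α (ltri hβ α α) S ∘L ket2 hβ α ξ = ket2 hβ (ltri hβ α α) (S ∘L ξ) :=
        idTensor_ket2 (𝔟 := 𝔟.dagger) m.module_hβ m.module_α hV.ltri_hβ_α_α hS.2.1 hξ
      exact mem_cspan ⟨(⟨S, hS.1, hS.2.1⟩, ket2 hβ α ξ k), congrArg (fun f => f k) e⟩
  · rw [hV.dualComultiplication_eq ha]
    exact congrArg (fun f => f p.2)
      (hV.assoc_conjLeft_comp_idTensor hreg ha p.1.2.1 p.1.2.2)

theorem isHopfBimodule (hreg : IsRegular V) :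
    IsHopfBimodule 𝔟.dagger α hβ (dualLeg V) (dualComultiplication V) where
  algebra := hV.isCStarBiAlgebra hreg
  map_add := fun a ha a' ha' => by
    rw [hV.dualComultiplication_eq ha, hV.dualComultiplication_eq ha',
      hV.dualComultiplication_eq ((dualLeg V).add_mem ha ha')]
    exact hV.bddLinOn_conj.add _ (hV.dualLeg_le ha) _ (hV.dualLeg_le ha')
  map_smul := fun z a ha => by
    rw [hV.dualComultiplication_eq ha,
      hV.dualComultiplication_eq ((dualLeg V).smul_mem z ha)]
    exact hV.bddLinOn_conj.smul z _ (hV.dualLeg_le ha)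
  map_mul := fun a ha a' ha' => by
    rw [hV.dualComultiplication_eq ha, hV.dualComultiplication_eq ha',
      hV.dualComultiplication_eq (hV.comp_mem_dualLeg hreg ha ha'), hV.conj_comp ha ha']
  map_star := fun a ha => by
    rw [hV.dualComultiplication_eq ha,
      hV.dualComultiplication_eq (hV.adjoint_mem_dualLeg hreg ha), hV.adjoint_conj hreg ha]
  mem_fiberProduct := fun _ ha => hV.dualComultiplication_mem_fiberProduct hreg ha
  seminormal_left := hV.cspan_comp_eq_ltri
  seminormal_right := hV.cspan_comp_eq_rtri
  coassoc := fun a ha => by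
    rw [hV.fiberMapLeft_eq ha, hV.fiberMapRight_eq hreg ha]
    simp only [assoc_comp]
    rw [hV.assocInv_comp_assoc_hβ, comp_id]

end IsPseudoMultiplicativeUnitary

end Coassociativity

/-! ### Compression by a cofixed element is a Haar weight -/

section HaarWeight

variable {𝔎 H : Type*} [NormedAddCommGroup 𝔎] [InnerProductSpace ℂ 𝔎] [CompleteSpace 𝔎]
  [NormedAddCommGroup H] [InnerProductSpace ℂ H] [CompleteSpace H]
  {𝔟 : CStarBase 𝔎} {hβ α β : Submodule ℂ (𝔎 →L[ℂ] H)} {V : RTP hβ α ≃ₗᵢ[ℂ] RTP α β}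

theorem rho_comp_of_mem_multiplierSpace (hα : IsCStarModule 𝔟 α) {ξ : 𝔎 →L[ℂ] H}
    (hξ : ξ ∈ multiplierSpace 𝔟.B α) {c : 𝔎 →L[ℂ] 𝔎} (hc : c ∈ 𝔟.Bd) :
    rho α c ∘L ξ = ξ ∘L c :=
  CStarBase.ext_B (𝔟 := 𝔟) fun b hb => by
    have e : b ∘L c = c ∘L b := (𝔟.commute b hb c hc).eq
    rw [comp_assoc, rho_comp hα hc (hξ.1 b hb), comp_assoc, e, comp_assoc]

theorem isCompletelyPositive_compression (A : Submodule ℂ (H →L[ℂ] H)) (ξ : 𝔎 →L[ℂ] H) :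
    IsCompletelyPositive A (compression A ξ) := fun n M hM ζ => by
  refine (hM fun i => ξ (ζ i)).trans_eq ?_
  refine Finset.sum_congr rfl fun i _ => Finset.sum_congr rfl fun j _ => ?_
  exact (adjoint_inner_right ξ _ _).symm

theorem norm_compression_le (A : Submodule ℂ (H →L[ℂ] H)) {ξ : 𝔎 →L[ℂ] H}
    (hξ : adjoint ξ ∘L ξ = ContinuousLinearMap.id ℂ 𝔎) (a : A) :
    ‖compression A ξ a‖ ≤ ‖a‖ := by
  have h1 : ‖ξ‖ ≤ 1 := by
    have h : ‖ξ‖ * ‖ξ‖ ≤ 1 := by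
      rw [← norm_adjoint_comp_self, hξ]; exact norm_id_le
    nlinarith [norm_nonneg ξ]
  have h2 : ‖adjoint ξ‖ ≤ 1 := by rwa [LinearIsometryEquiv.norm_map]
  calc ‖compression A ξ a‖ ≤ ‖adjoint ξ‖ * ‖(a : H →L[ℂ] H) ∘L ξ‖ := opNorm_comp_le _ _
    _ ≤ 1 * (‖(a : H →L[ℂ] H)‖ * 1) := by
        gcongr
        exact (opNorm_comp_le _ _).trans (by gcongr)
    _ = ‖a‖ := by rw [one_mul, mul_one]; rfl

theorem isNormalMap_compression (A : Submodule ℂ (H →L[ℂ] H)) {ξ : 𝔎 →L[ℂ] H}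
    {B : NonUnitalStarSubalgebra ℂ (𝔎 →L[ℂ] 𝔎)} (hξ : ξ ∈ multiplierSpace B α) :
    IsNormalMap B α A (compression A ξ) := by
  -- Both sequences are ξ, 0, 0, …, so each of the series has a single nonzero term.
  have hmem : ∀ k : ℕ, (if k = 0 then ξ else 0) ∈ multiplierSpace B α := fun k => by
    split_ifs
    · exact hξ
    · refine ⟨fun b _ => ?_, fun x _ => ?_⟩
      · rw [zero_comp]; exact α.zero_mem
      · rw [map_zero, zero_comp]; exact B.zero_mem
  have hsum : Summable fun k : ℕ =>
      adjoint (if k = 0 then ξ else 0) ∘L (if k = 0 then ξ else 0) :=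
    (hasSum_single 0 fun k hk => by rw [if_neg hk, comp_zero]).summable
  refine ⟨_, _, hmem, hmem, hsum, hsum, fun a => ?_⟩
  convert hasSum_single (f := fun k : ℕ => adjoint (if k = 0 then ξ else 0) ∘L
    (a : H →L[ℂ] H) ∘L (if k = 0 then ξ else 0)) 0 fun k hk => by
      rw [if_neg hk, comp_zero, comp_zero] using 1
  rw [if_pos rfl]; rfl

namespace IsPseudoMultiplicativeUnitary

variable (hV : IsPseudoMultiplicativeUnitary 𝔟 hβ α β V)

include hV

/-- By Â = [Âρ_α(𝔅†)] it is enough to treat bρ_α(c). Since ξ ∈ M(α), ρ_α(c)ξ = ξc; since ξ ∈ M(β),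
ξc ∈ β; then bξc ∈ β because Â preserves β, and ξ†β ⊆ 𝔅†. -/
theorem compression_mem (hreg : IsRegular V) {ξ : 𝔎 →L[ℂ] H} (hξ : IsCofixed 𝔟 V ξ)
    (a : dualLeg V) : compression (dualLeg V) ξ a ∈ 𝔟.dagger.B := by
  have h := ((BddLinOn.of_clm (P := (⊤ : Submodule ℂ (H →L[ℂ] H)))
    (ContinuousLinearMap.id ℂ _)).comp_right ξ).comp_left (adjoint ξ)
  refine h.mem_of_cspan (Y := 𝔟.dagger.subB) isClosed_univ (fun _ _ => Submodule.mem_top)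
    𝔟.isClosed_Bd ?_ (hV.dualLeg_le_cspan_comp_rho hreg a.2)
  rintro _ ⟨b, hb, c, hc, rfl⟩
  rw [ContinuousLinearMap.id_apply, comp_assoc,
    rho_comp_of_mem_multiplierSpace hV.module.module_α hξ.mem_α hc]
  exact hξ.mem_β.2 _ (hV.dualLeg_le hb _ (hξ.mem_β.1 c hc))

theorem bra1_dualComultiplication_ket1_mem (hreg : IsRegular V) {a : H →L[ℂ] H}
    (ha : a ∈ dualLeg V) {ξ ξ' : 𝔎 →L[ℂ] H} (hξ : ξ ∈ hβ) (hξ' : ξ' ∈ hβ) :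
    bra1 hβ α ξ ∘L dualComultiplication V a ∘L ket1 hβ α ξ' ∈ dualLeg V := by
  have m := hV.module
  rw [hV.dualComultiplication_eq ha]
  refine comp_mem_of_cspan_right _ (isClosed_cspan _) ?_ (hV.conj_comp_ket1_mem hreg ha hξ')
  rintro _ ⟨x, hx, b, hb, rfl⟩
  have e : bra1 hβ α ξ ∘L ket1 hβ α x = rho α (adjoint ξ ∘L x) :=
    bra1_comp_ket1 (𝔟 := 𝔟.dagger) m.module_hβ m.module_α hξ hx
  rw [← comp_assoc, e]
  exact hV.rho_α_comp_mem (m.module_hβ.inner_mem hξ hx) hb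

/-- The multiplier exchange rule turns |ξ⟩₁ξ₀ into |ξ₀⟩₂ξ, on which V acts by the cofixed property.
This identity and its adjoint remove V and V† from Δ̂(a) in the left invariance formula. -/
theorem ket1_comp_cofixed {ξ₀ ξ : 𝔎 →L[ℂ] H} (h₀ : IsCofixed 𝔟 V ξ₀) (hξ : ξ ∈ hβ) :
    opOf V ∘L ket1 hβ α ξ ∘L ξ₀ = ket2 α β ξ₀ ∘L ξ := by
  have e : ket2 hβ α ξ₀ ∘L ξ = ket1 hβ α ξ ∘L ξ₀ :=
    ket2_comp' (𝔟 := 𝔟.dagger) hV.module.module_hβ hV.module.module_α hξ h₀.mem_α.2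
  rw [← e, ← comp_assoc, h₀.cofixed]

/-- Tested on y ∈ α, |ξ₀⟩₂y = |y⟩₁ξ₀ lets id ⊗ a act on ξ₀, and ⟨ξ₀|₂|y⟩₁ = yξ₀† leaves yξ₀†aξ₀. -/
theorem bra2_idTensor_ket2_cofixed (hreg : IsRegular V) {ξ₀ : 𝔎 →L[ℂ] H}
    (h₀ : IsCofixed 𝔟 V ξ₀) (a : dualLeg V) :
    bra2 α β ξ₀ ∘L idTensor α β β (a : H →L[ℂ] H) ∘L ket2 α β ξ₀ =
      rho α (compression (dualLeg V) ξ₀ a) := by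
  have m := hV.module
  refine rho_eq m.module_α (hV.compression_mem hreg h₀ a) fun y hy => ?_
  rw [comp_assoc, comp_assoc, ket2_comp' m.module_α m.module_β hy h₀.mem_β.2,
    ← comp_assoc (idTensor _ _ _ _),
    idTensor_ket1 m.module_α m.module_β m.module_β (hV.dualLeg_le a.2) hy, comp_assoc,
    ← comp_assoc, bra2_comp_ket1' m.module_α m.module_β hy h₀.mem_β.2, comp_assoc]
  rfl

theorem compression_bra1_dualComultiplication_ket1 (hreg : IsRegular V) {ξ₀ : 𝔎 →L[ℂ] H}
    (h₀ : IsCofixed 𝔟 V ξ₀) (a : dualLeg V) {ξ ξ' : 𝔎 →L[ℂ] H} (hξ : ξ ∈ hβ) (hξ' : ξ' ∈ hβ) :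
    adjoint ξ₀ ∘L (bra1 hβ α ξ ∘L dualComultiplication V a ∘L ket1 hβ α ξ') ∘L ξ₀ =
      adjoint ξ ∘L rho α (compression (dualLeg V) ξ₀ a) ∘L ξ' := by
  have e := congrArg adjoint (hV.ket1_comp_cofixed h₀ hξ)
  simp only [adjoint_comp, adjoint_ket1, adjoint_ket2] at e
  rw [hV.dualComultiplication_eq a.2, ← hV.bra2_idTensor_ket2_cofixed hreg h₀ a, conj]
  simp only [assoc_comp]
  rw [hV.ket1_comp_cofixed h₀ hξ']
  have e' := congrArg (fun f => f ∘L idTensor α β β (a : H →L[ℂ] H) ∘L ket2 α β ξ₀ ∘L ξ') e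
  simp only [assoc_comp] at e'
  exact e'

theorem isNormalBoundedLeftHaarWeight (hreg : IsRegular V) {ξ₀ : 𝔎 →L[ℂ] H}
    (h₀ : IsCofixed 𝔟 V ξ₀) (h₁ : adjoint ξ₀ ∘L ξ₀ = ContinuousLinearMap.id ℂ 𝔎) :
    IsNormalBoundedLeftHaarWeight 𝔟.dagger α hβ (dualLeg V) (dualComultiplication V)
      (compression (dualLeg V) ξ₀) where
  haar :=
    { hopf := hV.isHopfBimodule hreg
      mem := hV.compression_mem hreg h₀
      completelyPositive := isCompletelyPositive_compression _ _
      contractive := norm_compression_le _ h₁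
      map_mul_rho := fun a b hb => ⟨hV.comp_rho_α_mem hreg hb a.2, by
        have e := rho_comp_of_mem_multiplierSpace hV.module.module_α h₀.mem_α hb
        change adjoint ξ₀ ∘L (a.1 ∘L rho α b) ∘L ξ₀ = (adjoint ξ₀ ∘L a.1 ∘L ξ₀) ∘L b
        simp only [assoc_comp]
        rw [e]⟩
      left_invariant := fun a ξ hξ ξ' hξ' =>
        ⟨hV.bra1_dualComultiplication_ket1_mem hreg a.2 hξ hξ',
          hV.compression_bra1_dualComultiplication_ket1 hreg h₀ a hξ hξ'⟩ }
  normal := isNormalMap_compression _ h₀.mem_α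

end IsPseudoMultiplicativeUnitary

end HaarWeight

end CPMU

end

theorem mainTheorem11 {𝔎 H : Type*} [NormedAddCommGroup 𝔎] [InnerProductSpace ℂ 𝔎]
    [CompleteSpace 𝔎] [NormedAddCommGroup H] [InnerProductSpace ℂ H] [CompleteSpace H]
    (𝔟 : CPMU.CStarBase 𝔎) (hβ α β : Submodule ℂ (𝔎 →L[ℂ] H))
    (V : CPMU.RTP hβ α ≃ₗᵢ[ℂ] CPMU.RTP α β)
    (hV : CPMU.IsPseudoMultiplicativeUnitary 𝔟 hβ α β V)
    (hreg : CPMU.IsRegular V) (hproper : CPMU.IsProper 𝔟 V) :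
    (∃ φ : CPMU.dualLeg V →ₗ[ℂ] (𝔎 →L[ℂ] 𝔎),
      CPMU.IsNormalBoundedLeftHaarWeight 𝔟.dagger α hβ (CPMU.dualLeg V)
        (CPMU.dualComultiplication V) φ) ∧
    ∀ ξ₀ : 𝔎 →L[ℂ] H, CPMU.IsCofixed 𝔟 V ξ₀ →
      adjoint ξ₀ ∘L ξ₀ = ContinuousLinearMap.id ℂ 𝔎 →
      CPMU.IsNormalBoundedLeftHaarWeight 𝔟.dagger α hβ (CPMU.dualLeg V)
        (CPMU.dualComultiplication V) (CPMU.compression (CPMU.dualLeg V) ξ₀) :=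
  have h := fun ξ₀ => hV.isNormalBoundedLeftHaarWeight hreg (ξ₀ := ξ₀)
  ⟨hproper.elim fun ξ₀ hξ₀ => ⟨_, h ξ₀ hξ₀.1 hξ₀.2⟩, h⟩
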